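/- Let $n\ge 1$, $0\le m_1<m$. Let $A^0,A^1,\dots,A^n,L$ be real constant $m\times m$ matrices and $Q^1,\dots,Q^n,R$ real constant $m_1\times m$ matrices. For $\omega\in S^{n-1}$ put $A(\omega)=\sum_j\omega_jA^j$ and $Q(\omega)=\sum_j\omega_jQ^j$. For a real square matrix $X$ let $X_1=\frac12(X+X^T)$ and $X_2=\frac12(X-X^T)$. Matrices act on $\mathbb C^m$, kernels are taken in $\mathbb C^m$, and $X\ge0$ (resp. $X>0$) on a subspace $V$ means $\mathrm{Re}\langle X\varphi,\varphi\rangle\ge0$ for all $\varphi\in V$ (resp. $>0$ for all $0\ne\varphi\in V$). Let $\Pi_1$ be the orthogonal projection of $\mathbb C^{m_1}$ onto $\mathrm{Image}(R)$, and $\Pi_2=I-\Pi_1$. Assume: (A) $A^0,\dots,A^n$ are symmetric, $A^0>0$ and $L\ge0$ on $\mathbb C^m$, and $\mathrm{Ker}(L)\neq\{0\}$. (C) For all $\omega\in S^{n-1}$: $Q(\omega)(A^0)^{-1}A(\omega)=0$, $\;Q(\omega)(A^0)^{-1}L+R(A^0)^{-1}A(\omega)=0$, and $R(A^0)^{-1}L=0$.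 (S) $S$ is a real $m\times m$ matrix with $(SA^0)^T=SA^0$, $\;(SL)_1+L_1\ge0$ on $\mathbb C^m$, and $\mathrm{Ker}((SL)_1+L_1)=\mathrm{Ker}(L)$. (S*)$_1$ For the same $S$, for all $\omega\in S^{n-1}$ and $\rho>0$: $\; i(SA(\omega))_2\ge0$ on $\mathrm{Ker}(L_1)\cap\{\varphi\in\mathbb C^m:\ i\rho\,Q(\omega)\varphi+R\varphi=0\}$. (K*) $K$ is a smooth real-$m\times m$-matrix-valued function on $S^{n-1}$ with, for all $\omega\in S^{n-1}$, $K(-\omega)=-K(\omega)$, $\;(K(\omega)A^0)^T=-K(\omega)A^0$, and $(K(\omega)A(\omega))_1>0$ on $\mathrm{Ker}(L)\cap\mathrm{Ker}(\Pi_2Q(\omega))$. Consider the Cauchy problem $$A^0w_t+\sum_{j=1}^nA^jw_{x_j}+Lw=0\quad(t>0,\ x\in\mathbb R^n),\qquad w|_{t=0}=w_0, \tag{1}$$ with values in $\mathbb R^m$ or, more generally, in $\mathbb C^m$. Solutions are understood as functions of $t\ge0$ with values in the tempered distributions on $\mathbb R^n$, weakly continuous on $[0,\infty)$ and weakly differentiable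 in $t$ on $(0,\infty)$. Consider also the constraint, in the sense of distributions, $$\sum_{j=1}^nQ^jw_{x_j}+Rw=0. \tag{2}$$ Write $\gamma_2(q,p)=\frac n2\left(\frac1q-\frac1p\right)$, and let $\|\partial_x^kw\|_{L^p}$ be the sum of the $L^p$ norms of all the partial derivatives of order $k$. (i) If $1\le q,r\le2$, $l\ge0$ is an integer, and $w_0\in W^{l,r}\cap L^q$ satisfies (2), then (1) has exactly one solution $w$, and $w(t)$ satisfies (2) for all $t>0$. (ii) Let $1\le q,r\le2\le p\le\infty$, and let $k,\ell\ge0$ be integers with $\ell>n\left(\frac1r-\frac1p\right)$, where $\ell\ge0$ suffices if $p=r=2$. There is a constant $C>0$, which does not depend on $w_0$ and $t$, such that for every integer $l\ge k+\ell$ and every $w_0\in W^{l,r}\cap L^q$ that satisfies (2), the solution $w$ of (1) has all its spatial derivatives of order $k$ in $L^p$, and $$\|\partial_x^kw(t)\|_{L^p}\le C(1+t)^{-\gamma_2(q,p)-\frac k2}\|w_0\|_{L^q}+C(1+t)^{-\frac\ell2+\gamma_2(r,p)}\|\partial_x^{k+\ell}w_0\|_{L^r}\qquad(t\ge0).$$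 -/

import Mathlib

open MeasureTheory
open scoped ENNReal Matrix SchwartzMap LineDeriv

noncomputable section

namespace HypSys

/-- Physical (and frequency) space `ℝⁿ` with its Euclidean norm. -/
abbrev Space (n : ℕ) := EuclideanSpace ℝ (Fin n)

/-- State space `ℂᵐ` (it contains `ℝᵐ`) with its Hermitian inner product. -/
abbrev State (m : ℕ) := EuclideanSpace ℂ (Fin m)

/-! ### Matrices -/

/-- A real matrix regarded as a complex one. -/
def cplx {a b : ℕ} (M : Matrix (Fin a) (Fin b) ℝ) : Matrix (Fin a) (Fin b) ℂ :=
  M.map Complex.ofReal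

/-- The linear map `ℂᵇ → ℂᵃ` given by a real `a × b` matrix. -/
def act {a b : ℕ} (M : Matrix (Fin a) (Fin b) ℝ) : State b →ₗ[ℂ] State a :=
  (cplx M).toEuclideanLin

/-- The symmetric part `X₁ = (X + Xᵀ)/2`. -/
def symPart {m : ℕ} (X : Matrix (Fin m) (Fin m) ℝ) : Matrix (Fin m) (Fin m) ℝ :=
  (1 / 2 : ℝ) • (X + Xᵀ)

/-- The skew-symmetric part `X₂ = (X - Xᵀ)/2`. -/
def skewPart {m : ℕ} (X : Matrix (Fin m) (Fin m) ℝ) : Matrix (Fin m) (Fin m) ℝ :=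
  (1 / 2 : ℝ) • (X - Xᵀ)

/-- `Ker X ⊆ ℂᵇ` of a real matrix `X`. -/
def Ker {a b : ℕ} (X : Matrix (Fin a) (Fin b) ℝ) : Submodule ℂ (State b) :=
  LinearMap.ker (act X)

/-- `Re ⟨X φ, φ⟩`. (Mathlib's inner product is conjugate-linear in its first argument.) -/
def reForm {m : ℕ} (X : Matrix (Fin m) (Fin m) ℂ) (φ : State m) : ℝ :=
  (inner ℂ φ (X.toEuclideanLin φ)).re

/-- `X ≥ 0` on the subspace `V`. -/
def NonnegOn {m : ℕ} (X : Matrix (Fin m) (Fin m) ℂ) (V : Submodule ℂ (State m)) : Prop :=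
  ∀ φ ∈ V, 0 ≤ reForm X φ

/-- `X > 0` on the subspace `V`. -/
def PosOn {m : ℕ} (X : Matrix (Fin m) (Fin m) ℂ) (V : Submodule ℂ (State m)) : Prop :=
  ∀ φ ∈ V, φ ≠ 0 → 0 < reForm X φ

/-- The symbol `M(ω) = ∑ⱼ ωⱼ Mʲ` of a family `M¹, …, Mⁿ`. -/
def symbol {n a b : ℕ} (M : Fin n → Matrix (Fin a) (Fin b) ℝ) (ω : Space n) :
    Matrix (Fin a) (Fin b) ℝ :=
  ∑ j, ω j • M j

/-- The unit sphere `Sⁿ⁻¹`. -/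
def unitSphere (n : ℕ) : Set (Space n) := Metric.sphere 0 1

/-- `Π₁`: the orthogonal projection of `ℂ^{m₁}` onto `Image R`. -/
def proj₁ {m m₁ : ℕ} (R : Matrix (Fin m₁) (Fin m) ℝ) : State m₁ →ₗ[ℂ] State m₁ :=
  ((LinearMap.range (act R)).starProjection : State m₁ →L[ℂ] State m₁).toLinearMap

/-- `Π₂ = I - Π₁`. -/
def proj₂ {m m₁ : ℕ} (R : Matrix (Fin m₁) (Fin m) ℝ) : State m₁ →ₗ[ℂ] State m₁ :=
  LinearMap.id - proj₁ R

/-- The space of all `φ ∈ ℂᵐ` with `i r Q(ω) φ + R φ = 0`: the Fourier modes at the frequency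
`ξ = r ω` that satisfy the differential constraint. -/
def constraintModes {n m m₁ : ℕ} (Q : Fin n → Matrix (Fin m₁) (Fin m) ℝ)
    (R : Matrix (Fin m₁) (Fin m) ℝ) (r : ℝ) (ω : Space n) : Submodule ℂ (State m) :=
  LinearMap.ker ((Complex.I * (r : ℂ)) • act (symbol Q ω) + act R)

/-! ### Structural conditions -/

/-- Condition (A). -/
structure ConditionA {n m : ℕ} (A₀ : Matrix (Fin m) (Fin m) ℝ)
    (A : Fin n → Matrix (Fin m) (Fin m) ℝ) (L : Matrix (Fin m) (Fin m) ℝ) : Prop where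
  symm_A₀ : A₀ᵀ = A₀
  symm_A : ∀ j, (A j)ᵀ = A j
  pos_A₀ : PosOn (cplx A₀) ⊤
  nonneg_L : NonnegOn (cplx L) ⊤
  ker_L : Ker L ≠ ⊥

/-- Condition (C), on the compatibility of the constraint with the system. -/
structure ConditionC {n m m₁ : ℕ} (A₀ : Matrix (Fin m) (Fin m) ℝ)
    (A : Fin n → Matrix (Fin m) (Fin m) ℝ) (L : Matrix (Fin m) (Fin m) ℝ)
    (Q : Fin n → Matrix (Fin m₁) (Fin m) ℝ) (R : Matrix (Fin m₁) (Fin m) ℝ) : Prop where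
  second_order : ∀ ω ∈ unitSphere n, symbol Q ω * A₀⁻¹ * symbol A ω = 0
  first_order : ∀ ω ∈ unitSphere n, symbol Q ω * A₀⁻¹ * L + R * A₀⁻¹ * symbol A ω = 0
  zeroth_order : R * A₀⁻¹ * L = 0

/-- Condition (S) for the real matrix `S`. -/
structure ConditionS {m : ℕ} (A₀ L S : Matrix (Fin m) (Fin m) ℝ) : Prop where
  symm : (S * A₀)ᵀ = S * A₀
  nonneg : NonnegOn (cplx (symPart (S * L) + symPart L)) ⊤
  ker_eq : Ker (symPart (S * L) + symPart L) = Ker L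

/-- Condition (S*)₁ for the matrix `S` of condition (S): `i (S A(ω))₂ ≥ 0` on the part of
`Ker L₁` that satisfies the constraint in Fourier space, at every frequency `ξ = r ω ≠ 0`. -/
def ConditionSStar₁ {n m m₁ : ℕ} (A : Fin n → Matrix (Fin m) (Fin m) ℝ)
    (L : Matrix (Fin m) (Fin m) ℝ) (Q : Fin n → Matrix (Fin m₁) (Fin m) ℝ)
    (R : Matrix (Fin m₁) (Fin m) ℝ) (S : Matrix (Fin m) (Fin m) ℝ) : Prop :=
  ∀ ω ∈ unitSphere n, ∀ r : ℝ, 0 < r →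
    NonnegOn (Complex.I • cplx (skewPart (S * symbol A ω)))
      (Ker (symPart L) ⊓ constraintModes Q R r ω)

/-- Condition (K*) for the matrix-valued function `K` on the unit sphere. Smoothness on the sphere
is smoothness away from the origin of the extension `x ↦ K (x / |x|)`. -/
structure ConditionKStar {n m m₁ : ℕ} (A₀ : Matrix (Fin m) (Fin m) ℝ)
    (A : Fin n → Matrix (Fin m) (Fin m) ℝ) (L : Matrix (Fin m) (Fin m) ℝ)
    (Q : Fin n → Matrix (Fin m₁) (Fin m) ℝ) (R : Matrix (Fin m₁) (Fin m) ℝ)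
    (K : Space n → Matrix (Fin m) (Fin m) ℝ) : Prop where
  smooth : ∀ a b, ContDiffOn ℝ (⊤ : ℕ∞) (fun x : Space n => K (‖x‖⁻¹ • x) a b) {0}ᶜ
  odd : ∀ ω ∈ unitSphere n, K (-ω) = -K ω
  skew : ∀ ω ∈ unitSphere n, (K ω * A₀)ᵀ = -(K ω * A₀)
  pos : ∀ ω ∈ unitSphere n, PosOn (cplx (symPart (K ω * symbol A ω)))
    (Ker L ⊓ LinearMap.ker (proj₂ R ∘ₗ act (symbol Q ω)))

/-! ### Distributions, Lebesgue and Sobolev norms, the Cauchy problem -/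

/-- The `j`-th standard basis vector of `ℝⁿ`. -/
def stdVec {n : ℕ} (j : Fin n) : Space n := EuclideanSpace.single j 1

/-- The `Lᵖ` norm of a tempered distribution: `‖g‖_{Lᵖ}` if the distribution is (represented by)
a function `g ∈ Lᵖ`, and `∞` otherwise. Such a `g` is unique up to null sets. -/
def lpNorm {n m : ℕ} (p : ℝ≥0∞) (u : 𝓢'(Space n, State m)) : ℝ≥0∞ :=
  ⨅ (g : Space n → State m)
    (_ : MemLp g p volume ∧ ∀ ψ : 𝓢(Space n, ℂ), u ψ = ∫ x, ψ x • g x), eLpNorm g p volume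

/-- `‖∂ₓᵏ u‖_{Lᵖ}`: the sum of the `Lᵖ` norms of all the partial derivatives of `u` of order `k`. -/
def derivNorm {n m : ℕ} (k : ℕ) (p : ℝ≥0∞) (u : 𝓢'(Space n, State m)) : ℝ≥0∞ :=
  ∑ α : Fin k → Fin n, lpNorm p (∂^{fun i => stdVec (α i)} u)

/-- `u ∈ W^{l,r} ∩ L^q`. -/
structure MemSobolevInter {n m : ℕ} (l : ℕ) (r q : ℝ≥0∞) (u : 𝓢'(Space n, State m)) : Prop where
  sobolev : ∀ k ≤ l, derivNorm k r u < ∞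
  lebesgue : lpNorm q u < ∞

/-- The constraint `∑ⱼ Qʲ ∂ⱼ u + R u = 0` in the sense of distributions. -/
def Constraint {n m m₁ : ℕ} (Q : Fin n → Matrix (Fin m₁) (Fin m) ℝ)
    (R : Matrix (Fin m₁) (Fin m) ℝ) (u : 𝓢'(Space n, State m)) : Prop :=
  ∀ ψ : 𝓢(Space n, ℂ), ∑ j, act (Q j) ((∂_{stdVec j} u) ψ) + act R (u ψ) = 0

/-- `w` is a solution of the Cauchy problem
`A⁰ w_t + ∑ⱼ Aʲ w_{xⱼ} + L w = 0` for `t > 0`, `w|_{t = 0} = w₀`,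
with values in the tempered distributions (`w` is continuous on `[0, ∞)` and differentiable on
`(0, ∞)` for the weak topology). The values of `w` at negative times play no role. -/
structure IsSolution {n m : ℕ} (A₀ : Matrix (Fin m) (Fin m) ℝ)
    (A : Fin n → Matrix (Fin m) (Fin m) ℝ) (L : Matrix (Fin m) (Fin m) ℝ)
    (w₀ : 𝓢'(Space n, State m)) (w : ℝ → 𝓢'(Space n, State m)) : Prop where
  initial : w 0 = w₀
  continuous_zero : ∀ ψ : 𝓢(Space n, ℂ), ContinuousWithinAt (fun t => w t ψ) (Set.Ici 0) 0
  equation : ∀ ψ : 𝓢(Space n, ℂ), ∀ t : ℝ, 0 < t →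
    ∃ v : State m, HasDerivAt (fun s => w s ψ) v t ∧
      act A₀ v + ∑ j, act (A j) ((∂_{stdVec j} (w t)) ψ) + act L (w t ψ) = 0

/-- `γ_σ(q, p) = (n/σ) (1/q - 1/p)`. -/
def gammaExp (n : ℕ) (σ : ℝ) (q p : ℝ≥0∞) : ℝ :=
  (n : ℝ) / σ * ((q⁻¹).toReal - (p⁻¹).toReal)

end HypSys

end

/-! After a Fourier transform in x, with 2πξ = ρω and |ω| = 1, system (1) becomes a linear ODE with
generator G = (A⁰)⁻¹(iρA(ω) + L), and (2) says that the mode lies in X = Ker(iρQ(ω) + R). Condition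
(C) puts the range of G into X, so the constraint is conserved. The heart of the matter is the bound
exp(-c(|ξ|/(1+|ξ|²))²t) for the modes in X, `exists_norm_propagator_le`.

It comes from an energy ⟨w, T A⁰w⟩ with T = I + aS - ibK, where a ~ 1/(1+ρ²) and b ~ ρ/(1+ρ²)²
(`exists_energy`). The term with L alone controls only the distance of w to Ker L₁, the S-term adds
control of Lw by (S), and the K-term controls the rest by (K*), since Π₂Q(ω) vanishes on X. The
obstacle is the cross term Re⟨w, iSA(ω)w⟩, which (S*)₁ makes nonnegative only on Ker L₁ ∩ X, a space
that varies with ρ and ω. A uniform estimate needs every w in X to be close to that space, with an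
error bounded by ⟨Lw, w⟩ (`exists_decomposition`).

This holds because X is the A⁰-orthogonal complement of the stationary modes Ker(iρA(ω) + L). That
operator is accretive, so its range is the orthogonal complement of its kernel, and (C) then gives
one inclusion. The other follows because X contains no stationary mode but 0
(`eq_zero_of_modeOp_eq_zero`). Since stationary modes lie in Ker L₁, the A⁰-orthogonal projection
onto Ker L₁ preserves X; this projection does not depend on ρ and ω, hence neither do the constants.

The L^p estimate splits the symbol. At low frequencies it is a heat kernel; at high frequencies
exp(-c t/|ξ|²) gives t^(-ℓ/2) at the price of ℓ derivatives. The Hausdorff-Young inequality takes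
L^q to L^q' and L^p' to L^p, and Hölder with a rescaled profile in between produces the powers of
1+t (`exists_derivNorm_le`).

The estimate concerns every distributional solution, so uniqueness among tempered distributions is
needed. Tested against compactly supported frequency functions, the solution and all its monomial
moments satisfy an infinite system of differential inequalities. Banach-Steinhaus bounds the moments
geometrically in their order, and iteration in time gives a factor t^k/k! that tends to 0
(`IsSolution.eq_zero`). -/

/-! ### Linear algebra: kernel bounds and accretive operators -/

section LinearAlgebra

variable {V W : Type*} [NormedAddCommGroup V] [InnerProductSpace ℂ V] [FiniteDimensional ℂ V]
  [NormedAddCommGroup W] [InnerProductSpace ℂ W]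

theorem LinearMap.exists_norm_le (T : V →ₗ[ℂ] W) : ∃ C : ℝ, 0 < C ∧ ∀ φ, ‖T φ‖ ≤ C * ‖φ‖ := by
  refine ⟨‖LinearMap.toContinuousLinearMap T‖ + 1, by positivity, fun φ => ?_⟩
  have h := (LinearMap.toContinuousLinearMap T).le_opNorm φ
  simp only [LinearMap.coe_toContinuousLinearMap'] at h
  nlinarith [norm_nonneg φ]

theorem LinearMap.exists_norm_le_of_injOn (M : V →ₗ[ℂ] W) (Y : Submodule ℂ V)
    (h : ∀ y ∈ Y, M y = 0 → y = 0) : ∃ C : ℝ, 0 < C ∧ ∀ y ∈ Y, ‖y‖ ≤ C * ‖M y‖ := by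
  have hk : (M.domRestrict Y).ker = ⊥ := by
    rw [LinearMap.ker_eq_bot']
    intro y hy
    exact Subtype.ext (h y y.2 hy)
  obtain ⟨C, hC, hL⟩ := LinearMap.exists_antilipschitzWith (M.domRestrict Y) hk
  refine ⟨C, hC, fun y hy => ?_⟩
  simpa using hL.le_mul_norm_sub ⟨y, hy⟩ 0

/-- A linear map vanishing on the kernel of another one is controlled by it. -/
theorem LinearMap.exists_norm_le_of_ker_le {U : Type*} [NormedAddCommGroup U]
    [InnerProductSpace ℂ U] (M : V →ₗ[ℂ] W) (T : V →ₗ[ℂ] U)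
    (h : ∀ φ, M φ = 0 → T φ = 0) : ∃ C : ℝ, 0 < C ∧ ∀ φ, ‖T φ‖ ≤ C * ‖M φ‖ := by
  obtain ⟨B, hB, hT⟩ := T.exists_norm_le
  obtain ⟨C, hC, hM⟩ := M.exists_norm_le_of_injOn M.kerᗮ (by
    intro y hy hy0
    have := (Submodule.mem_orthogonal _ _).1 hy y hy0
    simpa using this)
  refine ⟨B * C, by positivity, fun φ => ?_⟩
  obtain ⟨y, hy, z, hz, rfl⟩ := M.ker.exists_add_mem_mem_orthogonal φ
  rw [LinearMap.mem_ker] at hy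
  rw [map_add, map_add, h y hy, hy, zero_add, zero_add]
  calc ‖T z‖ ≤ B * ‖z‖ := hT z
    _ ≤ B * (C * ‖M z‖) := by gcongr; exact hM z hz
    _ = B * C * ‖M z‖ := by ring

open Complex in
-- The form of M is nonnegative at φ - Mφ/B, where B bounds the norm of M; expanding there gives the
-- claim with c = 1/B.
theorem LinearMap.IsSymmetric.exists_norm_sq_le {M : V →ₗ[ℂ] V} (hM : M.IsSymmetric)
    (h0 : ∀ φ, 0 ≤ (inner ℂ φ (M φ)).re) :
    ∃ c : ℝ, 0 < c ∧ ∀ φ, c * ‖M φ‖ ^ 2 ≤ (inner ℂ φ (M φ)).re := by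
  obtain ⟨B, hB, hBM⟩ := M.exists_norm_le
  refine ⟨1 / B, by positivity, fun φ => ?_⟩
  have h := h0 (φ - ((1 / B : ℝ) : ℂ) • M φ)
  have h1 : (inner ℂ (M φ) (M φ) : ℂ) = ((‖M φ‖ ^ 2 : ℝ) : ℂ) := by
    rw [inner_self_eq_norm_sq_to_K]; norm_cast
  have h2 : (inner ℂ φ (M (M φ)) : ℂ) = ((‖M φ‖ ^ 2 : ℝ) : ℂ) := by rw [← hM, h1]
  have h3 : (inner ℂ (M φ) (M (M φ))).re ≤ B * ‖M φ‖ ^ 2 := by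
    refine (Complex.re_le_norm _).trans ((norm_inner_le_norm _ _).trans ?_)
    have := hBM (M φ)
    nlinarith [norm_nonneg (M φ)]
  simp only [map_sub, map_smul, inner_sub_left, inner_sub_right, inner_smul_left, inner_smul_right,
    h1, h2, Complex.sub_re, Complex.mul_re, Complex.conj_ofReal, Complex.ofReal_re,
    Complex.ofReal_im, zero_mul, sub_zero] at h
  have h4 : 1 / B * (1 / B * (inner ℂ (M φ) (M (M φ))).re) ≤ 1 / B * ‖M φ‖ ^ 2 := by
    gcongr
    calc 1 / B * (inner ℂ (M φ) (M (M φ))).re ≤ 1 / B * (B * ‖M φ‖ ^ 2) := by gcongr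
      _ = ‖M φ‖ ^ 2 := by field_simp
  linarith

theorem LinearMap.IsSymmetric.eq_zero_of_re_inner_eq_zero {M : V →ₗ[ℂ] V} (hM : M.IsSymmetric)
    (h0 : ∀ φ, 0 ≤ (inner ℂ φ (M φ)).re) {φ : V} (h : (inner ℂ φ (M φ)).re = 0) : M φ = 0 := by
  obtain ⟨c, hc, hcM⟩ := hM.exists_norm_sq_le h0
  have := hcM φ
  rw [h] at this
  have h2 : ‖M φ‖ ^ 2 ≤ 0 := by nlinarith [sq_nonneg ‖M φ‖]
  simpa using h2

theorem LinearMap.IsSymmetric.exists_norm_sq_le_of_ker_le {U : Type*} [NormedAddCommGroup U]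
    [InnerProductSpace ℂ U] {M : V →ₗ[ℂ] V} (hM : M.IsSymmetric)
    (h0 : ∀ φ, 0 ≤ (inner ℂ φ (M φ)).re) (T : V →ₗ[ℂ] U) (h : ∀ φ, M φ = 0 → T φ = 0) :
    ∃ c : ℝ, 0 < c ∧ ∀ φ, c * ‖T φ‖ ^ 2 ≤ (inner ℂ φ (M φ)).re := by
  obtain ⟨c, hc, hcM⟩ := hM.exists_norm_sq_le h0
  obtain ⟨C, hC, hT⟩ := LinearMap.exists_norm_le_of_ker_le M T h
  refine ⟨c / C ^ 2, by positivity, fun φ => le_trans ?_ (hcM φ)⟩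
  calc c / C ^ 2 * ‖T φ‖ ^ 2 ≤ c / C ^ 2 * (C * ‖M φ‖) ^ 2 := by gcongr; exact hT φ
    _ = c * ‖M φ‖ ^ 2 := by field_simp

/-- Projection onto a subspace along its complement that is orthogonal for the form of `A`. -/
theorem LinearMap.exists_mem_inner_sub_eq_zero {A : V →ₗ[ℂ] V}
    (hA : ∀ φ, φ ≠ 0 → 0 < (inner ℂ φ (A φ)).re) (J : Submodule ℂ V) (w : V) :
    ∃ u ∈ J, ∀ v ∈ J, inner ℂ v (A (w - u)) = 0 := by
  -- The compression of A to J is injective by positivity, hence surjective in finite dimension.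
  let P : V →ₗ[ℂ] J := J.orthogonalProjectionOnto.toLinearMap
  let f : J →ₗ[ℂ] J := P ∘ₗ A ∘ₗ J.subtype
  have hP : ∀ (v : J) (x : V), inner ℂ (v : V) x = inner ℂ (v : V) (P x : V) := by
    intro v x
    exact (J.inner_orthogonalProjectionOnto_eq_of_mem_left v x).symm
  have hf : Function.Injective f := by
    rw [← LinearMap.ker_eq_bot, LinearMap.ker_eq_bot']
    intro u hu
    by_contra hne
    have h1 := hA u (by simpa using hne)
    rw [hP u (A u)] at h1
    have h2 : P (A u) = 0 := hu
    simp [h2] at h1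
  obtain ⟨u, hu⟩ := (LinearMap.injective_iff_surjective.1 hf) (P (A w))
  refine ⟨u, u.2, fun v hv => ?_⟩
  have h3 : P (A (w - u)) = 0 := by
    rw [map_sub, map_sub, sub_eq_zero]; exact hu.symm
  rw [hP ⟨v, hv⟩, h3]; simp

/-- For an accretive operator, the kernel and the kernel of the adjoint coincide. -/
theorem LinearMap.apply_eq_zero_of_adjoint_apply_eq_zero {B : V →ₗ[ℂ] V}
    (hB : ∀ φ, 0 ≤ (inner ℂ φ (B φ)).re) {φ : V} (h : LinearMap.adjoint B φ = 0) : B φ = 0 := by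
  let M := B + LinearMap.adjoint B
  have hM : M.IsSymmetric := by
    intro x y
    simp [M, inner_add_left, inner_add_right, LinearMap.adjoint_inner_left,
      LinearMap.adjoint_inner_right, add_comm]
  have hre : ∀ x, (inner ℂ x (M x)).re = 2 * (inner ℂ x (B x)).re := by
    intro x
    have : (inner ℂ (B x) x : ℂ).re = (inner ℂ x (B x)).re := by
      rw [← inner_conj_symm (B x) x, Complex.conj_re]
    rw [LinearMap.add_apply, inner_add_right, LinearMap.adjoint_inner_right, Complex.add_re, this]; ring
  have hz : M φ = 0 := by
    apply hM.eq_zero_of_re_inner_eq_zero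
    · intro x; rw [hre]; linarith [hB x]
    · rw [hre, ← LinearMap.adjoint_inner_left, h]; simp
  simpa [M, h] using hz

/-- The range of B is the orthogonal complement of the kernel of its adjoint, and accretivity puts
that kernel inside Ker B. With B = iρA(ω) + L this identifies the range of the generator. -/
theorem LinearMap.mem_range_of_forall_ker_inner {B : V →ₗ[ℂ] V}
    (hB : ∀ φ, 0 ≤ (inner ℂ φ (B φ)).re) {y : V} (h : ∀ ψ, B ψ = 0 → inner ℂ ψ y = 0) :
    ∃ x, B x = y := by
  have h1 : y ∈ ((LinearMap.adjoint B).ker)ᗮ := by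
    rw [Submodule.mem_orthogonal]
    intro u hu
    exact h u (LinearMap.apply_eq_zero_of_adjoint_apply_eq_zero hB hu)
  rw [LinearMap.orthogonal_ker, LinearMap.adjoint_adjoint] at h1
  exact h1

end LinearAlgebra

/-- A function that is positive where another nonnegative function vanishes becomes uniformly
positive on a compact set after adding a large multiple of the latter. -/
theorem IsCompact.exists_forall_le_add_mul {X : Type*} [TopologicalSpace X] {Z : Set X}
    (hZ : IsCompact Z) {k z : X → ℝ} (hk : ContinuousOn k Z) (hz : ContinuousOn z Z)
    (hz0 : ∀ x ∈ Z, 0 ≤ z x) (hpos : ∀ x ∈ Z, z x = 0 → 0 < k x) :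
    ∃ N c : ℝ, 0 < N ∧ 0 < c ∧ ∀ x ∈ Z, c ≤ k x + N * z x := by
  have : CompactSpace Z := isCompact_iff_compactSpace.1 hZ
  have hk' := continuousOn_iff_continuous_domRestrict.1 hk
  have hz' := continuousOn_iff_continuous_domRestrict.1 hz
  -- The weight i + 1 and the lower bound 1/(i + 1) share one index, so these open sets increase
  -- with i and a single one covers Z.
  obtain ⟨i, hi⟩ := (isCompact_univ : IsCompact (Set.univ : Set Z)).elim_directed_cover
    (fun i : ℕ => {x : Z | 1 / ((i : ℝ) + 1) < k x + ((i : ℝ) + 1) * z x})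
    (fun i => isOpen_lt continuous_const (hk'.add (continuous_const.mul hz')))
    (by
      rintro ⟨x, hx⟩ -
      simp only [Set.mem_iUnion, Set.mem_ofPred_eq]
      rcases (hz0 x hx).eq_or_lt with h | h
      · obtain ⟨i, hi⟩ := exists_nat_one_div_lt (hpos x hx h.symm)
        exact ⟨i, by rw [← h]; simpa using hi⟩
      · obtain ⟨i, hi⟩ := exists_nat_gt ((1 - k x) / z x)
        refine ⟨i, ?_⟩
        rw [div_lt_iff₀ h] at hi
        have : 1 / ((i : ℝ) + 1) ≤ 1 := by
          rw [div_le_one (by positivity)]; linarith [(Nat.cast_nonneg i : (0:ℝ) ≤ i)]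
        nlinarith)
    (by
      refine Monotone.directed_le (fun i j hij x hx => ?_)
      simp only [Set.mem_ofPred_eq] at hx ⊢
      have hij' : (i : ℝ) ≤ j := by exact_mod_cast hij
      calc 1 / ((j : ℝ) + 1) ≤ 1 / ((i : ℝ) + 1) := by gcongr
        _ < k x + ((i : ℝ) + 1) * z x := hx
        _ ≤ k x + ((j : ℝ) + 1) * z x := by
          have := hz0 x x.2
          gcongr)
  refine ⟨i + 1, 1 / ((i : ℝ) + 1), by positivity, by positivity, fun x hx => ?_⟩
  exact (hi (Set.mem_univ ⟨x, hx⟩)).le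

/-! ### Absorption inequalities for the energy method -/

theorem mul_le_quarter_mul_sq_add {e : ℝ} (he : 0 < e) (a b : ℝ) :
    a * b ≤ e / 4 * a ^ 2 + b ^ 2 / e := by
  have h' : 0 ≤ (e / 2 * a - b) ^ 2 / e := by positivity
  have e' : (e / 2 * a - b) ^ 2 / e = e / 4 * a ^ 2 + b ^ 2 / e - a * b := by field_simp; ring
  linarith

/-- Here x = |w|, y is the distance of w to its part in Ker L₁, z = |Lw|, and l, s, σ, k, κ are the
real parts of the forms of L, iSA, SL, KA, iKL at w; g = 1/(1+ρ²) and h = ρ/(1+ρ²). Writing l = (1 -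
αg)l + αg l pays for y from the first part and for z from the second, together with σ. The K-term
yields h²x². Its own errors are paid by z once β is small, and the error of s by y and h²x² once α
is small compared with β. -/
theorem dissipation_aux {c₁ c₂ c₃ C₄ C₅ N α β g h : ℝ} (h₁ : 0 < c₁) (h₂ : 0 < c₂) (h₃ : 0 < c₃)
    (hN : 0 < N) (hα : 0 < α) (hβ : 0 < β) (hg0 : 0 < g) (hg1 : g ≤ 1)
    (hh0 : 0 < h) (hhg : h ^ 2 ≤ g) (hβ2 : β * (4 * N) ≤ c₂) (hβ3 : β * (4 * C₅ ^ 2) ≤ c₂ * c₃)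
    (hα1 : α ≤ 1 / 2) (hα2 : α * (2 * C₄ ^ 2) ≤ c₁ * (β * c₃)) {x y z l s σ k κ : ℝ}
    (hl : c₁ * y ^ 2 ≤ l) (hσ : c₂ * z ^ 2 ≤ l + σ) (hs : -(C₄ * y * x) ≤ s)
    (hk : c₃ * x ^ 2 - N * z ^ 2 ≤ k) (hκ : κ ≤ C₅ * z * x) :
    α * β * c₃ / 2 * h ^ 2 * x ^ 2 ≤
      (1 - α * g) * l + α * g * (l + σ) + α * h * s + α * β * h ^ 2 * k - α * β * (h * g) * κ := by
  have hl0 : 0 ≤ l := le_trans (by positivity) hl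
  have i1 : c₁ / 2 * y ^ 2 ≤ (1 - α * g) * l := by
    have h1 : (1 : ℝ) / 2 ≤ 1 - α * g := by
      have : α * g ≤ 1 / 2 * 1 := by gcongr
      linarith
    calc c₁ / 2 * y ^ 2 = 1 / 2 * (c₁ * y ^ 2) := by ring
      _ ≤ 1 / 2 * l := by gcongr
      _ ≤ (1 - α * g) * l := by gcongr
  have i2 : α * g * (c₂ * z ^ 2) ≤ α * g * (l + σ) := by gcongr
  have i3 : α * h * (-(C₄ * y * x)) ≤ α * h * s := by gcongr
  have i4 : α * β * h ^ 2 * (c₃ * x ^ 2 - N * z ^ 2) ≤ α * β * h ^ 2 * k := by gcongr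
  have i5 : α * β * (h * g) * κ ≤ α * β * (h * g) * (C₅ * z * x) := by gcongr
  have j1 : α * β * h ^ 2 * (N * z ^ 2) ≤ α * g * (c₂ / 4 * z ^ 2) := by
    calc α * β * h ^ 2 * (N * z ^ 2) = α * h ^ 2 * (β * (4 * N) / 4) * z ^ 2 := by ring
      _ ≤ α * g * (c₂ / 4) * z ^ 2 := by gcongr
      _ = _ := by ring
  have j2 : α * β * (h * g) * (C₅ * z * x) ≤
      α * β * c₃ / 4 * (h * x) ^ 2 + α * g * (c₂ / 4 * z ^ 2) := by
    have q := mul_le_quarter_mul_sq_add h₃ (h * x) (C₅ * (g * z))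
    have q2 : β * ((C₅ * (g * z)) ^ 2 / c₃) ≤ g * (c₂ / 4 * z ^ 2) := by
      have : β * C₅ ^ 2 / c₃ ≤ c₂ / 4 := by
        rw [div_le_iff₀ h₃]; linarith
      calc β * ((C₅ * (g * z)) ^ 2 / c₃) = β * C₅ ^ 2 / c₃ * (g * z) ^ 2 := by ring
        _ ≤ c₂ / 4 * (g * z) ^ 2 := by gcongr
        _ = c₂ / 4 * (g * g) * z ^ 2 := by ring
        _ ≤ c₂ / 4 * (g * 1) * z ^ 2 := by gcongr
        _ = _ := by ring
    calc α * β * (h * g) * (C₅ * z * x) = α * β * ((h * x) * (C₅ * (g * z))) := by ring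
      _ ≤ α * β * (c₃ / 4 * (h * x) ^ 2 + (C₅ * (g * z)) ^ 2 / c₃) := by gcongr
      _ = α * β * c₃ / 4 * (h * x) ^ 2 + α * (β * ((C₅ * (g * z)) ^ 2 / c₃)) := by ring
      _ ≤ α * β * c₃ / 4 * (h * x) ^ 2 + α * (g * (c₂ / 4 * z ^ 2)) := by gcongr
      _ = _ := by ring
  have j3 : α * h * (C₄ * y * x) ≤ α * β * c₃ / 4 * (h * x) ^ 2 + c₁ / 2 * y ^ 2 := by
    have q := mul_le_quarter_mul_sq_add (mul_pos hβ h₃) (h * x) (C₄ * y)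
    have q2 : α * ((C₄ * y) ^ 2 / (β * c₃)) ≤ c₁ / 2 * y ^ 2 := by
      have : α * C₄ ^ 2 / (β * c₃) ≤ c₁ / 2 := by
        rw [div_le_iff₀ (by positivity)]; linarith
      calc α * ((C₄ * y) ^ 2 / (β * c₃)) = α * C₄ ^ 2 / (β * c₃) * y ^ 2 := by ring
        _ ≤ _ := by gcongr
    calc α * h * (C₄ * y * x) = α * ((h * x) * (C₄ * y)) := by ring
      _ ≤ α * (β * c₃ / 4 * (h * x) ^ 2 + (C₄ * y) ^ 2 / (β * c₃)) := by gcongr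
      _ = α * β * c₃ / 4 * (h * x) ^ 2 + α * ((C₄ * y) ^ 2 / (β * c₃)) := by ring
      _ ≤ _ := by gcongr
  have j4 : 0 ≤ α * g * (c₂ / 2 * z ^ 2) := by positivity
  linarith

/-- Absorption of the error terms of the energy method. -/
theorem exists_weights_dissipation {c₁ c₂ c₃ C₄ C₅ N : ℝ} (h₁ : 0 < c₁) (h₂ : 0 < c₂) (h₃ : 0 < c₃)
    (h₄ : 0 < C₄) (h₅ : 0 < C₅) (hN : 0 < N) {δ : ℝ} (hδ : 0 < δ) :
    ∃ α β c : ℝ, 0 < α ∧ α ≤ δ ∧ 0 < β ∧ β ≤ 1 ∧ 0 < c ∧ ∀ ρ x y z l s σ k κ : ℝ, 0 < ρ →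
      c₁ * y ^ 2 ≤ l → c₂ * z ^ 2 ≤ l + σ → -(C₄ * y * x) ≤ s →
      c₃ * x ^ 2 - N * z ^ 2 ≤ k → κ ≤ C₅ * z * x →
      c * (ρ / (1 + ρ ^ 2)) ^ 2 * x ^ 2 ≤ l + α / (1 + ρ ^ 2) * (ρ * s + σ)
        + α * β * ρ / (1 + ρ ^ 2) ^ 2 * (ρ * k - κ) := by
  obtain ⟨β, hβ, hβ1, hβ2, hβ3⟩ : ∃ β : ℝ, 0 < β ∧ β ≤ 1 ∧ β * (4 * N) ≤ c₂ ∧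
      β * (4 * C₅ ^ 2) ≤ c₂ * c₃ := by
    refine ⟨min 1 (min (c₂ / (4 * N)) (c₂ * c₃ / (4 * C₅ ^ 2))), by positivity, min_le_left _ _,
      ?_, ?_⟩
    · rw [← le_div_iff₀ (by positivity)]
      exact (min_le_right _ _).trans (min_le_left _ _)
    · rw [← le_div_iff₀ (by positivity)]
      exact (min_le_right _ _).trans (min_le_right _ _)
  obtain ⟨α, hα, hαδ, hα1, hα2⟩ : ∃ α : ℝ, 0 < α ∧ α ≤ δ ∧ α ≤ 1 / 2 ∧
      α * (2 * C₄ ^ 2) ≤ c₁ * (β * c₃) := by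
    refine ⟨min δ (min (1 / 2) (c₁ * (β * c₃) / (2 * C₄ ^ 2))), by positivity, min_le_left _ _,
      (min_le_right _ _).trans (min_le_left _ _), ?_⟩
    rw [← le_div_iff₀ (by positivity)]
    exact (min_le_right _ _).trans (min_le_right _ _)
  refine ⟨α, β, α * β * c₃ / 2, hα, hαδ, hβ, hβ1, by positivity, ?_⟩
  intro ρ x y z l s σ k κ hρ hl hσ hs hk hκ
  refine (dissipation_aux h₁ h₂ h₃ hN hα hβ (g := 1 / (1 + ρ ^ 2)) (h := ρ / (1 + ρ ^ 2))
    (by positivity) ?_ (by positivity) ?_ hβ2 hβ3 hα1 hα2 hl hσ hs hk hκ).trans_eq ?_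
  · rw [div_le_one (by positivity)]; nlinarith
  · rw [div_pow, div_le_div_iff₀ (by positivity) (by positivity)]; nlinarith [sq_nonneg ρ]
  · field_simp; ring

/-! ### Algebra of the Fourier modes and of the constraint -/

namespace HypSys

open Complex

section Act

variable {a b c m n : ℕ}

theorem act_apply (M : Matrix (Fin a) (Fin b) ℝ) (v : State b) (i : Fin a) :
    act M v i = ∑ j, (M i j : ℂ) * v j := by
  simp [act, cplx, Matrix.toLpLin_apply, Matrix.mulVec, dotProduct]

theorem act_mul (M : Matrix (Fin a) (Fin b) ℝ) (N : Matrix (Fin b) (Fin c) ℝ) :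
    act (M * N) = act M ∘ₗ act N := by
  have : cplx (M * N) = cplx M * cplx N := by
    ext i j; simp [cplx, Matrix.mul_apply]
  rw [act, this, Matrix.toLpLin_mul_same]
  rfl

theorem act_add (M N : Matrix (Fin a) (Fin b) ℝ) : act (M + N) = act M + act N := by
  ext v i; simp [act_apply, add_mul, Finset.sum_add_distrib]

theorem act_smul (r : ℝ) (M : Matrix (Fin a) (Fin b) ℝ) : act (r • M) = (r : ℂ) • act M := by
  ext v i; simp [act_apply, Finset.mul_sum, mul_assoc]

theorem act_neg (M : Matrix (Fin a) (Fin b) ℝ) : act (-M) = -act M := by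
  ext v i; simp [act_apply]

theorem act_zero : act (0 : Matrix (Fin a) (Fin b) ℝ) = 0 := by
  ext v i; simp [act_apply]

theorem act_one : act (1 : Matrix (Fin a) (Fin a) ℝ) = LinearMap.id := by
  ext v i
  simp only [act_apply, Matrix.one_apply, LinearMap.id_apply]
  rw [Finset.sum_eq_single i] <;> simp +contextual [eq_comm]

theorem act_sum {ι : Type*} (s : Finset ι) (M : ι → Matrix (Fin a) (Fin b) ℝ) :
    act (∑ i ∈ s, M i) = ∑ i ∈ s, act (M i) := by
  classical
  induction s using Finset.induction_on with
  | empty => simp [act_zero]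
  | insert i s hi ih => rw [Finset.sum_insert hi, Finset.sum_insert hi, act_add, ih]

theorem act_symbol (M : Fin n → Matrix (Fin a) (Fin b) ℝ) (ξ : Space n) :
    act (symbol M ξ) = ∑ j, (ξ j : ℂ) • act (M j) := by
  simp [symbol, act_sum, act_smul]

theorem act_symbol_smul (M : Fin n → Matrix (Fin a) (Fin b) ℝ) (r : ℝ) (ξ : Space n) :
    act (symbol M (r • ξ)) = (r : ℂ) • act (symbol M ξ) := by
  simp only [act_symbol, Finset.smul_sum, smul_smul, PiLp.smul_apply, smul_eq_mul,
    Complex.ofReal_mul]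

theorem inner_act_transpose (M : Matrix (Fin a) (Fin b) ℝ) (u : State a) (v : State b) :
    inner ℂ (act Mᵀ u) v = inner ℂ u (act M v) := by
  have : act Mᵀ = LinearMap.adjoint (act M) := by
    unfold act
    rw [← Matrix.toEuclideanLin_conjTranspose_eq_adjoint]
    congr 1
    ext i j
    simp [cplx]
  rw [this, LinearMap.adjoint_inner_left]

theorem isSymmetric_act {M : Matrix (Fin m) (Fin m) ℝ} (hM : Mᵀ = M) : (act M).IsSymmetric := by
  intro u v
  conv_lhs => rw [← hM]
  exact inner_act_transpose M u v

theorem norm_act_le (M : Matrix (Fin a) (Fin b) ℝ) (v : State b) :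
    ‖act M v‖ ≤ (∑ i, ∑ j, |M i j|) * ‖v‖ := by
  have h1 : ‖act M v‖ ≤ ∑ i, ‖act M v i‖ := by
    have := norm_sum_le Finset.univ (fun i => EuclideanSpace.single i (act M v i))
    simp only [EuclideanSpace.single, PiLp.norm_single] at this
    refine le_trans (le_of_eq ?_) this
    congr 1
    ext j
    simp [Finset.sum_apply, Pi.single_apply]
  refine h1.trans ?_
  rw [Finset.sum_mul]
  refine Finset.sum_le_sum (fun i _ => ?_)
  rw [act_apply, Finset.sum_mul]
  refine (norm_sum_le _ _).trans (Finset.sum_le_sum (fun j _ => ?_))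
  rw [norm_mul, Complex.norm_real, Real.norm_eq_abs]
  gcongr
  exact PiLp.norm_apply_le v j

theorem re_inner_act_transpose (X : Matrix (Fin m) (Fin m) ℝ) (φ : State m) :
    (inner ℂ φ (act Xᵀ φ)).re = (inner ℂ φ (act X φ)).re := by
  rw [← inner_act_transpose X φ φ, ← inner_conj_symm, Complex.conj_re]

theorem re_inner_symPart (X : Matrix (Fin m) (Fin m) ℝ) (φ : State m) :
    (inner ℂ φ (act (symPart X) φ)).re = (inner ℂ φ (act X φ)).re := by
  rw [symPart, act_smul, act_add, LinearMap.smul_apply, LinearMap.add_apply, inner_smul_right,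
    inner_add_right, Complex.re_ofReal_mul, Complex.add_re, re_inner_act_transpose]
  ring

theorem isSymmetric_act_symPart (X : Matrix (Fin m) (Fin m) ℝ) : (act (symPart X)).IsSymmetric :=
  isSymmetric_act (by simp [symPart, Matrix.transpose_add, add_comm])

theorem re_inner_I_smul_eq_zero {T : State m →ₗ[ℂ] State m} (hT : T.IsSymmetric) (φ : State m) :
    (inner ℂ φ (I • T φ)).re = 0 := by
  have h := hT.coe_re_inner_self_apply φ
  have h2 : (inner ℂ φ (T φ)).im = 0 := by
    rw [← h]
    exact Complex.ofReal_im _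
  rw [inner_smul_right]
  simp [h2]

theorem re_inner_I_skewPart (X : Matrix (Fin m) (Fin m) ℝ) (φ : State m) :
    reForm (I • cplx (skewPart X)) φ = (inner ℂ φ (I • act X φ)).re := by
  have h1 : X = symPart X + skewPart X := by
    ext i j; simp [symPart, skewPart]; ring
  conv_rhs => rw [h1, act_add, LinearMap.add_apply, smul_add, inner_add_right, Complex.add_re,
    re_inner_I_smul_eq_zero (isSymmetric_act_symPart X), zero_add]
  rw [reForm, act, map_smul, LinearMap.smul_apply]

end Act

variable {n m m₁ : ℕ} {A₀ : Matrix (Fin m) (Fin m) ℝ} {A : Fin n → Matrix (Fin m) (Fin m) ℝ}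
  {L : Matrix (Fin m) (Fin m) ℝ} {Q : Fin n → Matrix (Fin m₁) (Fin m) ℝ}
  {R : Matrix (Fin m₁) (Fin m) ℝ} {S : Matrix (Fin m) (Fin m) ℝ}
  {K : Space n → Matrix (Fin m) (Fin m) ℝ}

theorem ConditionA.isSymmetric_symbol (hA : ConditionA A₀ A L) (ω : Space n) :
    (act (symbol A ω)).IsSymmetric := by
  apply isSymmetric_act
  simp [symbol, Matrix.transpose_sum, hA.symm_A]

theorem ConditionA.act_inv_act (hA : ConditionA A₀ A L) :
    act A₀ ∘ₗ act A₀⁻¹ = LinearMap.id ∧ act A₀⁻¹ ∘ₗ act A₀ = LinearMap.id := by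
  have hinj : Function.Injective (act A₀) := by
    rw [← LinearMap.ker_eq_bot, LinearMap.ker_eq_bot']
    intro φ hφ
    by_contra hne
    have := hA.pos_A₀ φ trivial hne
    change 0 < (inner ℂ φ (act A₀ φ)).re at this
    simp [hφ] at this
  have hdet : IsUnit A₀.det := by
    rw [← Matrix.isUnit_iff_isUnit_det, ← Matrix.mulVec_injective_iff_isUnit]
    intro u v huv
    -- Positivity gives injectivity on ℂᵐ; real vectors are embedded there to obtain invertibility
    -- of the real matrix.
    have : act A₀ (WithLp.toLp 2 (fun i => (u i : ℂ))) = act A₀ (WithLp.toLp 2 (fun i => (v i : ℂ))) := by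
      ext i
      rw [act_apply, act_apply]
      have := congrFun huv i
      simp only [Matrix.mulVec, dotProduct] at this
      simpa using congrArg Complex.ofReal this
    have h2 := hinj this
    ext i
    have := congrArg (fun w : State m => w i) h2
    simpa using this
  rw [← act_mul, ← act_mul, Matrix.mul_nonsing_inv _ hdet, Matrix.nonsing_inv_mul _ hdet, act_one]
  exact ⟨rfl, rfl⟩

/-- The operator `iρA(ω) + L`. -/
noncomputable def modeOp (A : Fin n → Matrix (Fin m) (Fin m) ℝ) (L : Matrix (Fin m) (Fin m) ℝ) (ρ : ℝ)
    (ω : Space n) : State m →ₗ[ℂ] State m :=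
  (I * (ρ : ℂ)) • act (symbol A ω) + act L

theorem modeOp_apply (ρ : ℝ) (ω : Space n) (φ : State m) :
    modeOp A L ρ ω φ = (ρ : ℂ) • I • act (symbol A ω) φ + act L φ := by
  simp [modeOp, smul_smul, mul_comm]

theorem mem_constraintModes {ρ : ℝ} {ω : Space n} {φ : State m} :
    φ ∈ constraintModes Q R ρ ω ↔ ((I * (ρ : ℂ)) • act (symbol Q ω) + act R) φ = 0 :=
  LinearMap.mem_ker

theorem ConditionA.re_inner_modeOp (hA : ConditionA A₀ A L) (ρ : ℝ) (ω : Space n) (φ : State m) :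
    (inner ℂ φ (modeOp A L ρ ω φ)).re = (inner ℂ φ (act L φ)).re := by
  rw [modeOp_apply, inner_add_right, inner_smul_right, Complex.add_re, Complex.re_ofReal_mul,
    re_inner_I_smul_eq_zero (hA.isSymmetric_symbol ω)]
  ring

theorem ConditionA.re_inner_L_nonneg (hA : ConditionA A₀ A L) (φ : State m) :
    0 ≤ (inner ℂ φ (act L φ)).re := hA.nonneg_L φ trivial

theorem ConditionA.symPart_apply_eq_zero (hA : ConditionA A₀ A L) {φ : State m}
    (h : (inner ℂ φ (act L φ)).re = 0) : act (symPart L) φ = 0 :=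
  (isSymmetric_act_symPart L).eq_zero_of_re_inner_eq_zero
    (fun ψ => by rw [re_inner_symPart]; exact hA.re_inner_L_nonneg ψ) (by rwa [re_inner_symPart])

/-- In the product of iρQ + R with (A⁰)⁻¹(iρA + L), the coefficients of ρ², ρ and 1 vanish by the
three identities of (C). -/
theorem ConditionC.modeOp_mem (hC : ConditionC A₀ A L Q R) {ω : Space n} (hω : ω ∈ unitSphere n)
    (ρ : ℝ) (φ : State m) : act A₀⁻¹ (modeOp A L ρ ω φ) ∈ constraintModes Q R ρ ω := by
  have h1 : ∀ φ, act (symbol Q ω) (act A₀⁻¹ (act (symbol A ω) φ)) = 0 := fun φ => by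
    simpa [act_mul, act_zero] using congrArg (fun M => act M φ) (hC.second_order ω hω)
  have h2 : ∀ φ, act (symbol Q ω) (act A₀⁻¹ (act L φ)) + act R (act A₀⁻¹ (act (symbol A ω) φ)) = 0 :=
    fun φ => by
    simpa [act_mul, act_zero, act_add] using congrArg (fun M => act M φ) (hC.first_order ω hω)
  have h3 : ∀ φ, act R (act A₀⁻¹ (act L φ)) = 0 := fun φ => by
    simpa [act_mul, act_zero] using congrArg (fun M => act M φ) hC.zeroth_order
  rw [mem_constraintModes]
  simp only [modeOp, LinearMap.add_apply, LinearMap.smul_apply, map_add, map_smul, h1, h3, smul_zero,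
    zero_add, add_zero]
  rw [← smul_add, add_comm, h2, smul_zero]

/-- On such a mode iρQ(ω)φ = -Rφ, so Q(ω)φ lies in the image of R. This is what makes (K*)
applicable to constrained modes at every ρ > 0. -/
theorem proj₂_eq_zero_of_mem_constraintModes {ρ : ℝ} (hρ : 0 < ρ) {ω : Space n} {φ : State m}
    (hφ : φ ∈ constraintModes Q R ρ ω) : proj₂ R (act (symbol Q ω) φ) = 0 := by
  rw [mem_constraintModes] at hφ
  have h0 : I * (ρ : ℂ) ≠ 0 := by simp [hρ.ne']
  have hmem : act (symbol Q ω) φ ∈ LinearMap.range (act R) := by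
    refine ⟨-(I * (ρ : ℂ))⁻¹ • φ, ?_⟩
    simp only [LinearMap.add_apply, LinearMap.smul_apply] at hφ
    rw [map_smul, eq_neg_of_add_eq_zero_right hφ, smul_neg, neg_smul, neg_neg, inv_smul_smul₀ h0]
  simp [proj₂, proj₁, Submodule.starProjection_eq_self_iff.2 hmem]

theorem ConditionS.re_inner_eq (φ : State m) :
    (inner ℂ φ (act (symPart (S * L) + symPart L) φ)).re =
      (inner ℂ φ (act L φ)).re + (inner ℂ φ (act S (act L φ))).re := by
  rw [act_add, LinearMap.add_apply, inner_add_right, Complex.add_re, re_inner_symPart,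
    re_inner_symPart, act_mul]
  simp [add_comm]

/-- The symmetric matrix in (S) is nonnegative and its kernel is Ker L, so its form dominates a
multiple of |Lφ|². -/
theorem ConditionS.exists_coercive (hS : ConditionS A₀ L S) :
    ∃ c : ℝ, 0 < c ∧ ∀ φ : State m, c * ‖act L φ‖ ^ 2 ≤
      (inner ℂ φ (act L φ)).re + (inner ℂ φ (act S (act L φ))).re := by
  have hsym : (act (symPart (S * L) + symPart L)).IsSymmetric := by
    rw [act_add]; exact (isSymmetric_act_symPart _).add (isSymmetric_act_symPart _)
  obtain ⟨c, hc, h⟩ := hsym.exists_norm_sq_le_of_ker_le (fun φ => hS.nonneg φ trivial) (act L) (by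
    intro φ hφ
    have : φ ∈ Ker (symPart (S * L) + symPart L) := hφ
    rwa [hS.ker_eq] at this)
  exact ⟨c, hc, fun φ => by rw [← re_inner_eq]; exact h φ⟩

/-- The constraint excludes the stationary modes. -/
theorem eq_zero_of_modeOp_eq_zero (hA : ConditionA A₀ A L) (hS : ConditionS A₀ L S)
    (hS₁ : ConditionSStar₁ A L Q R S) (hK : ConditionKStar A₀ A L Q R K) {ω : Space n}
    (hω : ω ∈ unitSphere n) {ρ : ℝ} (hρ : 0 < ρ) {φ : State m}
    (hφ : φ ∈ constraintModes Q R ρ ω) (h : modeOp A L ρ ω φ = 0) : φ = 0 := by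
  have h1 : (inner ℂ φ (act L φ)).re = 0 := by
    rw [← hA.re_inner_modeOp ρ ω φ, h]; simp
  have h2 := hA.symPart_apply_eq_zero h1
  have h3 : 0 ≤ (inner ℂ φ (I • act S (act (symbol A ω) φ))).re := by
    have := hS₁ ω hω ρ hρ φ ⟨h2, hφ⟩
    rw [re_inner_I_skewPart, act_mul] at this
    exact this
  -- Apply S to the equation iρAφ + Lφ = 0 and pair with φ. Since Re⟨φ, iSAφ⟩ ≥ 0 and Re⟨φ, Lφ⟩ = 0,
  -- the form in (S) is nonpositive at φ, which forces Lφ = 0.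
  have h4 : ρ * (inner ℂ φ (I • act S (act (symbol A ω) φ))).re
      + (inner ℂ φ (act S (act L φ))).re = 0 := by
    have := congrArg (fun v => (inner ℂ φ (act S v)).re) h
    simpa only [modeOp_apply, map_add, map_smul, inner_add_right, inner_smul_right (_) (_) (ρ : ℂ),
      Complex.add_re, Complex.re_ofReal_mul, map_zero, inner_zero_right, Complex.zero_re] using this
  obtain ⟨c, hc, hcL⟩ := hS.exists_coercive
  have h5 : act L φ = 0 := by
    have := hcL φ
    have h6 : 0 ≤ ρ * (inner ℂ φ (I • act S (act (symbol A ω) φ))).re := by positivity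
    have h7 : ‖act L φ‖ ^ 2 ≤ 0 := by
      by_contra! hlt
      have : 0 < c * ‖act L φ‖ ^ 2 := by positivity
      linarith
    simpa using h7
  have h6 : act (symbol A ω) φ = 0 := by
    rw [modeOp_apply, h5, add_zero, smul_smul] at h
    exact (smul_eq_zero.1 h).resolve_left (by simp [hρ.ne'])
  by_contra hne
  have := hK.pos ω hω φ ⟨h5, proj₂_eq_zero_of_mem_constraintModes hρ hφ⟩ hne
  change 0 < (inner ℂ φ (act _ φ)).re at this
  rw [re_inner_symPart, act_mul] at this
  simp [h6] at this

/-- The modes satisfying the constraint are those orthogonal, in the inner product given by `A⁰`,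
to the stationary ones. -/
theorem mem_constraintModes_iff_forall_inner_eq_zero (hA : ConditionA A₀ A L)
    (hC : ConditionC A₀ A L Q R) (hS : ConditionS A₀ L S)
    (hS₁ : ConditionSStar₁ A L Q R S) (hK : ConditionKStar A₀ A L Q R K) {ω : Space n}
    (hω : ω ∈ unitSphere n) {ρ : ℝ} (hρ : 0 < ρ) {φ : State m} :
    φ ∈ constraintModes Q R ρ ω ↔ ∀ ψ, modeOp A L ρ ω ψ = 0 → inner ℂ ψ (act A₀ φ) = 0 := by
  have hback : ∀ φ, (∀ ψ, modeOp A L ρ ω ψ = 0 → inner ℂ ψ (act A₀ φ) = 0) →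
      φ ∈ constraintModes Q R ρ ω := by
    intro φ h
    -- A⁰φ is orthogonal to the kernel of an accretive operator, hence in its range; thus φ lies in
    -- the range of the generator.
    obtain ⟨x, hx⟩ := LinearMap.mem_range_of_forall_ker_inner
      (fun φ => by rw [hA.re_inner_modeOp]; exact hA.re_inner_L_nonneg φ) h
    have : φ = act A₀⁻¹ (act A₀ φ) := by
      rw [← LinearMap.comp_apply, hA.act_inv_act.2, LinearMap.id_apply]
    rw [this, ← hx]
    exact hC.modeOp_mem hω ρ x
  refine ⟨fun h => ?_, hback φ⟩
  -- Split off the stationary part u of φ. The remainder is admissible by the inclusion just proved,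
  -- so u is an admissible stationary mode and vanishes.
  obtain ⟨u, hu, hperp⟩ := LinearMap.exists_mem_inner_sub_eq_zero (A := act A₀)
    (fun φ hφ => hA.pos_A₀ φ trivial hφ) (modeOp A L ρ ω).ker φ
  have h1 : φ - u ∈ constraintModes Q R ρ ω := hback _ (fun ψ hψ => hperp ψ hψ)
  have h2 : u ∈ constraintModes Q R ρ ω := by
    have := Submodule.sub_mem _ h h1
    simpa using this
  have h3 := eq_zero_of_modeOp_eq_zero hA hS hS₁ hK hω hρ h2 hu
  intro ψ hψ
  simpa [h3] using hperp ψ hψ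

/-- Uniform approximation of admissible modes by admissible modes in `Ker L₁`. -/
theorem exists_decomposition (hA : ConditionA A₀ A L)
    (hC : ConditionC A₀ A L Q R) (hS : ConditionS A₀ L S)
    (hS₁ : ConditionSStar₁ A L Q R S) (hK : ConditionKStar A₀ A L Q R K) :
    ∃ c C : ℝ, 0 < c ∧ 0 < C ∧ ∀ ω ∈ unitSphere n, ∀ ρ : ℝ, 0 < ρ →
      ∀ w ∈ constraintModes Q R ρ ω, ∃ u ∈ Ker (symPart L) ⊓ constraintModes Q R ρ ω,
        c * ‖w - u‖ ^ 2 ≤ (inner ℂ w (act L w)).re ∧ ‖u‖ ≤ C * ‖w‖ := by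
  have hpos : ∀ φ, φ ≠ 0 → 0 < (inner ℂ φ (act A₀ φ)).re := fun φ hφ => hA.pos_A₀ φ trivial hφ
  let J := Ker (symPart L)
  -- Y is the A⁰-orthogonal complement of Ker L₁, on which L₁ is injective. Neither space involves ρ
  -- or ω, which makes the constants uniform.
  let Y : Submodule ℂ (State m) :=
    { carrier := {y | ∀ v ∈ J, inner ℂ v (act A₀ y) = 0}
      add_mem' := fun {x y} hx hy v hv => by
        rw [map_add, inner_add_right, hx v hv, hy v hv, add_zero]
      zero_mem' := fun v _ => by simp
      smul_mem' := fun r x hx v hv => by rw [map_smul, inner_smul_right, hx v hv, mul_zero] }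
  obtain ⟨C, hC0, hY⟩ := (act (symPart L)).exists_norm_le_of_injOn Y (by
    intro y hy h0
    by_contra hne
    have := hpos y hne
    rw [hy y h0] at this
    simp at this)
  obtain ⟨c, hc, hcL⟩ := (isSymmetric_act_symPart L).exists_norm_sq_le
    (fun φ => by rw [re_inner_symPart]; exact hA.re_inner_L_nonneg φ)
  obtain ⟨B, hB, hBL⟩ := (act (symPart L)).exists_norm_le
  refine ⟨c / C ^ 2, 1 + C * B, by positivity, by positivity, fun ω hω ρ hρ w hw => ?_⟩
  obtain ⟨u, hu, hperp⟩ := LinearMap.exists_mem_inner_sub_eq_zero hpos J w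
  have hwu : ‖w - u‖ ≤ C * ‖act (symPart L) w‖ := by
    have := hY (w - u) hperp
    rwa [map_sub, show act (symPart L) u = 0 from hu, sub_zero] at this
  refine ⟨u, ⟨hu, ?_⟩, ?_, ?_⟩
  · rw [SetLike.mem_coe]
    rw [mem_constraintModes_iff_forall_inner_eq_zero hA hC hS hS₁ hK hω hρ] at hw ⊢
    intro ψ hψ
    -- Stationary modes lie in Ker L₁, so both w and w - u are A⁰-orthogonal to them, and hence so
    -- is u.
    have hψJ : ψ ∈ J := hA.symPart_apply_eq_zero (by
      rw [← hA.re_inner_modeOp ρ ω ψ, hψ]; simp)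
    have h1 := hperp ψ hψJ
    rw [map_sub, inner_sub_right, hw ψ hψ, zero_sub, neg_eq_zero] at h1
    exact h1
  · rw [← re_inner_symPart]
    calc c / C ^ 2 * ‖w - u‖ ^ 2 ≤ c / C ^ 2 * (C * ‖act (symPart L) w‖) ^ 2 := by gcongr
      _ = c * ‖act (symPart L) w‖ ^ 2 := by field_simp
      _ ≤ _ := hcL w
  · calc ‖u‖ = ‖w - (w - u)‖ := by congr 1; abel
      _ ≤ ‖w‖ + ‖w - u‖ := norm_sub_le _ _
      _ ≤ ‖w‖ + C * (B * ‖w‖) := by gcongr; exact hwu.trans (by gcongr; exact hBL w)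
      _ = _ := by ring

end HypSys

/-! ### Energy functional and pointwise decay of the modes -/

namespace HypSys

open Complex

variable {n m m₁ : ℕ} {A₀ : Matrix (Fin m) (Fin m) ℝ} {A : Fin n → Matrix (Fin m) (Fin m) ℝ}
  {L : Matrix (Fin m) (Fin m) ℝ} {Q : Fin n → Matrix (Fin m₁) (Fin m) ℝ}
  {R : Matrix (Fin m₁) (Fin m) ℝ} {S : Matrix (Fin m) (Fin m) ℝ}
  {K : Space n → Matrix (Fin m) (Fin m) ℝ}

theorem continuous_symbol {a b : ℕ} (M : Fin n → Matrix (Fin a) (Fin b) ℝ) (i : Fin a) (j : Fin b) :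
    Continuous fun ω : Space n => symbol M ω i j := by
  simp only [symbol, Matrix.sum_apply, Matrix.smul_apply, smul_eq_mul]
  fun_prop

theorem ConditionKStar.continuousOn (hK : ConditionKStar A₀ A L Q R K) (i j : Fin m) :
    ContinuousOn (fun ω => K ω i j) (unitSphere n) := by
  have hsub : unitSphere n ⊆ {0}ᶜ := by
    intro ω hω h0
    rw [Set.mem_singleton_iff] at h0
    simp [unitSphere, h0] at hω
  refine ((hK.smooth i j).continuousOn.mono hsub).congr (fun ω hω => ?_)
  have : ‖ω‖ = 1 := by simpa [unitSphere] using hω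
  simp [this]

theorem isCompact_unitSphere : IsCompact (unitSphere n) := isCompact_sphere _ _

theorem exists_norm_act_le {X : Type*} [TopologicalSpace X] {s : Set X} (hs : IsCompact s) {a b : ℕ}
    {M : X → Matrix (Fin a) (Fin b) ℝ} (hM : ∀ i j, ContinuousOn (fun ω => M ω i j) s) :
    ∃ C : ℝ, 0 < C ∧ ∀ ω ∈ s, ∀ v, ‖act (M ω) v‖ ≤ C * ‖v‖ := by
  have hc : ContinuousOn (fun ω => ∑ i, ∑ j, |M ω i j|) s :=
    continuousOn_finsetSum _ (fun i _ => continuousOn_finsetSum _ (fun j _ => (hM i j).abs))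
  obtain ⟨C, hC⟩ := hs.exists_bound_of_continuousOn hc
  refine ⟨max C 1, by positivity, fun ω hω v => (norm_act_le _ v).trans ?_⟩
  gcongr
  exact (le_abs_self _).trans ((hC ω hω).trans (le_max_left _ _))

theorem continuousOn_act_apply {X : Type*} [TopologicalSpace X] {s : Set X} {a b : ℕ}
    {M : X → Matrix (Fin a) (Fin b) ℝ} (hM : ∀ i j, ContinuousOn (fun x => M x i j) s)
    {f : X → State b} (hf : ContinuousOn f s) : ContinuousOn (fun x => act (M x) (f x)) s := by
  have : (fun x => act (M x) (f x)) =
      fun x => (WithLp.toLp 2 (fun i => ∑ j, (M x i j : ℂ) * f x j) : State a) := by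
    ext x i; simp [act_apply]
  rw [this]
  refine (PiLp.continuous_toLp 2 _).comp_continuousOn (continuousOn_pi.2 fun i =>
    continuousOn_finsetSum _ fun j _ => ?_)
  refine (Complex.continuous_ofReal.comp_continuousOn (hM i j)).mul ?_
  exact (PiLp.continuous_apply 2 _ j).comp_continuousOn hf

/-- The kernel of Π₂Q(ω) may change dimension with ω, so compactness is used on the closed set of
pairs (ω, φ) of unit vectors with Π₂Q(ω)φ = 0. There the K-form is positive wherever Lφ = 0, and a
large multiple of |Lφ|² makes it uniformly positive. -/
theorem ConditionKStar.exists_coercive (hK : ConditionKStar A₀ A L Q R K) :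
    ∃ N c : ℝ, 0 < N ∧ 0 < c ∧ ∀ ω ∈ unitSphere n, ∀ φ, proj₂ R (act (symbol Q ω) φ) = 0 →
      c * ‖φ‖ ^ 2 - N * ‖act L φ‖ ^ 2 ≤ (inner ℂ φ (act (K ω) (act (symbol A ω) φ))).re := by
  let Z : Set (Space n × State m) := (unitSphere n ×ˢ Metric.sphere (0 : State m) 1) ∩
    {p | proj₂ R (act (symbol Q p.1) p.2) = 0}
  have hQ : Continuous fun p : Space n × State m => act (symbol Q p.1) p.2 := by
    rw [← continuousOn_univ]
    exact continuousOn_act_apply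
      (fun i j => ((continuous_symbol Q i j).comp continuous_fst).continuousOn)
      continuous_snd.continuousOn
  have hZ : IsCompact Z := by
    refine (isCompact_unitSphere.prod (isCompact_sphere _ _)).inter_right ?_
    exact isClosed_eq ((LinearMap.continuous_of_finiteDimensional (proj₂ R)).comp hQ)
      continuous_const
  have hkc : ContinuousOn (fun p : Space n × State m =>
      (inner ℂ p.2 (act (K p.1) (act (symbol A p.1) p.2))).re) Z := by
    have hfst : Set.MapsTo (Prod.fst : Space n × State m → Space n) Z (unitSphere n) :=
      fun p hp => hp.1.1
    refine Complex.continuous_re.comp_continuousOn (ContinuousOn.inner (𝕜 := ℂ) continuous_snd.continuousOn ?_)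
    refine continuousOn_act_apply (fun i j => (hK.continuousOn i j).comp continuousOn_fst hfst) ?_
    exact continuousOn_act_apply
      (fun i j => ((continuous_symbol A i j).comp continuous_fst).continuousOn)
      continuous_snd.continuousOn
  have hzc : ContinuousOn (fun p : Space n × State m => ‖act L p.2‖ ^ 2) Z := by
    exact (((LinearMap.continuous_of_finiteDimensional (act L)).comp continuous_snd).norm.pow 2).continuousOn
  obtain ⟨N, c, hN, hc, h⟩ := hZ.exists_forall_le_add_mul hkc hzc (fun _ _ => by positivity) (by
    rintro ⟨ω, φ⟩ ⟨⟨hω, hφ⟩, hp⟩ hz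
    have hne : φ ≠ 0 := by rintro rfl; simp at hφ
    have := hK.pos ω hω φ ⟨show act L φ = 0 by simpa using hz, hp⟩ hne
    change 0 < (inner ℂ φ (act _ φ)).re at this
    rwa [re_inner_symPart, act_mul] at this)
  refine ⟨N, c, hN, hc, fun ω hω φ hφ => ?_⟩
  rcases eq_or_ne φ 0 with rfl | hne
  · simp
  have hn : 0 < ‖φ‖ := norm_pos_iff.2 hne
  have := h (ω, ((‖φ‖⁻¹ : ℝ) : ℂ) • φ) ⟨⟨hω, by simp [norm_smul, hn.ne']⟩, by
    simp only [Set.mem_ofPred_eq, map_smul, hφ, smul_zero]⟩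
  simp only [map_smul, inner_smul_left, inner_smul_right, Complex.conj_ofReal, norm_smul,
    Complex.re_ofReal_mul, Complex.norm_real, Real.norm_eq_abs, abs_inv, abs_norm] at this
  have h2 : c * ‖φ‖ ^ 2 ≤ ((‖φ‖⁻¹ * (‖φ‖⁻¹ *
      (inner ℂ φ (act (K ω) (act (symbol A ω) φ))).re)) + N * (‖φ‖⁻¹ * ‖act L φ‖) ^ 2) *
        ‖φ‖ ^ 2 := by gcongr
  have h3 : ((‖φ‖⁻¹ * (‖φ‖⁻¹ *
      (inner ℂ φ (act (K ω) (act (symbol A ω) φ))).re)) + N * (‖φ‖⁻¹ * ‖act L φ‖) ^ 2) *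
        ‖φ‖ ^ 2 = (inner ℂ φ (act (K ω) (act (symbol A ω) φ))).re + N * ‖act L φ‖ ^ 2 := by
    field_simp
  linarith

/-- A weighted energy functional with coercive dissipation. -/
theorem exists_energy (hA : ConditionA A₀ A L)
    (hC : ConditionC A₀ A L Q R) (hS : ConditionS A₀ L S)
    (hS₁ : ConditionSStar₁ A L Q R S) (hK : ConditionKStar A₀ A L Q R K) :
    ∃ c₀ C₀ c : ℝ, 0 < c₀ ∧ 0 < C₀ ∧ 0 < c ∧ ∀ ω ∈ unitSphere n, ∀ ρ : ℝ, 0 < ρ →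
      ∃ T : State m →ₗ[ℂ] State m, (T ∘ₗ act A₀).IsSymmetric ∧
        (∀ w, c₀ * ‖w‖ ^ 2 ≤ (inner ℂ w (T (act A₀ w))).re) ∧
        (∀ w, (inner ℂ w (T (act A₀ w))).re ≤ C₀ * ‖w‖ ^ 2) ∧
        ∀ w ∈ constraintModes Q R ρ ω,
          c * (ρ / (1 + ρ ^ 2)) ^ 2 * ‖w‖ ^ 2 ≤ (inner ℂ w (T (modeOp A L ρ ω w))).re := by
  obtain ⟨N, c₃, hN, hc₃, hKpos⟩ := hK.exists_coercive
  obtain ⟨c₂, hc₂, hSpos⟩ := hS.exists_coercive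
  obtain ⟨c₁, Cu, hc₁, hCu, hdec⟩ := exists_decomposition hA hC hS hS₁ hK
  obtain ⟨CA, hCA, hAb⟩ := exists_norm_act_le (isCompact_unitSphere (n := n))
    (fun i j => (continuous_symbol A i j).continuousOn)
  obtain ⟨CK, hCK, hKb⟩ := exists_norm_act_le (isCompact_unitSphere (n := n)) hK.continuousOn
  obtain ⟨CS, hCS, hSb⟩ := (act S).exists_norm_le
  obtain ⟨B, hB, hA0b⟩ := (act A₀).exists_norm_le
  obtain ⟨c₀, hc₀, hA0pos⟩ := (isSymmetric_act hA.symm_A₀).exists_norm_sq_le_of_ker_le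
    (fun φ => by
      by_cases h : φ = 0
      · simp [h]
      · exact (hA.pos_A₀ φ trivial h).le) LinearMap.id (by
      intro φ hφ
      have := LinearMap.congr_fun hA.act_inv_act.2 φ
      simpa [hφ] using this.symm)
  simp only [LinearMap.id_apply] at hA0pos
  -- The bound δ on α keeps the S- and K-corrections of the energy below half of the form of A⁰.
  obtain ⟨α, β, c, hα, hαδ, hβ, hβ1, hc, hmain⟩ := exists_weights_dissipation hc₁ hc₂ hc₃
    (C₄ := CS * CA * (1 + Cu)) (C₅ := CK) (by positivity) hCK hN
    (δ := c₀ / (2 * ((CS + CK) * B))) (by positivity)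
  have hαδ' : α * ((CS + CK) * B) ≤ c₀ / 2 := by
    calc α * ((CS + CK) * B) ≤ c₀ / (2 * ((CS + CK) * B)) * ((CS + CK) * B) := by gcongr
      _ = c₀ / 2 := by field_simp
  refine ⟨c₀ / 2, B + c₀ / 2, c, by positivity, by positivity, hc, fun ω hω ρ hρ => ?_⟩
  set a : ℝ := α / (1 + ρ ^ 2) with ha
  set b : ℝ := α * β * ρ / (1 + ρ ^ 2) ^ 2 with hb
  have ha0 : 0 < a := by positivity
  have hb0 : 0 < b := by positivity
  have haα : a ≤ α := by
    rw [ha, div_le_iff₀ (by positivity)]; nlinarith [mul_pos hα (pow_pos hρ 2)]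
  have hbα : b ≤ α := by
    rw [hb, div_le_iff₀ (by positivity)]
    have h1 : ρ ≤ (1 + ρ ^ 2) ^ 2 := by nlinarith [sq_nonneg (ρ - 1), sq_nonneg ρ, sq_nonneg (ρ^2)]
    calc α * β * ρ ≤ α * 1 * (1 + ρ ^ 2) ^ 2 := by gcongr
      _ = _ := by ring
  -- The sign of the K-term is chosen so that -ibK applied to iρAw gives +bρKAw.
  let T : State m →ₗ[ℂ] State m :=
    LinearMap.id + (a : ℂ) • act S - (b : ℂ) • (I • act (K ω))
  have hTre : ∀ u v : State m, (inner ℂ u (T v)).re = (inner ℂ u v).re +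
      a * (inner ℂ u (act S v)).re - b * (inner ℂ u (I • act (K ω) v)).re := by
    intro u v
    simp only [T, LinearMap.sub_apply, LinearMap.add_apply, LinearMap.smul_apply, inner_add_right,
      inner_sub_right, inner_smul_right _ _ (a : ℂ), inner_smul_right _ _ (b : ℂ), Complex.add_re,
      Complex.sub_re, Complex.re_ofReal_mul, LinearMap.id_apply]
  have herr : ∀ w, |a * (inner ℂ w (act S (act A₀ w))).re -
      b * (inner ℂ w (I • act (K ω) (act A₀ w))).re| ≤ c₀ / 2 * ‖w‖ ^ 2 := by
    intro w
    have e1 : |(inner ℂ w (act S (act A₀ w))).re| ≤ ‖w‖ * (CS * (B * ‖w‖)) := by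
      refine (Complex.abs_re_le_norm _).trans ((norm_inner_le_norm _ _).trans ?_)
      gcongr
      exact (hSb _).trans (by gcongr; exact hA0b w)
    have e2 : |(inner ℂ w (I • act (K ω) (act A₀ w))).re| ≤ ‖w‖ * (CK * (B * ‖w‖)) := by
      refine (Complex.abs_re_le_norm _).trans ((norm_inner_le_norm _ _).trans ?_)
      rw [norm_smul, Complex.norm_I, one_mul]
      gcongr
      exact (hKb ω hω _).trans (by gcongr; exact hA0b w)
    calc _ ≤ |a * (inner ℂ w (act S (act A₀ w))).re| +
          |b * (inner ℂ w (I • act (K ω) (act A₀ w))).re| := abs_sub _ _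
      _ ≤ α * (‖w‖ * (CS * (B * ‖w‖))) + α * (‖w‖ * (CK * (B * ‖w‖))) := by
        rw [abs_mul, abs_mul, abs_of_pos ha0, abs_of_pos hb0]
        gcongr
      _ = α * ((CS + CK) * B) * ‖w‖ ^ 2 := by ring
      _ ≤ _ := by gcongr
  refine ⟨T, ?_, ?_, ?_, ?_⟩
  -- K A⁰ is real and skew-symmetric, so iK A⁰ is Hermitian.
  · have hsk : (I • (act (K ω) ∘ₗ act A₀)).IsSymmetric := by
      intro u v
      have h1 : act (K ω) ∘ₗ act A₀ = - act (K ω * A₀)ᵀ := by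
        rw [hK.skew ω hω, act_neg, neg_neg, act_mul]
      rw [LinearMap.smul_apply, LinearMap.smul_apply, inner_smul_left, inner_smul_right]
      conv_lhs => rw [h1, LinearMap.neg_apply, inner_neg_left, inner_act_transpose, act_mul]
      simp
    have hs : (act S ∘ₗ act A₀).IsSymmetric := by
      rw [← act_mul]; exact isSymmetric_act hS.symm
    have : T ∘ₗ act A₀ = act A₀ + (a : ℂ) • (act S ∘ₗ act A₀) -
        (b : ℂ) • (I • (act (K ω) ∘ₗ act A₀)) := by
      ext v i; simp [T]
    rw [this]
    exact ((isSymmetric_act hA.symm_A₀).add (hs.smul (Complex.conj_ofReal a))).sub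
      (hsk.smul (Complex.conj_ofReal b))
  · intro w
    rw [hTre]
    have := neg_le_of_abs_le (herr w)
    have := hA0pos w
    linarith
  · intro w
    rw [hTre]
    have h1 := le_of_abs_le (herr w)
    have h2 : (inner ℂ w (act A₀ w)).re ≤ B * ‖w‖ ^ 2 := by
      refine (Complex.re_le_norm _).trans ((norm_inner_le_norm _ _).trans ?_)
      have := hA0b w
      nlinarith [norm_nonneg w]
    linarith
  · intro w hw
    obtain ⟨u, ⟨hu, huX⟩, hul, hun⟩ := hdec ω hω ρ hρ w hw
    have hs : -(CS * CA * (1 + Cu) * ‖w - u‖ * ‖w‖) ≤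
        (inner ℂ w (I • act S (act (symbol A ω) w))).re := by
      let G : State m →ₗ[ℂ] State m := I • (act S ∘ₗ act (symbol A ω))
      have hG : ∀ v, ‖G v‖ ≤ CS * CA * ‖v‖ := by
        intro v
        simp only [G, LinearMap.smul_apply, norm_smul, Complex.norm_I, one_mul, LinearMap.comp_apply]
        calc _ ≤ CS * (CA * ‖v‖) := (hSb _).trans (by gcongr; exact hAb ω hω v)
          _ = _ := by ring
      -- This is the one use of (S*)₁ in the estimate: at u, which lies in Ker L₁ and still
      -- satisfies the constraint. Replacing w by u costs a multiple of |w - u||w|.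
      have h0 : 0 ≤ (inner ℂ u (G u)).re := by
        have := hS₁ ω hω ρ hρ u ⟨hu, huX⟩
        rw [re_inner_I_skewPart, act_mul] at this
        exact this
      have hsplit : (inner ℂ w (G w)).re = (inner ℂ u (G u)).re + (inner ℂ u (G (w - u))).re
          + (inner ℂ (w - u) (G w)).re := by
        simp only [map_sub, inner_sub_left, inner_sub_right, Complex.sub_re]; ring
      have e1 : |(inner ℂ u (G (w - u))).re| ≤ Cu * ‖w‖ * (CS * CA * ‖w - u‖) :=
        (Complex.abs_re_le_norm _).trans ((norm_inner_le_norm _ _).trans (by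
          gcongr; exact hG _))
      have e2 : |(inner ℂ (w - u) (G w)).re| ≤ ‖w - u‖ * (CS * CA * ‖w‖) :=
        (Complex.abs_re_le_norm _).trans ((norm_inner_le_norm _ _).trans (by
          gcongr; exact hG _))
      have := neg_le_of_abs_le e1
      have := neg_le_of_abs_le e2
      change _ ≤ (inner ℂ w (G w)).re
      rw [hsplit]
      nlinarith
    have hκ : (inner ℂ w (I • act (K ω) (act L w))).re ≤ CK * ‖act L w‖ * ‖w‖ := by
      refine (Complex.re_le_norm _).trans ((norm_inner_le_norm _ _).trans ?_)
      rw [norm_smul, Complex.norm_I, one_mul, mul_comm]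
      gcongr
      exact hKb ω hω _
    refine (hmain ρ ‖w‖ ‖w - u‖ ‖act L w‖ _ _ _ _ _ hρ hul (hSpos w) hs
      (hKpos ω hω w (proj₂_eq_zero_of_mem_constraintModes hρ hw)) hκ).trans_eq ?_
    rw [hTre, hA.re_inner_modeOp]
    -- The factor i in front of K cancels the i of the symbol, so that Re⟨w, KAw⟩ appears.
    have hII : I • act (K ω) (modeOp A L ρ ω w) =
        -((ρ : ℂ) • act (K ω) (act (symbol A ω) w)) + I • act (K ω) (act L w) := by
      rw [modeOp_apply, map_add, map_smul, smul_add]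
      congr 1
      rw [map_smul, smul_comm I (ρ : ℂ), smul_smul I, Complex.I_mul_I]
      simp
    have hSS : act S (modeOp A L ρ ω w) =
        (ρ : ℂ) • (I • act S (act (symbol A ω) w)) + act S (act L w) := by
      rw [modeOp_apply, map_add, map_smul, map_smul]
    rw [hII, hSS]
    simp only [inner_add_right, inner_neg_right, inner_smul_right _ _ (ρ : ℂ), Complex.add_re,
      Complex.neg_re, Complex.re_ofReal_mul]
    ring

/-- The generator `(A⁰)⁻¹ (2πi A(ξ) + L)` of the system at the frequency `ξ`. -/
noncomputable def generator (A₀ : Matrix (Fin m) (Fin m) ℝ) (A : Fin n → Matrix (Fin m) (Fin m) ℝ)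
    (L : Matrix (Fin m) (Fin m) ℝ) (ξ : Space n) : State m →L[ℂ] State m :=
  LinearMap.toContinuousLinearMap
    (act A₀⁻¹ ∘ₗ ((2 * Real.pi * I : ℂ) • act (symbol A ξ) + act L))

/-- The constraint `2πi Q(ξ) + R` at the frequency `ξ`. -/
noncomputable def constraintSymbol (Q : Fin n → Matrix (Fin m₁) (Fin m) ℝ)
    (R : Matrix (Fin m₁) (Fin m) ℝ) (ξ : Space n) : State m →L[ℂ] State m₁ :=
  LinearMap.toContinuousLinearMap ((2 * Real.pi * I : ℂ) • act (symbol Q ξ) + act R)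

/-- The solution operator `exp (-t G(ξ))` at the frequency `ξ`. -/
noncomputable def propagator (A₀ : Matrix (Fin m) (Fin m) ℝ) (A : Fin n → Matrix (Fin m) (Fin m) ℝ)
    (L : Matrix (Fin m) (Fin m) ℝ) (t : ℝ) (ξ : Space n) : State m →L[ℂ] State m :=
  NormedSpace.exp (t • -generator A₀ A L ξ)

theorem norm_inv_smul_mem_unitSphere {ξ : Space n} (hξ : ξ ≠ 0) : ‖ξ‖⁻¹ • ξ ∈ unitSphere n := by
  simp [unitSphere, norm_smul, norm_ne_zero_iff.2 hξ]

theorem act_symbol_eq_norm_smul {a b : ℕ} (M : Fin n → Matrix (Fin a) (Fin b) ℝ) {ξ : Space n}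
    (hξ : ξ ≠ 0) : (2 * Real.pi * I : ℂ) • act (symbol M ξ) =
      (I * ((2 * Real.pi * ‖ξ‖ : ℝ) : ℂ)) • act (symbol M (‖ξ‖⁻¹ • ξ)) := by
  have h : ‖ξ‖ ≠ 0 := norm_ne_zero_iff.2 hξ
  rw [act_symbol_smul, smul_smul]
  congr 1
  push_cast
  have : (‖ξ‖ : ℂ) ≠ 0 := by exact_mod_cast h
  field_simp

theorem generator_apply_eq {ξ : Space n} (hξ : ξ ≠ 0) (φ : State m) :
    generator A₀ A L ξ φ = act A₀⁻¹ (modeOp A L (2 * Real.pi * ‖ξ‖) (‖ξ‖⁻¹ • ξ) φ) := by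
  simp only [generator, act_symbol_eq_norm_smul A hξ, modeOp]
  rfl

theorem constraintSymbol_eq_zero_iff {ξ : Space n} (hξ : ξ ≠ 0) (φ : State m) :
    constraintSymbol Q R ξ φ = 0 ↔
      φ ∈ constraintModes Q R (2 * Real.pi * ‖ξ‖) (‖ξ‖⁻¹ • ξ) := by
  rw [mem_constraintModes, ← act_symbol_eq_norm_smul Q hξ]
  rfl

theorem propagator_zero (ξ : Space n) (φ : State m) : propagator A₀ A L 0 ξ φ = φ := by
  simp [propagator]

theorem hasDerivAt_propagator (ξ : Space n) (φ : State m) (t : ℝ) :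
    HasDerivAt (fun t => propagator A₀ A L t ξ φ)
      (-generator A₀ A L ξ (propagator A₀ A L t ξ φ)) t := by
  have h := hasDerivAt_exp_smul_const' (𝕂 := ℝ) (-generator A₀ A L ξ) t
  have h2 := ((ContinuousLinearMap.apply ℂ (State m) φ).restrictScalars ℝ).hasFDerivAt.comp_hasDerivAt t h
  exact h2

/-- The time derivative is the constraint symbol applied to a vector in the range of the generator,
which vanishes by (C). -/
theorem constraintSymbol_propagator (hC : ConditionC A₀ A L Q R) {ξ : Space n} (hξ : ξ ≠ 0)
    (t : ℝ) (φ : State m) :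
    constraintSymbol Q R ξ (propagator A₀ A L t ξ φ) = constraintSymbol Q R ξ φ := by
  have hd : ∀ t, HasDerivAt (fun t => constraintSymbol Q R ξ (propagator A₀ A L t ξ φ)) 0 t := by
    intro t
    have h := ((constraintSymbol Q R ξ).restrictScalars ℝ).hasFDerivAt.comp_hasDerivAt t
      (hasDerivAt_propagator (A₀ := A₀) (A := A) (L := L) ξ φ t)
    refine h.congr_deriv ?_
    rw [ContinuousLinearMap.coe_restrictScalars', map_neg, generator_apply_eq hξ, neg_eq_zero,
      constraintSymbol_eq_zero_iff hξ]
    exact hC.modeOp_mem (norm_inv_smul_mem_unitSphere hξ) _ _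
  have := is_const_of_deriv_eq_zero (fun t => (hd t).differentiableAt) (fun t => (hd t).deriv) t 0
  rwa [propagator_zero] at this

/-- Pointwise decay, of regularity-loss type, of the Fourier modes that satisfy the constraint. -/
theorem exists_norm_propagator_le (hA : ConditionA A₀ A L)
    (hC : ConditionC A₀ A L Q R) (hS : ConditionS A₀ L S)
    (hS₁ : ConditionSStar₁ A L Q R S) (hK : ConditionKStar A₀ A L Q R K) :
    ∃ C c : ℝ, 0 < C ∧ 0 < c ∧ ∀ ξ : Space n, ξ ≠ 0 → ∀ φ : State m, constraintSymbol Q R ξ φ = 0 →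
      ∀ t : ℝ, 0 ≤ t → ‖propagator A₀ A L t ξ φ‖ ≤
        C * Real.exp (-c * (‖ξ‖ / (1 + ‖ξ‖ ^ 2)) ^ 2 * t) * ‖φ‖ := by
  obtain ⟨c₀, C₀, c, hc₀, hC₀, hc, hE⟩ := exists_energy hA hC hS hS₁ hK
  have hpi : 1 < 2 * Real.pi := by linarith [Real.pi_gt_three]
  refine ⟨√(C₀ / c₀), c / C₀ / (2 * Real.pi) ^ 2, by positivity, by positivity,
    fun ξ hξ φ hφ t ht => ?_⟩
  set ρ := 2 * Real.pi * ‖ξ‖ with hρd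
  set ω := ‖ξ‖⁻¹ • ξ
  have hn : 0 < ‖ξ‖ := norm_pos_iff.2 hξ
  have hρ : 0 < ρ := by positivity
  obtain ⟨T, hTs, hTl, hTu, hTd⟩ := hE ω (norm_inv_smul_mem_unitSphere hξ) ρ hρ
  set w : ℝ → State m := fun t => propagator A₀ A L t ξ φ with hw
  set e : ℝ → ℝ := fun t => (inner ℂ (w t) (T (act A₀ (w t)))).re with he
  -- Twice the dissipation rate, divided by the upper constant C₀ of the energy: with this rate `e'
  -- ≤ -μ e`.
  set μ : ℝ := 2 * (c / C₀ * (ρ / (1 + ρ ^ 2)) ^ 2)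
  have hwd : ∀ t, HasDerivAt w (-generator A₀ A L ξ (w t)) t := hasDerivAt_propagator ξ φ
  have hed : ∀ t, HasDerivAt e (-(2 * (inner ℂ (w t) (T (modeOp A L ρ ω (w t)))).re)) t := by
    intro t
    let H : State m →L[ℝ] State m :=
      (LinearMap.toContinuousLinearMap (T ∘ₗ act A₀)).restrictScalars ℝ
    have h1 : HasDerivAt (fun t => H (w t)) (H (-generator A₀ A L ξ (w t))) t :=
      H.hasFDerivAt.comp_hasDerivAt t (hwd t)
    have h2 := (hwd t).inner ℂ h1
    have h3 := Complex.reCLM.hasFDerivAt.comp_hasDerivAt t h2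
    refine h3.congr_deriv ?_
    have h4 : ∀ v, H v = (T ∘ₗ act A₀) v := fun v => rfl
    have h5 : act A₀ (generator A₀ A L ξ (w t)) = modeOp A L ρ ω (w t) := by
      rw [generator_apply_eq hξ, ← LinearMap.comp_apply, hA.act_inv_act.1]; rfl
    have h6 : (inner ℂ (-generator A₀ A L ξ (w t)) ((T ∘ₗ act A₀) (w t)) : ℂ).re =
        (inner ℂ (w t) ((T ∘ₗ act A₀) (-generator A₀ A L ξ (w t)))).re := by
      rw [← hTs, ← inner_conj_symm, Complex.conj_re]
    rw [Complex.reCLM_apply, Complex.add_re, h4, h4, h6, map_neg, inner_neg_right, Complex.neg_re,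
      LinearMap.comp_apply, h5]
    ring
  have hwX : ∀ t, w t ∈ constraintModes Q R ρ ω := by
    intro t
    rw [← constraintSymbol_eq_zero_iff hξ, constraintSymbol_propagator hC hξ, hφ]
  have hanti : Antitone (fun t => e t * Real.exp (μ * t)) := by
    have hd : ∀ t, HasDerivAt (fun t => e t * Real.exp (μ * t))
        (-(2 * (inner ℂ (w t) (T (modeOp A L ρ ω (w t)))).re) * Real.exp (μ * t) +
          e t * (Real.exp (μ * t) * μ)) t := fun t => by
      have h := ((hasDerivAt_id t).const_mul μ).exp
      simp only [id, mul_one] at h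
      exact (hed t).mul h
    refine antitone_of_deriv_nonpos (fun t => (hd t).differentiableAt) (fun t => ?_)
    rw [(hd t).deriv]
    have h1 := hTd (w t) (hwX t)
    have h2 : μ * e t ≤ 2 * (c * (ρ / (1 + ρ ^ 2)) ^ 2 * ‖w t‖ ^ 2) := by
      calc μ * e t ≤ μ * (C₀ * ‖w t‖ ^ 2) := by gcongr; exact hTu (w t)
        _ = _ := by simp only [μ]; field_simp
    have h3 := Real.exp_pos (μ * t)
    nlinarith
  have h1 := hanti ht
  simp only [mul_zero, Real.exp_zero, mul_one] at h1
  have hw0 : w 0 = φ := propagator_zero ξ φ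
  have h2 : c₀ * ‖w t‖ ^ 2 * Real.exp (μ * t) ≤ C₀ * ‖φ‖ ^ 2 := by
    calc _ ≤ e t * Real.exp (μ * t) := by gcongr; exact hTl (w t)
      _ ≤ e 0 := h1
      _ ≤ _ := by rw [← hw0]; exact hTu (w 0)
  -- Passing from ρ = 2π|ξ| to |ξ| in ρ/(1+ρ²) costs only a factor 2π.
  have hμ : 2 * (c / C₀ / (2 * Real.pi) ^ 2 * (‖ξ‖ / (1 + ‖ξ‖ ^ 2)) ^ 2) ≤ μ := by
    have : ‖ξ‖ / (1 + ‖ξ‖ ^ 2) / (2 * Real.pi) ≤ ρ / (1 + ρ ^ 2) := by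
      rw [div_div, div_le_div_iff₀ (by positivity) (by positivity), hρd]
      have h2p : (1 : ℝ) ≤ (2 * Real.pi) ^ 2 := by nlinarith
      nlinarith [mul_pos hn hn]
    calc 2 * (c / C₀ / (2 * Real.pi) ^ 2 * (‖ξ‖ / (1 + ‖ξ‖ ^ 2)) ^ 2)
        = 2 * (c / C₀ * (‖ξ‖ / (1 + ‖ξ‖ ^ 2) / (2 * Real.pi)) ^ 2) := by field_simp
      _ ≤ _ := by simp only [μ]; gcongr
  refine abs_le_of_sq_le_sq' ?_ (by positivity) |>.2
  rw [mul_pow, mul_pow, Real.sq_sqrt (by positivity), ← Real.exp_nat_mul]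
  have h3 : Real.exp (-(μ * t)) ≤
      Real.exp ((2 : ℕ) * (-(c / C₀ / (2 * Real.pi) ^ 2) * (‖ξ‖ / (1 + ‖ξ‖ ^ 2)) ^ 2 * t)) := by
    rw [Real.exp_le_exp]
    push_cast
    nlinarith [mul_le_mul_of_nonneg_right hμ ht]
  calc ‖w t‖ ^ 2 = c₀ * ‖w t‖ ^ 2 * Real.exp (μ * t) * Real.exp (-(μ * t)) / c₀ := by
        rw [Real.exp_neg]; field_simp
    _ ≤ C₀ * ‖φ‖ ^ 2 * Real.exp (-(μ * t)) / c₀ := by gcongr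
    _ = C₀ / c₀ * Real.exp (-(μ * t)) * ‖φ‖ ^ 2 := by ring
    _ ≤ _ := by gcongr

end HypSys

set_option linter.unusedSectionVars false

/-! ### The Hausdorff-Young inequality by real interpolation -/

section HausdorffYoung

open FourierTransform

variable {E F : Type*} [NormedAddCommGroup E] [InnerProductSpace ℝ E] [FiniteDimensional ℝ E]
  [MeasurableSpace E] [BorelSpace E]
  [NormedAddCommGroup F] [InnerProductSpace ℂ F] [CompleteSpace F]

/-- `g` represents the Fourier transform of `f` in the sense of tempered distributions. -/
def IsFourierPair (f g : E → F) : Prop :=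
  ∀ ψ : 𝓢(E, ℂ), ∫ x, (𝓕 ψ : 𝓢(E, ℂ)) x • f x = ∫ x, ψ x • g x

theorem SchwartzMap.integrable_smul_of_memLp (ψ : 𝓢(E, ℂ)) {p : ℝ≥0∞} (hp : 1 ≤ p) {f : E → F}
    (hf : MemLp f p volume) : Integrable (fun x => ψ x • f x) := by
  have : ENNReal.HolderConjugate p (1 - p⁻¹)⁻¹ := ENNReal.HolderConjugate.inv_one_sub_inv' hp
  have : ENNReal.HolderTriple (1 - p⁻¹)⁻¹ p 1 := this.symm
  exact memLp_one_iff_integrable.1 (hf.smul (ψ.memLp (1 - p⁻¹)⁻¹))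

theorem isFourierPair_of_integrable {f : E → F} (hf : Integrable f) : IsFourierPair f (𝓕 f) := by
  intro ψ
  have := VectorFourier.integral_fourierIntegral_smul_eq_flip (L := innerₗ E) (μ := volume)
    (ν := volume) Real.continuous_fourierChar continuous_inner ψ.integrable hf
  simpa using! this

theorem exists_isFourierPair_of_memLp_two {f : E → F} (hf : MemLp f 2 volume) :
    ∃ g : E → F, MemLp g 2 volume ∧ eLpNorm g 2 volume = eLpNorm f 2 volume ∧
      IsFourierPair f g := by
  refine ⟨(𝓕 (hf.toLp f) : Lp F 2 (volume : Measure E)), Lp.memLp _, ?_, ?_⟩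
  · have := Lp.norm_fourier_eq (hf.toLp f)
    rw [Lp.norm_def, Lp.norm_def, ENNReal.toReal_eq_toReal_iff' (Lp.eLpNorm_ne_top _)
      (Lp.eLpNorm_ne_top _)] at this
    rw [this]
    exact eLpNorm_congr_ae hf.coeFn_toLp
  · intro ψ
    have := DFunLike.congr_fun (Lp.fourier_toTemperedDistribution_eq (hf.toLp f)) ψ
    rw [TemperedDistribution.fourier_apply, Lp.toTemperedDistribution_apply,
      Lp.toTemperedDistribution_apply] at this
    rw [← this]
    refine integral_congr_ae ?_
    filter_upwards [hf.coeFn_toLp] with x hx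
    rw [hx]

theorem ae_eq_of_forall_integral_schwartz_smul {g g' : E → F} (hg : LocallyIntegrable g)
    (hg' : LocallyIntegrable g') (h : ∀ ψ : 𝓢(E, ℂ), ∫ x, ψ x • g x = ∫ x, ψ x • g' x) :
    g =ᵐ[volume] g' := by
  refine ae_eq_of_integral_contDiff_smul_eq hg hg' (fun ψ hψ hc => ?_)
  have h1 : HasCompactSupport (Complex.ofRealCLM ∘ ψ) := hc.comp_left rfl
  have h2 : ContDiff ℝ ((⊤ : ℕ∞) : WithTop ℕ∞) (Complex.ofRealCLM ∘ ψ) :=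
    Complex.ofRealCLM.contDiff.comp hψ
  simpa using! h (h1.toSchwartzMap h2)

theorem IsFourierPair.add {f f' g g' : E → F} {p p' r r' : ℝ≥0∞} (hp : 1 ≤ p) (hp' : 1 ≤ p')
    (hr : 1 ≤ r) (hr' : 1 ≤ r') (hf : MemLp f p volume) (hf' : MemLp f' p' volume)
    (hg : MemLp g r volume) (hg' : MemLp g' r' volume)
    (h : IsFourierPair f g) (h' : IsFourierPair f' g') : IsFourierPair (f + f') (g + g') := by
  intro ψ
  simp only [Pi.add_apply, smul_add]
  rw [integral_add ((𝓕 ψ).integrable_smul_of_memLp hp hf)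
      ((𝓕 ψ).integrable_smul_of_memLp hp' hf'),
    integral_add (ψ.integrable_smul_of_memLp hr hg) (ψ.integrable_smul_of_memLp hr' hg'), h ψ, h' ψ]

theorem norm_fourier_le_integral_norm (f : E → F) (x : E) : ‖𝓕 f x‖ ≤ ∫ y, ‖f y‖ :=
  VectorFourier.norm_fourierIntegral_le_integral_norm _ _ _ _ _

theorem memLp_top_fourier {f : E → F} (hf : Integrable f) : MemLp (𝓕 f) ∞ volume := by
  have hc : Continuous (𝓕 f) :=
    VectorFourier.fourierIntegral_continuous Real.continuous_fourierChar continuous_inner hf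
  exact memLp_top_of_bound hc.aestronglyMeasurable _
    (Filter.Eventually.of_forall (norm_fourier_le_integral_norm f))

/-- The part of `f` where `2 ‖f‖^(1 - q) < s`, which is where `f` is large. -/
noncomputable def largePart (q s : ℝ) (f : E → F) : E → F :=
  {x | 2 * ‖f x‖ ^ (1 - q) < s}.indicator f

/-- The part of `f` where `s ≤ 2 ‖f‖^(1 - q)`, which is where `f` is small. -/
noncomputable def smallPart (q s : ℝ) (f : E → F) : E → F :=
  {x | s ≤ 2 * ‖f x‖ ^ (1 - q)}.indicator f

theorem largePart_add_smallPart (q s : ℝ) (f : E → F) : largePart q s f + smallPart q s f = f := by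
  have : {x | s ≤ 2 * ‖f x‖ ^ (1 - q)} = {x | 2 * ‖f x‖ ^ (1 - q) < s}ᶜ := by
    ext x; simp
  rw [largePart, smallPart, this, Set.indicator_self_add_compl]

variable {q s : ℝ} {f : E → F}

theorem measurable_two_mul_norm_rpow (hm : StronglyMeasurable f) (q : ℝ) :
    Measurable fun x => 2 * ‖f x‖ ^ (1 - q) := (hm.norm.measurable.pow_const _).const_mul 2

/-- Since |f| = |f|^(1-q)|f|^q, the cut is placed so that the large part has L¹ norm at most s/2
when ∫|f|^q ≤ 1; its Fourier transform is then at most s/2 everywhere. -/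
theorem norm_largePart_le (hs : 0 < s) (x : E) :
    ‖largePart q s f x‖ ≤ s / 2 * ‖f x‖ ^ q := by
  by_cases h : 2 * ‖f x‖ ^ (1 - q) < s
  · rw [largePart, Set.indicator_of_mem (by exact h)]
    rcases (norm_nonneg (f x)).eq_or_lt with h0 | h0
    · rw [← h0]; positivity
    · calc ‖f x‖ = ‖f x‖ ^ (1 - q) * ‖f x‖ ^ q := by
            rw [← Real.rpow_add h0, sub_add_cancel, Real.rpow_one]
        _ ≤ _ := by gcongr; linarith
  · rw [largePart, Set.indicator_of_notMem (by exact h), norm_zero]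
    positivity

/-- As q > 1, the cut bounds |f| from above by (2/s)^(1/(q-1)); hence |f|² is at most a constant
times |f|^q, and the small part lies in L². -/
theorem norm_smallPart_sq_le (hq1 : 1 < q) (hq2 : q < 2) (hs : 0 < s) (x : E) :
    ‖smallPart q s f x‖ ^ 2 ≤ ((2 / s) ^ (1 / (q - 1))) ^ (2 - q) * ‖f x‖ ^ q := by
  by_cases h : s ≤ 2 * ‖f x‖ ^ (1 - q)
  · rw [smallPart, Set.indicator_of_mem (by exact h)]
    rcases (norm_nonneg (f x)).eq_or_lt with h0 | h0
    · rw [← h0, zero_pow two_ne_zero]; positivity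
    · have h1 : ‖f x‖ ^ (q - 1) ≤ 2 / s := by
        rw [le_div_iff₀ hs]
        calc ‖f x‖ ^ (q - 1) * s ≤ ‖f x‖ ^ (q - 1) * (2 * ‖f x‖ ^ (1 - q)) := by gcongr
          _ = 2 * (‖f x‖ ^ (q - 1) * ‖f x‖ ^ (1 - q)) := by ring
          _ = 2 := by rw [← Real.rpow_add h0]; simp
      have h2 : ‖f x‖ ≤ (2 / s) ^ (1 / (q - 1)) := by
        have := Real.rpow_le_rpow (by positivity) h1 (show 0 ≤ 1 / (q - 1) by
          apply one_div_nonneg.2; linarith)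
        rwa [← Real.rpow_mul h0.le, mul_one_div_cancel (by linarith), Real.rpow_one] at this
      calc ‖f x‖ ^ 2 = ‖f x‖ ^ (2 - q) * ‖f x‖ ^ q := by
            rw [← Real.rpow_add h0, sub_add_cancel]; norm_cast
        _ ≤ _ := by gcongr
  · rw [smallPart, Set.indicator_of_notMem (by exact h), norm_zero, zero_pow two_ne_zero]
    positivity

theorem integrable_largePart (hs : 0 < s) (hm : StronglyMeasurable f)
    (hf : Integrable fun x => ‖f x‖ ^ q) : Integrable (largePart q s f) := by
  refine (hf.const_mul (s / 2)).mono' ?_ (Filter.Eventually.of_forall (norm_largePart_le hs))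
  exact (hm.indicator (measurableSet_lt (measurable_two_mul_norm_rpow hm q)
    measurable_const)).aestronglyMeasurable

theorem memLp_smallPart (hq1 : 1 < q) (hq2 : q < 2) (hs : 0 < s) (hm : StronglyMeasurable f)
    (hf : Integrable fun x => ‖f x‖ ^ q) : MemLp (smallPart q s f) 2 volume := by
  have hm' : AEStronglyMeasurable (smallPart q s f) volume :=
    (hm.indicator (measurableSet_le measurable_const
      (measurable_two_mul_norm_rpow hm q))).aestronglyMeasurable
  rw [memLp_two_iff_integrable_sq_norm hm']
  refine (hf.const_mul (((2 / s) ^ (1 / (q - 1))) ^ (2 - q))).mono' (hm'.norm.pow 2) ?_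
  refine Filter.Eventually.of_forall fun x => ?_
  rw [Real.norm_of_nonneg (by positivity)]
  exact norm_smallPart_sq_le hq1 hq2 hs x

theorem exists_isFourierPair_of_integrable_rpow (hq1 : 1 < q) (hq2 : q < 2)
    (hm : StronglyMeasurable f) (hf : Integrable fun x => ‖f x‖ ^ q) :
    ∃ g : E → F, LocallyIntegrable g ∧ IsFourierPair f g := by
  obtain ⟨b, hb, -, hfb⟩ :=
    exists_isFourierPair_of_memLp_two (memLp_smallPart hq1 hq2 one_pos hm hf)
  have ha := integrable_largePart one_pos hm hf
  refine ⟨𝓕 (largePart q 1 f) + b, ((memLp_top_fourier ha).locallyIntegrable le_top).add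
    (hb.locallyIntegrable one_le_two), ?_⟩
  have := (isFourierPair_of_integrable ha).add le_rfl one_le_two le_top one_le_two
    (memLp_one_iff_integrable.2 ha) (memLp_smallPart hq1 hq2 one_pos hm hf)
    (memLp_top_fourier ha) hb hfb
  rwa [largePart_add_smallPart] at this

/-- Where |g| > s, the transform of the large part accounts for at most s/2, so that of the small
part is at least s/2. Chebyshev's inequality in L² and Plancherel conclude. -/
theorem IsFourierPair.measure_lt_norm_le {g : E → F} (hfg : IsFourierPair f g)
    (hg : LocallyIntegrable g) (hq1 : 1 < q) (hq2 : q < 2)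
    (hm : StronglyMeasurable f) (hf : Integrable fun x => ‖f x‖ ^ q) (hf1 : ∫ x, ‖f x‖ ^ q ≤ 1)
    (hs : 0 < s) :
    volume {x | s < ‖g x‖} ≤ ENNReal.ofReal (4 * s ^ (-2 : ℝ)) *
      ∫⁻ x, {x | s ≤ 2 * ‖f x‖ ^ (1 - q)}.indicator (fun x => ENNReal.ofReal (‖f x‖ ^ 2)) x := by
  have hbm := memLp_smallPart hq1 hq2 hs hm hf
  obtain ⟨b, hb, hbn, hfb⟩ := exists_isFourierPair_of_memLp_two hbm
  have ha := integrable_largePart hs hm hf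
  have hsum := (isFourierPair_of_integrable ha).add le_rfl one_le_two le_top one_le_two
    (memLp_one_iff_integrable.2 ha) hbm (memLp_top_fourier ha) hb hfb
  rw [largePart_add_smallPart] at hsum
  have hae : g =ᵐ[volume] 𝓕 (largePart q s f) + b :=
    ae_eq_of_forall_integral_schwartz_smul hg
      (((memLp_top_fourier ha).locallyIntegrable le_top).add (hb.locallyIntegrable one_le_two))
      (fun ψ => by rw [← hfg ψ, ← hsum ψ])
  have hal : ∀ x, ‖𝓕 (largePart q s f) x‖ ≤ s / 2 := fun x => by
    refine (norm_fourier_le_integral_norm _ x).trans ?_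
    calc ∫ y, ‖largePart q s f y‖ ≤ ∫ y, s / 2 * ‖f y‖ ^ q :=
          integral_mono ha.norm (hf.const_mul _) (norm_largePart_le hs)
      _ = s / 2 * ∫ y, ‖f y‖ ^ q := integral_const_mul _ _
      _ ≤ s / 2 * 1 := by gcongr
      _ = s / 2 := mul_one _
  have hle : volume {x | s < ‖g x‖} ≤ volume {x | ENNReal.ofReal (s / 2) ≤ ‖b x‖ₑ} := by
    refine measure_mono_ae ?_
    filter_upwards [hae] with x hx hgx
    change s < ‖g x‖ at hgx
    change ENNReal.ofReal (s / 2) ≤ ‖b x‖ₑ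
    rw [← ofReal_norm]
    refine ENNReal.ofReal_le_ofReal ?_
    rw [hx, Pi.add_apply] at hgx
    have := norm_add_le (𝓕 (largePart q s f) x) (b x)
    have := hal x
    linarith
  refine hle.trans ((meas_ge_le_mul_pow_eLpNorm_enorm volume two_ne_zero ENNReal.ofNat_ne_top
    hb.1 (by simpa using hs) (by simp)).trans ?_)
  rw [hbn]
  have h1 : eLpNorm (smallPart q s f) 2 volume ^ (2 : ℝ≥0∞).toReal =
      ∫⁻ x, {x | s ≤ 2 * ‖f x‖ ^ (1 - q)}.indicator (fun x => ENNReal.ofReal (‖f x‖ ^ 2)) x := by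
    rw [eLpNorm_eq_lintegral_rpow_enorm_toReal two_ne_zero ENNReal.ofNat_ne_top,
      ← ENNReal.rpow_mul]
    simp only [ENNReal.toReal_ofNat, ne_eq, OfNat.ofNat_ne_zero, not_false_eq_true,
      div_mul_cancel₀, ENNReal.rpow_one]
    refine lintegral_congr fun x => ?_
    by_cases h : s ≤ 2 * ‖f x‖ ^ (1 - q)
    · rw [smallPart, Set.indicator_of_mem (by exact h), Set.indicator_of_mem (by exact h),
        ← ofReal_norm, ENNReal.ofReal_rpow_of_nonneg (norm_nonneg _) zero_le_two]
      norm_cast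
    · rw [smallPart, Set.indicator_of_notMem (by exact h), Set.indicator_of_notMem (by exact h)]
      simp
  have h2 : (ENNReal.ofReal (s / 2))⁻¹ ^ (2 : ℝ≥0∞).toReal = ENNReal.ofReal (4 * s ^ (-2 : ℝ)) := by
    rw [← ENNReal.ofReal_inv_of_pos (by positivity), ENNReal.toReal_ofNat,
      ENNReal.ofReal_rpow_of_nonneg (by positivity) zero_le_two]
    congr 1
    rw [Real.rpow_neg hs.le]
    norm_cast
    field_simp
    norm_num
  rw [h1, h2]

theorem lintegral_Ioc_rpow {a r : ℝ} (ha : 0 ≤ a) (hr : 0 < r) :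
    ∫⁻ s in Set.Ioc 0 a, ENNReal.ofReal (s ^ (r - 1)) = ENNReal.ofReal (a ^ r / r) := by
  have hint : IntervalIntegrable (fun s : ℝ => s ^ (r - 1)) volume 0 a :=
    intervalIntegral.intervalIntegrable_rpow' (by linarith)
  rw [← ofReal_integral_eq_lintegral_ofReal
    ((intervalIntegrable_iff_integrableOn_Ioc_of_le ha).1 hint), ← intervalIntegral.integral_of_le ha,
    integral_rpow (Or.inl (by linarith))]
  · simp [hr.ne']
  · filter_upwards [ae_restrict_mem measurableSet_Ioc] with s hs
    exact Real.rpow_nonneg hs.1.le _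

/-- The normalized Hausdorff-Young inequality, by real interpolation. -/
theorem IsFourierPair.lintegral_rpow_le {g : E → F} (hfg : IsFourierPair f g)
    (hg : LocallyIntegrable g) {q' : ℝ} (hqq : q.HolderConjugate q') (hq2 : q < 2)
    (hm : StronglyMeasurable f) (hf : Integrable fun x => ‖f x‖ ^ q) (hf1 : ∫ x, ‖f x‖ ^ q ≤ 1) :
    ∫⁻ x, ENNReal.ofReal (‖g x‖ ^ q') ≤
      ENNReal.ofReal (q' * (4 * (2 ^ (q' - 2) / (q' - 2)))) := by
  have hq1 : 1 < q := hqq.lt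
  have hq'1 : 1 < q' := hqq.symm.lt
  have hmul : q * q' = q + q' := hqq.mul_eq_add
  have hq'2 : 2 < q' := by nlinarith
  have hD : MeasurableSet {p : ℝ × E | p.1 ≤ 2 * ‖f p.2‖ ^ (1 - q)} :=
    measurableSet_le measurable_fst ((measurable_two_mul_norm_rpow hm q).comp measurable_snd)
  have hfm : Measurable fun x => ENNReal.ofReal (‖f x‖ ^ 2) :=
    (hm.norm.measurable.pow_const 2).ennreal_ofReal
  calc ∫⁻ x, ENNReal.ofReal (‖g x‖ ^ q')
      = ENNReal.ofReal q' * ∫⁻ s in Set.Ioi 0, volume {x | s < ‖g x‖} *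
          ENNReal.ofReal (s ^ (q' - 1)) :=
        lintegral_rpow_eq_lintegral_meas_lt_mul volume
          (Filter.Eventually.of_forall fun x => norm_nonneg _)
          hg.aestronglyMeasurable.norm.aemeasurable (by linarith)
    _ ≤ ENNReal.ofReal q' * ∫⁻ s in Set.Ioi 0, ∫⁻ x,
          {p : ℝ × E | p.1 ≤ 2 * ‖f p.2‖ ^ (1 - q)}.indicator
            (fun p => ENNReal.ofReal (4 * p.1 ^ (q' - 2 - 1)) * ENNReal.ofReal (‖f p.2‖ ^ 2))
            (s, x) := by
        gcongr ENNReal.ofReal q' * ?_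
        refine setLIntegral_mono' measurableSet_Ioi fun s hs => ?_
        have hs' : (0 : ℝ) < s := hs
        calc volume {x | s < ‖g x‖} * ENNReal.ofReal (s ^ (q' - 1))
            ≤ ENNReal.ofReal (4 * s ^ (-2 : ℝ)) * (∫⁻ x, {x | s ≤ 2 * ‖f x‖ ^ (1 - q)}.indicator
                (fun x => ENNReal.ofReal (‖f x‖ ^ 2)) x) * ENNReal.ofReal (s ^ (q' - 1)) := by
              gcongr
              exact hfg.measure_lt_norm_le hg hq1 hq2 hm hf hf1 hs'
          _ = ENNReal.ofReal (4 * s ^ (q' - 2 - 1)) * ∫⁻ x,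
                {x | s ≤ 2 * ‖f x‖ ^ (1 - q)}.indicator
                  (fun x => ENNReal.ofReal (‖f x‖ ^ 2)) x := by
              rw [mul_right_comm, ← ENNReal.ofReal_mul (by positivity), mul_assoc,
                ← Real.rpow_add hs']
              congr 3
              ring_nf
          _ = ∫⁻ x, ENNReal.ofReal (4 * s ^ (q' - 2 - 1)) *
                {x | s ≤ 2 * ‖f x‖ ^ (1 - q)}.indicator
                  (fun x => ENNReal.ofReal (‖f x‖ ^ 2)) x := by
              rw [lintegral_const_mul]
              exact hfm.indicator (measurableSet_le measurable_const
                (measurable_two_mul_norm_rpow hm q))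
          _ ≤ _ := by
              refine lintegral_mono fun x => ?_
              by_cases h : s ≤ 2 * ‖f x‖ ^ (1 - q)
              · rw [Set.indicator_of_mem (by exact h), Set.indicator_of_mem (by exact h)]
              · rw [Set.indicator_of_notMem (by exact h), mul_zero]
                exact zero_le
    _ = ENNReal.ofReal q' * ∫⁻ x, ∫⁻ s in Set.Ioi 0,
          {p : ℝ × E | p.1 ≤ 2 * ‖f p.2‖ ^ (1 - q)}.indicator
            (fun p => ENNReal.ofReal (4 * p.1 ^ (q' - 2 - 1)) * ENNReal.ofReal (‖f p.2‖ ^ 2))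
            (s, x) := by
        -- After Tonelli, s runs over (0, 2|f|^(1-q)] for fixed x, and s^(q'-3) is integrable there
        -- because q' > 2.
        rw [lintegral_lintegral_swap]
        refine (Measurable.indicator ?_ hD).aemeasurable
        exact (((measurable_fst.pow_const _).const_mul 4).ennreal_ofReal).mul
          (hfm.comp measurable_snd)
    _ = ENNReal.ofReal q' * ∫⁻ x,
          ENNReal.ofReal (4 * (2 ^ (q' - 2) / (q' - 2))) * ENNReal.ofReal (‖f x‖ ^ q) := by
        congr 1
        refine lintegral_congr fun x => ?_
        set v := ‖f x‖ with hv
        have hv0 : 0 ≤ v := norm_nonneg _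
        have ha : 0 ≤ 2 * v ^ (1 - q) := by positivity
        calc ∫⁻ s in Set.Ioi 0, {p : ℝ × E | p.1 ≤ 2 * ‖f p.2‖ ^ (1 - q)}.indicator
              (fun p => ENNReal.ofReal (4 * p.1 ^ (q' - 2 - 1)) * ENNReal.ofReal (‖f p.2‖ ^ 2))
              (s, x)
            = ∫⁻ s in Set.Ioi 0, (Set.Iic (2 * v ^ (1 - q))).indicator (fun s =>
                ENNReal.ofReal (4 * s ^ (q' - 2 - 1)) * ENNReal.ofReal (v ^ 2)) s := rfl
          _ = ∫⁻ s in Set.Ioc 0 (2 * v ^ (1 - q)),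
                ENNReal.ofReal (4 * s ^ (q' - 2 - 1)) * ENNReal.ofReal (v ^ 2) := by
              rw [lintegral_indicator measurableSet_Iic, Measure.restrict_restrict measurableSet_Iic,
                Set.inter_comm, Set.Ioi_inter_Iic]
          _ = ENNReal.ofReal 4 * ENNReal.ofReal (v ^ 2) *
                ∫⁻ s in Set.Ioc 0 (2 * v ^ (1 - q)), ENNReal.ofReal (s ^ (q' - 2 - 1)) := by
              rw [← lintegral_const_mul _ (by fun_prop)]
              refine lintegral_congr fun s => ?_
              rw [ENNReal.ofReal_mul zero_le_four]
              ring
          _ = ENNReal.ofReal (4 * v ^ 2 * ((2 * v ^ (1 - q)) ^ (q' - 2) / (q' - 2))) := by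
              rw [lintegral_Ioc_rpow ha (by linarith), ← ENNReal.ofReal_mul zero_le_four,
                ← ENNReal.ofReal_mul (by positivity)]
          _ = _ := by
              rw [← ENNReal.ofReal_mul (mul_nonneg zero_le_four
                (div_nonneg (by positivity) (by linarith)))]
              congr 1
              -- The exponents add up to q because qq' = q + q'.
              have h1 : v ^ 2 * (v ^ (1 - q)) ^ (q' - 2) = v ^ q := by
                rcases hv0.eq_or_lt with h0 | h0
                · rw [← h0, Real.zero_rpow (by linarith : q ≠ 0)]; simp
                · rw [← Real.rpow_mul h0.le, ← Real.rpow_natCast, ← Real.rpow_add h0]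
                  congr 1
                  push_cast
                  linarith
              rw [Real.mul_rpow zero_le_two (by positivity), ← h1]
              ring
    _ = ENNReal.ofReal q' * (ENNReal.ofReal (4 * (2 ^ (q' - 2) / (q' - 2))) *
          ENNReal.ofReal (∫ x, ‖f x‖ ^ q)) := by
        rw [lintegral_const_mul' _ _ ENNReal.ofReal_ne_top, ofReal_integral_eq_lintegral_ofReal hf
          (Filter.Eventually.of_forall fun x => by positivity)]
    _ ≤ ENNReal.ofReal q' * (ENNReal.ofReal (4 * (2 ^ (q' - 2) / (q' - 2))) *
          ENNReal.ofReal 1) := by gcongr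
    _ = _ := by
        rw [ENNReal.ofReal_one, mul_one, ENNReal.ofReal_mul (show 0 ≤ q' by linarith)]

theorem IsFourierPair.smul {g : E → F} (h : IsFourierPair f g) (c : ℂ) :
    IsFourierPair (c • f) (c • g) := by
  intro ψ
  simp only [Pi.smul_apply, smul_comm _ c]
  rw [integral_smul, integral_smul, h ψ]

theorem IsFourierPair.congr_left {f' g : E → F} (h : IsFourierPair f g) (hff : f =ᵐ[volume] f') :
    IsFourierPair f' g := by
  intro ψ
  rw [← h ψ]
  refine integral_congr_ae ?_
  filter_upwards [hff] with x hx
  rw [hx]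

/-- The Hausdorff-Young inequality (with a non-optimal constant). -/
theorem exists_isFourierPair_eLpNorm_le (E F : Type*) [NormedAddCommGroup E] [InnerProductSpace ℝ E]
    [FiniteDimensional ℝ E] [MeasurableSpace E] [BorelSpace E] [NormedAddCommGroup F]
    [InnerProductSpace ℂ F] [CompleteSpace F] {q : ℝ≥0∞} (hq1 : 1 ≤ q) (hq2 : q ≤ 2) :
    ∃ C : ℝ, 0 < C ∧ ∀ f : E → F, MemLp f q volume → ∃ g : E → F,
      MemLp g (1 - q⁻¹)⁻¹ volume ∧
      eLpNorm g (1 - q⁻¹)⁻¹ volume ≤ ENNReal.ofReal C * eLpNorm f q volume ∧ IsFourierPair f g := by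
  rcases hq1.eq_or_lt with rfl | hq1
  · refine ⟨1, one_pos, fun f hf => ⟨𝓕 f, ?_, ?_, ?_⟩⟩
    · simpa using memLp_top_fourier (memLp_one_iff_integrable.1 hf)
    · simp only [inv_one, tsub_self, ENNReal.inv_zero, ENNReal.ofReal_one, one_mul]
      refine eLpNormEssSup_le_of_ae_enorm_bound (Filter.Eventually.of_forall fun x => ?_)
      have h := norm_fourier_le_integral_norm f x
      rw [← ofReal_norm, eLpNorm_one_eq_lintegral_enorm]
      refine (ENNReal.ofReal_le_ofReal h).trans_eq ?_
      exact ofReal_integral_norm_eq_lintegral_enorm (memLp_one_iff_integrable.1 hf)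
    · exact isFourierPair_of_integrable (memLp_one_iff_integrable.1 hf)
  rcases hq2.eq_or_lt with rfl | hq2
  · refine ⟨1, one_pos, fun f hf => ?_⟩
    obtain ⟨g, hg, hn, hfg⟩ := exists_isFourierPair_of_memLp_two hf
    have h2 : (1 - (2 : ℝ≥0∞)⁻¹)⁻¹ = 2 := by rw [ENNReal.one_sub_inv_two, inv_inv]
    rw [h2]
    exact ⟨g, hg, by simp [hn], hfg⟩
  have hqt : q ≠ ∞ := hq2.ne_top
  have hq0 : q ≠ 0 := (zero_lt_one.trans hq1).ne'
  set p : ℝ := q.toReal with hp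
  have hp1 : 1 < p := by
    rw [hp, ← ENNReal.toReal_one]; exact (ENNReal.toReal_lt_toReal ENNReal.one_ne_top hqt).2 hq1
  have hp2 : p < 2 := by
    rw [hp, ← ENNReal.toReal_ofNat]; exact (ENNReal.toReal_lt_toReal hqt ENNReal.ofNat_ne_top).2 hq2
  have hc := Real.HolderConjugate.conjExponent hp1
  set p' : ℝ := p.conjExponent
  have hp'0 : 0 < p' := hc.symm.pos
  have hq' : (1 - q⁻¹)⁻¹ = ENNReal.ofReal p' := by
    have h1 : q⁻¹ = ENNReal.ofReal p⁻¹ := by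
      rw [ENNReal.ofReal_inv_of_pos (by linarith), hp, ENNReal.ofReal_toReal hqt]
    rw [h1, ← ENNReal.ofReal_one, ← ENNReal.ofReal_sub _ (by positivity), hc.one_sub_inv,
      ENNReal.ofReal_inv_of_pos hp'0, inv_inv]
  set B : ℝ := p' * (4 * (2 ^ (p' - 2) / (p' - 2))) with hB
  have hmul : p * p' = p + p' := hc.mul_eq_add
  have hp'2 : 2 < p' := by nlinarith
  have hB0 : 0 < B := by have : 0 < p' - 2 := by linarith
                         positivity
  refine ⟨B ^ (1 / p'), by positivity, fun f hf => ?_⟩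
  rw [hq']
  have hnorm : ∀ g : E → F, eLpNorm g (ENNReal.ofReal p') volume =
      (∫⁻ x, ENNReal.ofReal (‖g x‖ ^ p')) ^ (1 / p') := by
    intro g
    rw [eLpNorm_eq_lintegral_rpow_enorm_toReal (by simpa using hp'0) ENNReal.ofReal_ne_top,
      ENNReal.toReal_ofReal hp'0.le]
    congr 1
    refine lintegral_congr fun x => ?_
    rw [← ofReal_norm, ENNReal.ofReal_rpow_of_nonneg (norm_nonneg _) hp'0.le]
  by_cases hz : eLpNorm f q volume = 0
  · refine ⟨0, MemLp.zero, by simp, ?_⟩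
    have : f =ᵐ[volume] 0 := (eLpNorm_eq_zero_iff hf.1 hq0).1 hz
    refine IsFourierPair.congr_left (f := 0) (fun ψ => by simp) this.symm
  set N : ℝ := (eLpNorm f q volume).toReal with hN
  have hN0 : 0 < N := ENNReal.toReal_pos hz hf.eLpNorm_ne_top
  have hNe : eLpNorm f q volume = ENNReal.ofReal N := (ENNReal.ofReal_toReal hf.eLpNorm_ne_top).symm
  -- A strongly measurable representative, normalized in L^q; the scalar and the null set are
  -- restored at the end.
  set f₁ : E → F := ((N⁻¹ : ℝ) : ℂ) • hf.1.mk f with hf₁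
  have hm₁ : StronglyMeasurable f₁ := hf.1.stronglyMeasurable_mk.const_smul _
  have hfm : MemLp (hf.1.mk f) q volume := hf.ae_eq hf.1.ae_eq_mk
  have hL₁ : MemLp f₁ q volume := hfm.const_smul _
  have hn₁ : eLpNorm f₁ q volume = 1 := by
    rw [hf₁, eLpNorm_const_smul, ← eLpNorm_congr_ae hf.1.ae_eq_mk, hNe, ← ofReal_norm,
      ← ENNReal.ofReal_mul (norm_nonneg _), Complex.norm_real, Real.norm_of_nonneg (by positivity),
      inv_mul_cancel₀ hN0.ne', ENNReal.ofReal_one]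
  have hint : Integrable fun x => ‖f₁ x‖ ^ p := hL₁.integrable_norm_rpow hq0 hqt
  have hint1 : ∫ x, ‖f₁ x‖ ^ p ≤ 1 := by
    have := hL₁.eLpNorm_eq_integral_rpow_norm hq0 hqt
    rw [hn₁] at this
    have h2 : (∫ x, ‖f₁ x‖ ^ p) ^ p⁻¹ = 1 := by
      have h3 := congrArg ENNReal.toReal this
      rw [ENNReal.toReal_ofReal (by positivity)] at h3
      simpa using h3.symm
    have h0 : 0 ≤ ∫ x, ‖f₁ x‖ ^ p := integral_nonneg fun x => by positivity
    rw [Real.rpow_inv_eq h0 zero_le_one (by linarith)] at h2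
    simp [h2]
  obtain ⟨g, hgl, hfg⟩ := exists_isFourierPair_of_integrable_rpow hp1 hp2 hm₁ hint
  have hle := hfg.lintegral_rpow_le hgl hc hp2 hm₁ hint hint1
  have hgn : eLpNorm g (ENNReal.ofReal p') volume ≤ ENNReal.ofReal (B ^ (1 / p')) := by
    rw [hnorm, ← ENNReal.ofReal_rpow_of_nonneg hB0.le (by positivity)]
    gcongr
  have hgm : MemLp g (ENNReal.ofReal p') volume :=
    ⟨hgl.aestronglyMeasurable, hgn.trans_lt ENNReal.ofReal_lt_top⟩
  refine ⟨((N : ℝ) : ℂ) • g, hgm.const_smul _, ?_, ?_⟩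
  · rw [eLpNorm_const_smul, hNe, mul_comm, ← ofReal_norm, Complex.norm_real,
      Real.norm_of_nonneg hN0.le]
    gcongr
  · refine (hfg.smul ((N : ℝ) : ℂ)).congr_left ?_
    filter_upwards [hf.1.ae_eq_mk] with x hx
    rw [hf₁, Pi.smul_apply, Pi.smul_apply, smul_smul, ← Complex.ofReal_mul, mul_inv_cancel₀ hN0.ne',
      Complex.ofReal_one, one_smul, hx]

end HausdorffYoung

/-! ### Completeness of the Schwartz space -/

section SchwartzComplete

open Filter Topology

variable {E F : Type*} [NormedAddCommGroup E] [NormedSpace ℝ E] [NormedAddCommGroup F]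
  [NormedSpace ℝ F]

theorem SchwartzMap.iteratedFDeriv_sub_apply (f g : 𝓢(E, F)) (l : ℕ) (x : E) :
    iteratedFDeriv ℝ l (f - g : 𝓢(E, F)) x = iteratedFDeriv ℝ l f x - iteratedFDeriv ℝ l g x := by
  have : ((f - g : 𝓢(E, F)) : E → F) = (f : E → F) - (g : E → F) := by
    ext y; simp
  rw [this, _root_.iteratedFDeriv_sub_apply (f.smooth l).contDiffAt (g.smooth l).contDiffAt]

theorem SchwartzMap.eventually_seminorm_sub_lt {u : ℕ → 𝓢(E, F)} (hu : CauchySeq u) (k l : ℕ)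
    {ε : ℝ} (hε : 0 < ε) :
    ∃ N, ∀ a ≥ N, ∀ b ≥ N, SchwartzMap.seminorm ℝ k l (u a - u b) < ε := by
  have hc : Continuous (SchwartzMap.seminorm ℝ k l : 𝓢(E, F) → ℝ) :=
    (schwartz_withSeminorms ℝ E F).continuous_seminorm (k, l)
  have h1 : Tendsto (fun p : ℕ × ℕ => u p.1 - u p.2) atTop (𝓝 0) := by
    have := cauchySeq_iff_tendsto.1 hu
    rw [uniformity_eq_comap_nhds_zero_swapped, tendsto_comap_iff] at this
    exact this
  have h2 := (hc.tendsto 0).comp h1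
  rw [map_zero] at h2
  have h3 := h2.eventually (gt_mem_nhds hε)
  rw [eventually_atTop] at h3
  obtain ⟨⟨N, M⟩, h⟩ := h3
  exact ⟨max N M, fun a ha b hb => h (a, b) ⟨(le_max_left _ _).trans ha, (le_max_right _ _).trans hb⟩⟩

instance SchwartzMap.instCompleteSpace [CompleteSpace F] : CompleteSpace 𝓢(E, F) := by
  have : (uniformity 𝓢(E, F)).IsCountablyGenerated := IsUniformAddGroup.uniformity_countably_generated
  refine UniformSpace.complete_of_cauchySeq_tendsto (fun u hu => ?_)
  have hdist : ∀ l a b x, dist (iteratedFDeriv ℝ l (u a) x) (iteratedFDeriv ℝ l (u b) x) ≤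
      SchwartzMap.seminorm ℝ 0 l (u a - u b) := fun l a b x => by
    rw [dist_eq_norm, ← iteratedFDeriv_sub_apply]
    exact norm_iteratedFDeriv_le_seminorm ℝ _ _ _
  have hunif : ∀ l, UniformCauchySeqOn (fun a x => iteratedFDeriv ℝ l (u a) x) atTop Set.univ := by
    intro l
    rw [Metric.uniformCauchySeqOn_iff]
    intro ε hε
    obtain ⟨N, hN⟩ := eventually_seminorm_sub_lt hu 0 l hε
    exact ⟨N, fun a ha b hb x _ => (hdist l a b x).trans_lt (hN a ha b hb)⟩
  have hlim : ∀ x l, ∃ p, Tendsto (fun a => iteratedFDeriv ℝ l (u a) x) atTop (𝓝 p) := fun x l =>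
    cauchySeq_tendsto_of_complete ((hunif l).cauchySeq (Set.mem_univ x))
  choose p hp using hlim
  have hU : ∀ l, TendstoUniformlyOn (fun a x => iteratedFDeriv ℝ l (u a) x) (p · l) atTop Set.univ :=
    fun l => (hunif l).tendstoUniformlyOn_of_tendsto (fun x _ => hp x l)
  -- Every derivative converges uniformly, so the limits p form a Taylor series of the limit
  -- function, which is therefore smooth.
  have hT : HasFTaylorSeriesUpTo ((⊤ : ℕ∞) : WithTop ℕ∞) (fun x => (p x 0).curry0) p := by
    have hf : ∀ l : ℕ, ∀ x, HasFDerivAt (fun y => p y l) (p x l.succ).curryLeft x := by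
      intro l x
      refine hasFDerivAt_of_tendstoUniformlyOn (f := fun a y => iteratedFDeriv ℝ l (u a) y)
        (f' := fun a y => (iteratedFDeriv ℝ (l + 1) (u a) y).curryLeft)
        (g' := fun y => (p y l.succ).curryLeft) isOpen_univ ?_ ?_ (fun y _ => hp y l)
        (Set.mem_univ x)
      · have hl := (continuousMultilinearCurryLeftEquiv ℝ (fun _ : Fin (l + 1) => E)
          F).isometry.uniformContinuous
        exact hl.comp_tendstoUniformlyOn (hU (l + 1))
      · intro a y _
        have hd : DifferentiableAt ℝ (iteratedFDeriv ℝ l (u a)) y :=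
          ((u a).smooth (l + 1)).differentiable_iteratedFDeriv (by exact_mod_cast Nat.lt_succ_self l) y
        have := hd.hasFDerivAt
        rw [fderiv_iteratedFDeriv] at this
        exact this
    exact ⟨fun x => rfl, fun l _ x => hf l x, fun l _ => continuous_iff_continuousAt.2
      fun x => (hf l x).continuousAt⟩
  have hD : ∀ l x, iteratedFDeriv ℝ l (fun x => (p x 0).curry0) x = p x l := fun l x =>
    (hT.eq_iteratedFDeriv (by exact_mod_cast le_top) x).symm
  have hclose : ∀ k l, ∀ ε > 0, ∃ N, ∀ a ≥ N, ∀ x,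
      ‖x‖ ^ k * ‖iteratedFDeriv ℝ l (u a) x - p x l‖ ≤ ε := by
    intro k l ε hε
    obtain ⟨N, hN⟩ := eventually_seminorm_sub_lt hu k l hε
    refine ⟨N, fun a ha x => ?_⟩
    -- Let b tend to infinity in the Cauchy estimate for `u a - u b`.
    refine le_of_tendsto (((hp x l).const_sub (iteratedFDeriv ℝ l (u a) x)).norm.const_mul
      (‖x‖ ^ k)) ?_
    filter_upwards [eventually_ge_atTop N] with b hb
    rw [← iteratedFDeriv_sub_apply]
    exact (le_seminorm ℝ k l _ x).trans (hN a ha b hb).le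
  let f : 𝓢(E, F) :=
    { toFun := fun x => (p x 0).curry0
      smooth' := hT.contDiff
      decay' := fun k l => by
        obtain ⟨N, hN⟩ := hclose k l 1 one_pos
        refine ⟨SchwartzMap.seminorm ℝ k l (u N) + 1, fun x => ?_⟩
        rw [hD]
        have h1 := hN N le_rfl x
        have h2 := le_seminorm ℝ k l (u N) x
        have h3 : ‖p x l‖ ≤ ‖iteratedFDeriv ℝ l (u N) x‖ +
            ‖iteratedFDeriv ℝ l (u N) x - p x l‖ := by
          rw [← norm_neg (iteratedFDeriv ℝ l (u N) x - p x l), neg_sub]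
          exact norm_le_norm_add_norm_sub' _ _
        calc ‖x‖ ^ k * ‖p x l‖ ≤ ‖x‖ ^ k * (‖iteratedFDeriv ℝ l (u N) x‖ +
              ‖iteratedFDeriv ℝ l (u N) x - p x l‖) := by gcongr
          _ ≤ _ := by rw [mul_add]; gcongr }
  refine ⟨f, ?_⟩
  rw [(schwartz_withSeminorms ℝ E F).tendsto_nhds_atTop]
  rintro ⟨k, l⟩ ε hε
  obtain ⟨N, hN⟩ := hclose k l (ε / 2) (half_pos hε)
  refine ⟨N, fun a ha => ?_⟩
  refine lt_of_le_of_lt (seminorm_le_bound ℝ k l _ (half_pos hε).le (fun x => ?_)) (half_lt_self hε)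
  rw [iteratedFDeriv_sub_apply]
  have : iteratedFDeriv ℝ l f x = p x l := hD l x
  rw [this]
  exact hN a ha x

end SchwartzComplete

/-! ### Uniform boundedness for tempered distributions -/

section Equicontinuity

open Filter Topology

variable {E F : Type*} [NormedAddCommGroup E] [NormedSpace ℝ E] [NormedAddCommGroup F]
  [NormedSpace ℂ F]

/-- The space is complete with a countably generated uniformity, so Baire's theorem applies. -/
instance SchwartzMap.instBarrelledSpace : BarrelledSpace ℂ 𝓢(E, ℂ) := by
  have : (uniformity 𝓢(E, ℂ)).IsCountablyGenerated := IsUniformAddGroup.uniformity_countably_generated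
  infer_instance

/-- Pointwise bounded families of tempered distributions have uniformly bounded order. -/
theorem TemperedDistribution.exists_uniform_bound {ι : Type*} (d : ι → 𝓢'(E, F))
    (h : ∀ ψ : 𝓢(E, ℂ), ∃ B, ∀ i, ‖d i ψ‖ ≤ B) :
    ∃ (s : Finset (ℕ × ℕ)) (C : ℝ), 0 < C ∧ ∀ i, ∀ ψ : 𝓢(E, ℂ),
      ‖d i ψ‖ ≤ C * (s.sup (schwartzSeminormFamily ℂ E ℂ)) ψ := by
  -- The same maps, repackaged as plain continuous linear maps, to which Banach-Steinhaus applies.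
  let D : ι → 𝓢(E, ℂ) →L[ℂ] F := fun i => ⟨(d i).toLinearMap, (d i).cont⟩
  have heq := (norm_withSeminorms ℂ F).banach_steinhaus (𝓕 := D) (fun _ ψ => by
    obtain ⟨B, hB⟩ := h ψ
    refine ⟨B, ?_⟩
    rintro _ ⟨i, rfl⟩
    exact hB i)
  replace heq := ((norm_withSeminorms ℂ F).uniformEquicontinuous_iff_exists_continuous_seminorm
    (fun i => (D i).toLinearMap)).1 heq
  obtain ⟨p, hp, hpD⟩ := heq 0
  obtain ⟨s, C, hC, hs⟩ := Seminorm.bound_of_continuous (schwartz_withSeminorms ℂ E ℂ) p hp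
  refine ⟨s, C, by positivity, fun i ψ => ?_⟩
  exact (hpD i ψ).trans (hs ψ)

end Equicontinuity

/-! ### Density of compactly supported functions -/

section Density

open Filter Topology

variable {E F : Type*} [NormedAddCommGroup E] [InnerProductSpace ℝ E] [FiniteDimensional ℝ E]
  [NormedAddCommGroup F] [NormedSpace ℝ F]

theorem exists_norm_iteratedFDeriv_le_of_hasCompactSupport {χ : E → ℝ}
    (hχ : ContDiff ℝ ((⊤ : ℕ∞) : WithTop ℕ∞) χ) (hc : HasCompactSupport χ) (i : ℕ) :
    ∃ C : ℝ, 0 ≤ C ∧ ∀ x, ‖iteratedFDeriv ℝ i χ x‖ ≤ C := by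
  have hcont : Continuous (iteratedFDeriv ℝ i χ) :=
    hχ.continuous_iteratedFDeriv (by exact_mod_cast le_top)
  obtain ⟨C, hC⟩ := (hc.iteratedFDeriv i).exists_bound_of_continuous hcont
  exact ⟨C, (norm_nonneg _).trans (hC 0), hC⟩

/-- Smooth functions with compact support are dense in the Schwartz space. -/
theorem SchwartzMap.exists_hasCompactSupport_tendsto (f : 𝓢(E, F)) :
    ∃ u : ℕ → 𝓢(E, F), (∀ a, HasCompactSupport (u a)) ∧ Tendsto u atTop (𝓝 f) := by
  let χ : ContDiffBump (0 : E) := ⟨1, 2, one_pos, one_lt_two⟩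
  have hχs : ContDiff ℝ ((⊤ : ℕ∞) : WithTop ℕ∞) (χ : E → ℝ) := χ.contDiff
  let g : ℕ → E →L[ℝ] E := fun a => ((a : ℝ) + 1)⁻¹ • ContinuousLinearMap.id ℝ E
  have hg : ∀ a, ‖g a‖ ≤ 1 := fun a => by
    have h1 : ‖((a : ℝ) + 1)⁻¹‖ ≤ 1 := by
      rw [Real.norm_of_nonneg (by positivity)]
      exact inv_le_one_of_one_le₀ (by linarith [(Nat.cast_nonneg a : (0 : ℝ) ≤ a)])
    calc ‖g a‖ = ‖((a : ℝ) + 1)⁻¹‖ * ‖ContinuousLinearMap.id ℝ E‖ := norm_smul _ _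
      _ ≤ (1 : ℝ) * 1 := by gcongr; exact ContinuousLinearMap.norm_id_le
      _ = 1 := one_mul 1
  -- The error of truncation is `e a` times f. Its factor vanishes where |x| < a + 1, and its
  -- derivatives are bounded uniformly in a because the dilations have norm at most 1.
  let e : ℕ → E → ℝ := fun a x => 1 - χ (g a x)
  have hes : ∀ a, ContDiff ℝ ((⊤ : ℕ∞) : WithTop ℕ∞) (e a) := fun a =>
    contDiff_const.sub (hχs.comp (g a).contDiff)
  have hχg : ∀ a, HasCompactSupport (fun x => χ (g a x)) := fun a => by
    have ha : ((a : ℝ) + 1)⁻¹ ≠ 0 := by positivity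
    exact χ.hasCompactSupport.comp_homeomorph (Homeomorph.smulOfNeZero _ ha)
  have hwc : ∀ a, HasCompactSupport (fun x => χ (g a x) • f x) := fun a => (hχg a).smul_right
  have hws : ∀ a, ContDiff ℝ ((⊤ : ℕ∞) : WithTop ℕ∞) (fun x => χ (g a x) • f x) := fun a =>
    (hχs.comp (g a).contDiff).smul (f.smooth _)
  refine ⟨fun a => (hwc a).toSchwartzMap (hws a), hwc, ?_⟩
  have hzero : ∀ (a : ℕ) x, ‖x‖ < (a : ℝ) + 1 → ∀ i, iteratedFDeriv ℝ i (e a) x = 0 := by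
    intro a x hx i
    have : e a =ᶠ[𝓝 x] fun _ => (0 : ℝ) := by
      filter_upwards [(isOpen_lt continuous_norm continuous_const).mem_nhds hx] with y hy
      have hy' : ‖y‖ < (a : ℝ) + 1 := hy
      have : χ (g a y) = 1 := χ.one_of_mem_closedBall (by
        rw [mem_closedBall_zero_iff]
        change ‖((a : ℝ) + 1)⁻¹ • y‖ ≤ 1
        rw [norm_smul, Real.norm_of_nonneg (by positivity), inv_mul_le_iff₀ (by positivity), mul_one]
        exact hy'.le)
      simp [e, this]
    rw [(Filter.EventuallyEq.iteratedFDeriv ℝ this i).eq_of_nhds]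
    exact congrFun iteratedFDeriv_fun_zero x
  have hbd : ∀ i, ∃ C : ℝ, 0 ≤ C ∧ ∀ a x, ‖iteratedFDeriv ℝ i (e a) x‖ ≤ C := by
    intro i
    obtain ⟨C, hC, hCχ⟩ :=
      exists_norm_iteratedFDeriv_le_of_hasCompactSupport hχs χ.hasCompactSupport i
    refine ⟨‖iteratedFDeriv ℝ i (fun _ : E => (1 : ℝ)) (0 : E)‖ + C + 1, by positivity,
      fun a x => ?_⟩
    have h1 : iteratedFDeriv ℝ i (e a) x = iteratedFDeriv ℝ i (fun _ : E => (1 : ℝ)) x -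
        iteratedFDeriv ℝ i ((χ : E → ℝ) ∘ g a) x := by
      have : e a = (fun _ : E => (1 : ℝ)) - ((χ : E → ℝ) ∘ g a) := rfl
      rw [this, _root_.iteratedFDeriv_sub_apply contDiff_const.contDiffAt
        ((hχs.of_le (by exact_mod_cast le_top)).comp (g a).contDiff).contDiffAt]
    have h2 : ‖iteratedFDeriv ℝ i ((χ : E → ℝ) ∘ g a) x‖ ≤ C := by
      rw [(g a).iteratedFDeriv_comp_right hχs x (by exact_mod_cast le_top)]
      refine (ContinuousMultilinearMap.norm_compContinuousLinearMap_le _ _).trans ?_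
      calc _ ≤ C * ∏ _i : Fin i, (1 : ℝ) := by
            gcongr
            · exact hCχ _
            · exact hg a
        _ = C := by simp
    have h3 : ‖iteratedFDeriv ℝ i (fun _ : E => (1 : ℝ)) x‖ =
        ‖iteratedFDeriv ℝ i (fun _ : E => (1 : ℝ)) (0 : E)‖ := by
      rcases i with _ | i
      · simp
      · rw [iteratedFDeriv_succ_const]; simp
    rw [h1]
    calc _ ≤ ‖iteratedFDeriv ℝ i (fun _ : E => (1 : ℝ)) x‖ +
          ‖iteratedFDeriv ℝ i ((χ : E → ℝ) ∘ g a) x‖ := norm_sub_le _ _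
      _ ≤ _ := by rw [h3]; linarith
  choose B hB hBe using hbd
  rw [(schwartz_withSeminorms ℝ E F).tendsto_nhds_atTop]
  rintro ⟨k, l⟩ ε hε
  -- One extra power of |x|, at least a + 1 on the region that matters, is spent to gain the factor
  -- 1/(a + 1).
  set M : ℝ := ∑ i ∈ Finset.range (l + 1), (l.choose i : ℝ) * B i *
    SchwartzMap.seminorm ℝ (k + 1) (l - i) f with hM
  have hM0 : 0 ≤ M := Finset.sum_nonneg fun i _ =>
    mul_nonneg (mul_nonneg (Nat.cast_nonneg _) (hB i)) (apply_nonneg _ _)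
  obtain ⟨N, hN⟩ := exists_nat_gt (M / ε)
  refine ⟨N, fun a ha => ?_⟩
  have ha' : (N : ℝ) ≤ a := by exact_mod_cast ha
  have hMa : M / ((a : ℝ) + 1) < ε := by
    rw [div_lt_iff₀ (by positivity)]
    rw [div_lt_iff₀ hε] at hN
    nlinarith
  refine lt_of_le_of_lt (seminorm_le_bound ℝ k l _ (by positivity) (fun x => ?_)) hMa
  have hfun : (((hwc a).toSchwartzMap (hws a) - f : 𝓢(E, F)) : E → F) = -fun x => e a x • f x := by
    ext x
    simp only [sub_apply, Pi.neg_apply, e, sub_smul, one_smul, neg_sub]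
    rfl
  rw [hfun, iteratedFDeriv_neg_apply, norm_neg]
  have hle := norm_iteratedFDeriv_smul_le (hes a) (f.smooth _) x (n := l) (by exact_mod_cast le_top)
  rw [le_div_iff₀ (by positivity)]
  rcases lt_or_ge ‖x‖ ((a : ℝ) + 1) with hx | hx
  · have : ‖iteratedFDeriv ℝ l (fun x => e a x • f x) x‖ ≤ 0 := by
      refine hle.trans_eq (Finset.sum_eq_zero fun i _ => ?_)
      rw [hzero a x hx i]; simp
    have h0 := le_antisymm this (norm_nonneg _)
    rw [h0]; simpa using hM0
  · calc ‖x‖ ^ k * ‖iteratedFDeriv ℝ l (fun x => e a x • f x) x‖ * ((a : ℝ) + 1)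
        ≤ ‖x‖ ^ k * (∑ i ∈ Finset.range (l + 1), (l.choose i : ℝ) * ‖iteratedFDeriv ℝ i (e a) x‖ *
            ‖iteratedFDeriv ℝ (l - i) f x‖) * ‖x‖ := by gcongr
      _ = ∑ i ∈ Finset.range (l + 1), (l.choose i : ℝ) * ‖iteratedFDeriv ℝ i (e a) x‖ *
            (‖x‖ ^ (k + 1) * ‖iteratedFDeriv ℝ (l - i) f x‖) := by
          rw [Finset.mul_sum, Finset.sum_mul]
          refine Finset.sum_congr rfl fun i _ => ?_
          ring
      _ ≤ M := by
          refine Finset.sum_le_sum fun i _ => ?_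
          have := hBe i a x
          have := le_seminorm ℝ (k + 1) (l - i) f x
          have := hB i
          gcongr

end Density

/-! ### Differential inequalities -/

section Uniqueness

open Filter Topology

/-- A continuous function vanishing at `0` with `‖y'(s)‖ ≤ B sᵏ` on `(0, T)` is bounded by
`B tᵏ⁺¹ / (k + 1)`. -/
theorem norm_le_mul_pow_succ_of_norm_deriv_le {F : Type*} [NormedAddCommGroup F] [NormedSpace ℝ F]
    {y y' : ℝ → F} {T B : ℝ} {k : ℕ} (hB : 0 ≤ B) (hc : ContinuousOn y (Set.Icc 0 T)) (h0 : y 0 = 0)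
    (hd : ∀ s, 0 < s → HasDerivAt y (y' s) s)
    (hb : ∀ s ∈ Set.Icc 0 T, 0 < s → ‖y' s‖ ≤ B * s ^ k) {t : ℝ} (ht : t ∈ Set.Icc 0 T) :
    ‖y t‖ ≤ B * (t ^ (k + 1) / (k + 1)) := by
  rcases ht.1.eq_or_lt with rfl | ht0
  · rw [h0]; simp
  -- The function need not be differentiable at 0, so the comparison starts at ε > 0, and continuity
  -- at 0 allows ε to tend to 0.
  have hε : ∀ ε ∈ Set.Ioc 0 t, ‖y t‖ ≤ B * (t ^ (k + 1) / (k + 1)) + ‖y ε‖ := by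
    intro ε hε
    have hder : ∀ x : ℝ, HasDerivAt (fun x : ℝ => B * (x ^ (k + 1) / (k + 1)) + ‖y ε‖) (B * x ^ k) x := by
      intro x
      have h := (((hasDerivAt_pow (k + 1) x).div_const ((k : ℝ) + 1)).const_mul B).add_const ‖y ε‖
      refine h.congr_deriv ?_
      have : (k : ℝ) + 1 ≠ 0 := by positivity
      push_cast
      field_simp
    refine image_norm_le_of_norm_deriv_right_le_deriv_boundary (a := ε) (b := t)
      (hc.mono (Set.Icc_subset_Icc hε.1.le ht.2))
      (fun x hx => (hd x (hε.1.trans_le hx.1)).hasDerivWithinAt) ?_ hder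
      (fun x hx => hb x ⟨hε.1.le.trans hx.1, hx.2.le.trans ht.2⟩ (hε.1.trans_le hx.1))
      ⟨hε.2, le_rfl⟩
    have : 0 ≤ ε := hε.1.le
    have : 0 ≤ B * (ε ^ (k + 1) / (k + 1)) := by positivity
    linarith
  have hlim : Tendsto (fun ε => B * (t ^ (k + 1) / (k + 1)) + ‖y ε‖) (𝓝[>] 0)
      (𝓝 (B * (t ^ (k + 1) / (k + 1)) + ‖y 0‖)) := by
    have : ContinuousWithinAt y (Set.Ioc 0 t) 0 :=
      (hc 0 ⟨le_rfl, ht0.le.trans ht.2⟩).mono fun x hx => ⟨hx.1.le, hx.2.trans ht.2⟩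
    have h2 : Tendsto y (𝓝[>] 0) (𝓝 (y 0)) := by
      rw [← nhdsWithin_Ioc_eq_nhdsGT ht0]; exact this
    exact h2.norm.const_add _
  rw [h0, norm_zero, add_zero] at hlim
  refine ge_of_tendsto hlim ?_
  filter_upwards [Ioc_mem_nhdsGT ht0] with ε h using hε ε h

theorem eq_zero_of_forall_norm_le_pow_div_factorial {F : Type*} [NormedAddCommGroup F] {y : F}
    {C x : ℝ} (h : ∀ k : ℕ, ‖y‖ ≤ C * (x ^ k / k.factorial)) : y = 0 := by
  have := (FloorSemiring.tendsto_pow_div_factorial_atTop x).const_mul C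
  rw [mul_zero] at this
  exact norm_le_zero_iff.1 (ge_of_tendsto this (Eventually.of_forall h))

/-- An infinite system of differential inequalities of first order with zero initial data. -/
theorem eq_zero_of_norm_deriv_le_sum {ι F : Type*} [Fintype ι] [NormedAddCommGroup F]
    [NormedSpace ℝ F] {y : List ι → ℝ → F} {T Λ C M : ℝ} (hΛ : 0 ≤ Λ) (hC : 0 ≤ C) (hM : 0 ≤ M)
    (hc : ∀ α, ContinuousOn (y α) (Set.Icc 0 T)) (h0 : ∀ α, y α 0 = 0)
    (hd : ∀ α s, 0 < s → ∃ v, HasDerivAt (y α) v s ∧ ‖v‖ ≤ Λ * (∑ j, ‖y (j :: α) s‖ + ‖y α s‖))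
    (hb : ∀ α, ∀ t ∈ Set.Icc 0 T, ‖y α t‖ ≤ C * M ^ α.length) (α : List ι) {t : ℝ}
    (ht : t ∈ Set.Icc 0 T) : y α t = 0 := by
  -- Each of the longer words on the right costs one factor M, so Γ is the total cost of a time
  -- integration.
  set Γ : ℝ := Λ * (Fintype.card ι * M + 1) with hΓ
  have hΓ0 : 0 ≤ Γ := by positivity
  have key : ∀ k : ℕ, ∀ α, ∀ t ∈ Set.Icc 0 T,
      ‖y α t‖ ≤ C * M ^ α.length * Γ ^ k / k.factorial * t ^ k := by
    intro k
    induction k with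
    | zero => intro α t ht; simpa using hb α t ht
    | succ k ih =>
      intro α t ht
      have hd' : ∀ s, ∃ v, 0 < s → HasDerivAt (y α) v s ∧
          ‖v‖ ≤ Λ * (∑ j, ‖y (j :: α) s‖ + ‖y α s‖) := fun s => by
        by_cases hs : 0 < s
        · obtain ⟨v, hv⟩ := hd α s hs
          exact ⟨v, fun _ => hv⟩
        · exact ⟨0, fun h => absurd h hs⟩
      choose v hv using hd'
      refine (norm_le_mul_pow_succ_of_norm_deriv_le (k := k)
        (B := C * M ^ α.length * Γ ^ k / k.factorial * Γ) (by positivity) (hc α) (h0 α)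
        (fun s hs => (hv s hs).1) (fun s hs hs0 => ?_) ht).trans_eq ?_
      · refine (hv s hs0).2.trans ?_
        calc Λ * (∑ j, ‖y (j :: α) s‖ + ‖y α s‖)
            ≤ Λ * (∑ _j : ι, C * M ^ (α.length + 1) * Γ ^ k / k.factorial * s ^ k +
              C * M ^ α.length * Γ ^ k / k.factorial * s ^ k) := by
              gcongr with j
              · exact ih (j :: α) s hs
              · exact ih α s hs
          _ = _ := by
              rw [Finset.sum_const, Finset.card_univ, nsmul_eq_mul, hΓ]
              ring
      · rw [Nat.factorial_succ]
        push_cast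
        have : (k : ℝ) + 1 ≠ 0 := by positivity
        field_simp
        ring
  refine eq_zero_of_forall_norm_le_pow_div_factorial (C := C * M ^ α.length) (x := Γ * t)
    (fun k => (key k α t ht).trans_eq ?_)
  rw [mul_pow Γ t k]; ring

end Uniqueness

/-! ### Multiplication by frequency monomials -/

section FrequencyWords

open FourierTransform Filter Topology

variable {E : Type*} [NormedAddCommGroup E] [InnerProductSpace ℝ E]

/-- Multiplication by `2πi ⟨ξ, v⟩`. -/
noncomputable def freqMul (v : E) (φ : 𝓢(E, ℂ)) : 𝓢(E, ℂ) :=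
  (2 * Real.pi * Complex.I) • SchwartzMap.smulLeftCLM ℂ (inner ℝ · v) φ

theorem hasTemperateGrowth_inner_right (v : E) : (inner ℝ · v : E → ℝ).HasTemperateGrowth :=
  ((innerSL ℝ).flip v).hasTemperateGrowth

theorem freqMul_apply (v : E) (φ : 𝓢(E, ℂ)) (ξ : E) :
    freqMul v φ ξ = (2 * Real.pi * Complex.I) * ((inner ℝ ξ v : ℝ) : ℂ) * φ ξ := by
  simp [freqMul, SchwartzMap.smulLeftCLM_apply_apply (hasTemperateGrowth_inner_right v), mul_assoc]

/-- On the ball that carries φ, the linear factor and its derivatives are bounded, so no order of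
seminorm is lost. As M depends only on the ball, iteration over a word of length k costs M^k. -/
theorem exists_sup_seminorm_freqMul_le [FiniteDimensional ℝ E] (v : E) (r : ℝ) (N : ℕ) :
    ∃ M : ℝ, 0 ≤ M ∧ ∀ φ : 𝓢(E, ℂ), (∀ ξ, r < ‖ξ‖ → φ ξ = 0) →
      (Finset.Iic (N, N)).sup (schwartzSeminormFamily ℂ E ℂ) (freqMul v φ) ≤
        M * (Finset.Iic (N, N)).sup (schwartzSeminormFamily ℂ E ℂ) φ := by
  have hgs : ContDiff ℝ ((⊤ : ℕ∞) : WithTop ℕ∞) (inner ℝ · v : E → ℝ) :=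
    ((innerSL ℝ).flip v).contDiff
  have hG : ∀ i, ∃ G : ℝ, 0 ≤ G ∧ ∀ ξ ∈ Metric.closedBall (0 : E) r,
      ‖iteratedFDeriv ℝ i (inner ℝ · v : E → ℝ) ξ‖ ≤ G := by
    intro i
    obtain ⟨G, hG⟩ := (isCompact_closedBall (0 : E) r).exists_bound_of_continuousOn
      (hgs.continuous_iteratedFDeriv (m := i) (by exact_mod_cast le_top)).continuousOn
    exact ⟨max G 0, le_max_right _ _, fun ξ hξ => (hG ξ hξ).trans (le_max_left _ _)⟩
  choose G hG0 hG using hG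
  refine ⟨2 * Real.pi * ∑ l ∈ Finset.range (N + 1), ∑ i ∈ Finset.range (l + 1), l.choose i * G i,
    mul_nonneg (by positivity) (Finset.sum_nonneg fun l _ => Finset.sum_nonneg fun i _ =>
      mul_nonneg (Nat.cast_nonneg _) (hG0 i)), fun φ hφ => ?_⟩
  set P := (Finset.Iic (N, N)).sup (schwartzSeminormFamily ℂ E ℂ) with hP
  set S : ℕ → ℝ := fun l => ∑ i ∈ Finset.range (l + 1), l.choose i * G i with hS
  have hS0 : ∀ l, 0 ≤ S l := fun l => Finset.sum_nonneg fun i _ =>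
    mul_nonneg (Nat.cast_nonneg _) (hG0 i)
  have hPφ : ∀ k ≤ N, ∀ l ≤ N, ∀ x, ‖x‖ ^ k * ‖iteratedFDeriv ℝ l φ x‖ ≤ P φ := by
    intro k hk l hl x
    refine (SchwartzMap.le_seminorm ℂ k l φ x).trans ?_
    exact Seminorm.le_finset_sup_apply (p := schwartzSeminormFamily ℂ E ℂ) (i := (k, l))
      (Finset.mem_Iic.2 ⟨hk, hl⟩)
  have hP0 : 0 ≤ P φ := apply_nonneg _ _
  refine Seminorm.finset_sup_apply_le (mul_nonneg (mul_nonneg (by positivity)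
    (Finset.sum_nonneg fun l _ => hS0 l)) hP0) ?_
  rintro ⟨k, l⟩ hkl
  obtain ⟨hk, hl⟩ := Finset.mem_Iic.1 hkl
  simp only at hk hl
  change SchwartzMap.seminorm ℂ k l _ ≤ _
  rw [freqMul, map_smul_eq_mul]
  have hn : ‖(2 * Real.pi * Complex.I : ℂ)‖ = 2 * Real.pi := by
    simp [abs_of_pos Real.pi_pos]
  rw [hn, mul_assoc (2 * Real.pi) _ (P φ)]
  refine mul_le_mul_of_nonneg_left ?_ Real.two_pi_pos.le
  have hSl : S l ≤ ∑ l ∈ Finset.range (N + 1), S l :=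
    Finset.single_le_sum (fun l _ => hS0 l) (Finset.mem_range.2 (Nat.lt_succ_of_le hl))
  refine le_trans ?_ (mul_le_mul_of_nonneg_right hSl hP0)
  refine SchwartzMap.seminorm_le_bound ℂ k l _ (mul_nonneg (hS0 l) hP0) fun x => ?_
  have hfun : ((SchwartzMap.smulLeftCLM ℂ (inner ℝ · v) φ : 𝓢(E, ℂ)) : E → ℂ) =
      fun x => (inner ℝ x v : ℝ) • φ x := by
    ext x
    rw [SchwartzMap.smulLeftCLM_apply_apply (hasTemperateGrowth_inner_right v)]
  rw [hfun]
  rcases le_or_gt ‖x‖ r with hx | hx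
  · have hle := norm_iteratedFDeriv_smul_le hgs (φ.smooth _) x (n := l) (by exact_mod_cast le_top)
    calc ‖x‖ ^ k * ‖iteratedFDeriv ℝ l (fun x => (inner ℝ x v : ℝ) • φ x) x‖
        ≤ ‖x‖ ^ k * ∑ i ∈ Finset.range (l + 1), (l.choose i : ℝ) *
            ‖iteratedFDeriv ℝ i (inner ℝ · v : E → ℝ) x‖ * ‖iteratedFDeriv ℝ (l - i) φ x‖ := by
          gcongr
      _ = ∑ i ∈ Finset.range (l + 1), (l.choose i : ℝ) *
            ‖iteratedFDeriv ℝ i (inner ℝ · v : E → ℝ) x‖ *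
              (‖x‖ ^ k * ‖iteratedFDeriv ℝ (l - i) φ x‖) := by
          rw [Finset.mul_sum]
          exact Finset.sum_congr rfl fun i _ => by ring
      _ ≤ ∑ i ∈ Finset.range (l + 1), (l.choose i : ℝ) * G i * P φ := by
          refine Finset.sum_le_sum fun i _ => ?_
          have h1 := hG i x (by simpa using hx)
          have h2 := hPφ k hk (l - i) ((Nat.sub_le _ _).trans hl) x
          have h3 := hG0 i
          gcongr
      _ = S l * P φ := by rw [hS, Finset.sum_mul]
  · have : (fun x => (inner ℝ x v : ℝ) • φ x) =ᶠ[𝓝 x] fun _ => (0 : ℂ) := by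
      filter_upwards [(isOpen_lt continuous_const continuous_norm).mem_nhds hx] with z hz
      rw [hφ z hz, smul_zero]
    rw [(Filter.EventuallyEq.iteratedFDeriv ℝ this l).eq_of_nhds]
    have h0 : iteratedFDeriv ℝ l (fun _ : E => (0 : ℂ)) x = 0 := congrFun iteratedFDeriv_fun_zero x
    rw [h0, norm_zero, mul_zero]
    exact mul_nonneg (hS0 l) hP0

end FrequencyWords

/-! ### Uniqueness of tempered solutions -/

namespace HypSys

open FourierTransform Filter Topology

variable {n m : ℕ} {A₀ : Matrix (Fin m) (Fin m) ℝ} {A : Fin n → Matrix (Fin m) (Fin m) ℝ}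
  {L : Matrix (Fin m) (Fin m) ℝ}

/-- The product of `φ` with the monomial `∏ 2πi ξⱼ` over a word in the indices. -/
noncomputable def wordMul (φ : 𝓢(Space n, ℂ)) (α : List (Fin n)) : 𝓢(Space n, ℂ) :=
  α.foldr (fun j φ => freqMul (stdVec j) φ) φ

theorem wordMul_cons (φ : 𝓢(Space n, ℂ)) (j : Fin n) (α : List (Fin n)) :
    wordMul φ (j :: α) = freqMul (stdVec j) (wordMul φ α) := rfl

theorem wordMul_eq_zero {φ : 𝓢(Space n, ℂ)} {ξ : Space n} (h : φ ξ = 0) (α : List (Fin n)) :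
    wordMul φ α ξ = 0 := by
  induction α with
  | nil => exact h
  | cons j α ih => rw [wordMul_cons, freqMul_apply, ih, mul_zero]

theorem exists_sup_seminorm_wordMul_le {φ : 𝓢(Space n, ℂ)} {r : ℝ}
    (hφ : ∀ ξ, r < ‖ξ‖ → φ ξ = 0) (N : ℕ) :
    ∃ M : ℝ, 0 ≤ M ∧ ∀ α : List (Fin n),
      (Finset.Iic (N, N)).sup (schwartzSeminormFamily ℂ (Space n) ℂ) (wordMul φ α) ≤
        (Finset.Iic (N, N)).sup (schwartzSeminormFamily ℂ (Space n) ℂ) φ * M ^ α.length := by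
  choose M hM0 hM using fun j : Fin n => exists_sup_seminorm_freqMul_le (stdVec j : Space n) r N
  refine ⟨∑ j, M j, Finset.sum_nonneg fun j _ => hM0 j, fun α => ?_⟩
  induction α with
  | nil => simp [wordMul]
  | cons j α ih =>
    rw [wordMul_cons, List.length_cons, pow_succ, ← mul_assoc, mul_comm _ (∑ j, M j)]
    refine (hM j _ (fun ξ hξ => wordMul_eq_zero (hφ ξ hξ) α)).trans ?_
    exact mul_le_mul (Finset.single_le_sum (fun j _ => hM0 j) (Finset.mem_univ j)) ih
      (apply_nonneg _ _) (Finset.sum_nonneg fun j _ => hM0 j)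

theorem lineDeriv_apply_fourierInv (u : 𝓢'(Space n, State m)) (j : Fin n) (φ : 𝓢(Space n, ℂ)) :
    (∂_{stdVec j} u) (𝓕⁻ φ) = -u (𝓕⁻ (freqMul (stdVec j) φ)) := by
  rw [TemperedDistribution.lineDerivOp_apply_apply, SchwartzMap.lineDerivOp_fourierInv_eq, map_neg]
  rfl

/-- Tempered solutions with zero initial data vanish. -/
theorem IsSolution.eq_zero (hA : ConditionA A₀ A L) {d : ℝ → 𝓢'(Space n, State m)}
    (hd : IsSolution A₀ A L 0 d) {t : ℝ} (ht : 0 ≤ t) : d t = 0 := by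
  have hcont : ∀ ψ : 𝓢(Space n, ℂ), ContinuousOn (fun t => d t ψ) (Set.Icc 0 t) := by
    intro ψ s hs
    rcases hs.1.eq_or_lt with h | h
    · subst h
      exact (hd.continuous_zero ψ).mono fun x hx => hx.1
    · obtain ⟨v, hv, -⟩ := hd.equation ψ s h
      exact hv.continuousAt.continuousWithinAt
  -- Weak continuity on the compact interval bounds d pointwise; Banach-Steinhaus turns this into a
  -- bound by one seminorm for all times.
  obtain ⟨s, C, hC, hb⟩ := TemperedDistribution.exists_uniform_bound
    (fun s : Set.Icc 0 t => (𝓕⁻ (d s) : 𝓢'(Space n, State m))) (fun ψ => by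
      obtain ⟨B, hB⟩ := isCompact_Icc.exists_bound_of_continuousOn (hcont (𝓕⁻ ψ))
      exact ⟨B, fun s => hB s s.2⟩)
  obtain ⟨N, hN⟩ : ∃ N : ℕ, s ⊆ Finset.Iic (N, N) := by
    refine ⟨s.sup (fun i => max i.1 i.2), fun i hi => ?_⟩
    have := Finset.le_sup (f := fun i : ℕ × ℕ => max i.1 i.2) hi
    exact Finset.mem_Iic.2 ⟨(le_max_left _ _).trans this, (le_max_right _ _).trans this⟩
  obtain ⟨C₁, hC₁, hA₀⟩ := (act A₀⁻¹).exists_norm_le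
  choose C₂ hC₂ hAj using fun j => (act (A j)).exists_norm_le
  obtain ⟨C₃, hC₃, hL⟩ := (act L).exists_norm_le
  have hcpt : ∀ φ : 𝓢(Space n, ℂ), HasCompactSupport φ → d t (𝓕⁻ φ) = 0 := by
    intro φ hφ
    obtain ⟨r, hr⟩ : ∃ r : ℝ, ∀ ξ, r < ‖ξ‖ → φ ξ = 0 := by
      obtain ⟨r, hr⟩ := hφ.isCompact.isBounded.subset_closedBall 0
      refine ⟨r, fun ξ hξ => ?_⟩
      by_contra hne
      have := hr (subset_tsupport _ hne)
      rw [mem_closedBall_zero_iff] at this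
      linarith
    obtain ⟨M, hM0, hM⟩ := exists_sup_seminorm_wordMul_le hr N
    refine eq_zero_of_norm_deriv_le_sum (y := fun α s => d s (𝓕⁻ (wordMul φ α))) (T := t)
      (Λ := C₁ * (∑ j, C₂ j + C₃))
      (C := C * (Finset.Iic (N, N)).sup (schwartzSeminormFamily ℂ (Space n) ℂ) φ) (M := M)
      (mul_nonneg hC₁.le (add_nonneg (Finset.sum_nonneg fun j _ => (hC₂ j).le) hC₃.le))
      (mul_nonneg hC.le (apply_nonneg _ _)) hM0
      (fun α => hcont _) (fun α => by simp [hd.initial]) ?_ ?_ [] ⟨ht, le_rfl⟩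
    · intro α s hs
      obtain ⟨v, hv, he⟩ := hd.equation (𝓕⁻ (wordMul φ α)) s hs
      refine ⟨v, hv, ?_⟩
      -- A space derivative lengthens the word by one letter: the equation at α involves only α and
      -- the words `j :: α`.
      simp only [lineDeriv_apply_fourierInv, ← wordMul_cons] at he
      have hv2 : v = act A₀⁻¹ (∑ j, act (A j) (d s (𝓕⁻ (wordMul φ (j :: α)))) -
          act L (d s (𝓕⁻ (wordMul φ α)))) := by
        have h1 : act A₀ v = ∑ j, act (A j) (d s (𝓕⁻ (wordMul φ (j :: α)))) -
            act L (d s (𝓕⁻ (wordMul φ α))) := by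
          simp only [map_neg, Finset.sum_neg_distrib] at he
          rw [add_assoc] at he
          rw [eq_neg_of_add_eq_zero_left he]
          abel
        rw [← h1, ← LinearMap.comp_apply, hA.act_inv_act.2, LinearMap.id_apply]
      rw [hv2, mul_assoc]
      refine (hA₀ _).trans ?_
      gcongr
      refine (norm_sub_le _ _).trans ?_
      have h1 : ‖∑ j, act (A j) (d s (𝓕⁻ (wordMul φ (j :: α))))‖ ≤
          (∑ j, C₂ j) * ∑ j, ‖d s (𝓕⁻ (wordMul φ (j :: α)))‖ := by
        refine (norm_sum_le _ _).trans ?_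
        rw [Finset.sum_mul]
        refine Finset.sum_le_sum fun j _ => (hAj j _).trans ?_
        gcongr
        · exact (hC₂ j).le
        · exact Finset.single_le_sum (f := fun j => ‖d s (𝓕⁻ (wordMul φ (j :: α)))‖)
            (fun j _ => norm_nonneg _) (Finset.mem_univ j)
      have h2 := hL (d s (𝓕⁻ (wordMul φ α)))
      have h3 : 0 ≤ ∑ j, C₂ j := Finset.sum_nonneg fun j _ => (hC₂ j).le
      have h4 : 0 ≤ ∑ j, ‖d s (𝓕⁻ (wordMul φ (j :: α)))‖ := Finset.sum_nonneg fun j _ => norm_nonneg _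
      have h5 := norm_nonneg (d s (𝓕⁻ (wordMul φ α)))
      nlinarith [mul_nonneg h3 h5, mul_nonneg hC₃.le h4]
    · intro α s hs
      calc ‖d s (𝓕⁻ (wordMul φ α))‖ ≤ C * _ := hb ⟨s, hs⟩ (wordMul φ α)
        _ ≤ C * (Finset.Iic (N, N)).sup (schwartzSeminormFamily ℂ (Space n) ℂ) (wordMul φ α) := by
            gcongr
            exact Finset.sup_mono (f := schwartzSeminormFamily ℂ (Space n) ℂ) hN _
        _ ≤ _ := by
            rw [mul_assoc]
            gcongr
            exact hM α
  ext1 χ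
  -- Compactly supported frequency functions are dense, and the Fourier transform of `d t` is
  -- continuous.
  obtain ⟨u, hu, hlim⟩ := (𝓕 χ : 𝓢(Space n, ℂ)).exists_hasCompactSupport_tendsto
  have h1 : Tendsto (fun a => (𝓕⁻ (d t) : 𝓢'(Space n, State m)) (u a)) atTop
      (𝓝 ((𝓕⁻ (d t) : 𝓢'(Space n, State m)) (𝓕 χ))) :=
    ((𝓕⁻ (d t) : 𝓢'(Space n, State m)).cont.tendsto _).comp hlim
  have h2 : ∀ a, (𝓕⁻ (d t) : 𝓢'(Space n, State m)) (u a) = 0 := fun a => hcpt (u a) (hu a)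
  simp only [h2] at h1
  have h3 := tendsto_nhds_unique h1 tendsto_const_nhds
  rw [TemperedDistribution.fourierInv_apply, FourierTransform.fourierInv_fourier_eq] at h3
  rw [h3]; rfl

theorem IsSolution.sub {w₀ w₀' : 𝓢'(Space n, State m)} {w w' : ℝ → 𝓢'(Space n, State m)}
    (h : IsSolution A₀ A L w₀ w) (h' : IsSolution A₀ A L w₀' w') :
    IsSolution A₀ A L (w₀ - w₀') (fun t => w t - w' t) where
  initial := by rw [h.initial, h'.initial]
  continuous_zero ψ := (h.continuous_zero ψ).sub (h'.continuous_zero ψ)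
  equation ψ t ht := by
    obtain ⟨v, hv, he⟩ := h.equation ψ t ht
    obtain ⟨v', hv', he'⟩ := h'.equation ψ t ht
    refine ⟨v - v', hv.sub hv', ?_⟩
    have e := sub_eq_zero.2 (he.trans he'.symm)
    rw [← e]
    have hs : ∀ j, (∂_{stdVec j} (w t - w' t) : 𝓢'(Space n, State m)) ψ =
        (∂_{stdVec j} (w t) : 𝓢'(Space n, State m)) ψ -
          (∂_{stdVec j} (w' t) : 𝓢'(Space n, State m)) ψ := fun j => by
      rw [TemperedDistribution.lineDerivOp_apply_apply,
        TemperedDistribution.lineDerivOp_apply_apply, TemperedDistribution.lineDerivOp_apply_apply]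
      rfl
    have hs' : (w t - w' t) ψ = w t ψ - w' t ψ := rfl
    simp only [hs, hs', map_sub, Finset.sum_sub_distrib]
    abel

theorem IsSolution.unique (hA : ConditionA A₀ A L) {w₀ : 𝓢'(Space n, State m)}
    {w w' : ℝ → 𝓢'(Space n, State m)} (h : IsSolution A₀ A L w₀ w) (h' : IsSolution A₀ A L w₀ w')
    {t : ℝ} (ht : 0 ≤ t) : w t = w' t := by
  have h1 := h.sub h'
  rw [sub_self] at h1
  exact sub_eq_zero.1 (h1.eq_zero hA ht)

end HypSys

/-! ### Distributions whose Fourier transform is a function -/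

namespace HypSys

open FourierTransform Filter Topology

variable {n m m₁ : ℕ}

/-- The Fourier transform of `u` is the (locally integrable, tempered) function `h`. -/
structure HasSpectrum (u : 𝓢'(Space n, State m)) (h : Space n → State m) : Prop where
  locallyIntegrable : LocallyIntegrable h
  integrable (φ : 𝓢(Space n, ℂ)) : Integrable fun ξ => φ ξ • h ξ
  apply_fourier (φ : 𝓢(Space n, ℂ)) : u (𝓕 φ) = ∫ ξ, φ ξ • h ξ

theorem HasSpectrum.apply {u : 𝓢'(Space n, State m)} {h : Space n → State m}
    (hu : HasSpectrum u h) (ψ : 𝓢(Space n, ℂ)) :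
    u ψ = ∫ ξ, (𝓕⁻ ψ : 𝓢(Space n, ℂ)) ξ • h ξ := by
  rw [← hu.apply_fourier, FourierTransform.fourier_fourierInv_eq]

theorem HasSpectrum.ae_eq {u : 𝓢'(Space n, State m)} {h h' : Space n → State m}
    (hu : HasSpectrum u h) (hu' : HasSpectrum u h') : h =ᵐ[volume] h' :=
  ae_eq_of_forall_integral_schwartz_smul hu.locallyIntegrable hu'.locallyIntegrable fun ψ => by
    rw [← hu.apply_fourier, hu'.apply_fourier]

theorem HasSpectrum.eq {u u' : 𝓢'(Space n, State m)} {h : Space n → State m}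
    (hu : HasSpectrum u h) (hu' : HasSpectrum u' h) : u = u' := by
  ext1 ψ
  rw [hu.apply, hu'.apply]

theorem exists_hasSpectrum {p : ℝ≥0∞} (hp : 1 ≤ p) {h : Space n → State m}
    (hh : MemLp h p volume) : ∃ u : 𝓢'(Space n, State m), HasSpectrum u h := by
  have : Fact (1 ≤ p) := ⟨hp⟩
  refine ⟨𝓕⁻ (Lp.toTemperedDistribution (hh.toLp h)), hh.locallyIntegrable hp,
    fun φ => φ.integrable_smul_of_memLp hp hh, fun φ => ?_⟩
  rw [TemperedDistribution.fourierInv_apply, FourierTransform.fourierInv_fourier_eq,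
    Lp.toTemperedDistribution_apply]
  refine integral_congr_ae ?_
  filter_upwards [hh.coeFn_toLp] with x hx
  rw [hx]

/-- The Hausdorff-Young inequality for the Fourier transform of a distribution in `L^q`. -/
theorem exists_hasSpectrum_eLpNorm_le (n m : ℕ) {q : ℝ≥0∞} (hq1 : 1 ≤ q) (hq2 : q ≤ 2) :
    ∃ C : ℝ, 0 < C ∧ ∀ u : 𝓢'(Space n, State m), lpNorm q u < ∞ → ∃ h : Space n → State m,
      HasSpectrum u h ∧ MemLp h (1 - q⁻¹)⁻¹ volume ∧
      eLpNorm h (1 - q⁻¹)⁻¹ volume ≤ ENNReal.ofReal C * lpNorm q u := by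
  obtain ⟨C, hC, hHY⟩ := exists_isFourierPair_eLpNorm_le (Space n) (State m) hq1 hq2
  have hq' : 1 ≤ (1 - q⁻¹)⁻¹ := by
    rw [ENNReal.one_le_inv]; exact tsub_le_self
  have key : ∀ (u : 𝓢'(Space n, State m)) (g : Space n → State m), MemLp g q volume →
      (∀ ψ : 𝓢(Space n, ℂ), u ψ = ∫ x, ψ x • g x) → ∃ h : Space n → State m,
      HasSpectrum u h ∧ MemLp h (1 - q⁻¹)⁻¹ volume ∧
      eLpNorm h (1 - q⁻¹)⁻¹ volume ≤ ENNReal.ofReal C * eLpNorm g q volume := by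
    intro u g hg hu
    obtain ⟨h, hh, hle, hgh⟩ := hHY g hg
    exact ⟨h, ⟨hh.locallyIntegrable hq', fun φ => φ.integrable_smul_of_memLp hq' hh,
      fun φ => by rw [hu, hgh]⟩, hh, hle⟩
  refine ⟨C, hC, fun u hu => ?_⟩
  simp only [lpNorm, iInf_lt_iff] at hu
  obtain ⟨g, ⟨hg, hug⟩, -⟩ := hu
  obtain ⟨h, hh, hL, -⟩ := key u g hg hug
  refine ⟨h, hh, hL, ?_⟩
  have hC0 : ENNReal.ofReal C ≠ 0 := by simpa using hC
  -- The norm is an infimum over representatives; the estimate holds for each of them, and all give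
  -- the same spectrum almost everywhere.
  rw [lpNorm, ENNReal.mul_iInf_of_ne hC0 ENNReal.ofReal_ne_top]
  refine le_iInf fun g' => ?_
  rw [ENNReal.mul_iInf_of_ne hC0 ENNReal.ofReal_ne_top]
  refine le_iInf fun hg' => ?_
  obtain ⟨h', hh', -, hle⟩ := key u g' hg'.1 hg'.2
  rwa [eLpNorm_congr_ae (hh.ae_eq hh')]

/-- The Hausdorff-Young inequality for the inverse Fourier transform. -/
theorem exists_lpNorm_le_of_hasSpectrum (n m : ℕ) {q : ℝ≥0∞} (hq1 : 1 ≤ q) (hq2 : q ≤ 2) :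
    ∃ C : ℝ, 0 < C ∧ ∀ (u : 𝓢'(Space n, State m)) (h : Space n → State m), HasSpectrum u h →
      MemLp h q volume → lpNorm (1 - q⁻¹)⁻¹ u ≤ ENNReal.ofReal C * eLpNorm h q volume := by
  obtain ⟨C, hC, hHY⟩ := exists_isFourierPair_eLpNorm_le (Space n) (State m) hq1 hq2
  refine ⟨C, hC, fun u h hu hh => ?_⟩
  -- The inverse transform of h is the transform of its reflection.
  have hneg := Measure.measurePreserving_neg (volume : Measure (Space n))
  obtain ⟨g, hg, hle, hhg⟩ := hHY (h ∘ Neg.neg) (hh.comp_measurePreserving hneg)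
  rw [eLpNorm_comp_measurePreserving hh.1 hneg] at hle
  refine iInf₂_le_of_le g ⟨hg, fun ψ => ?_⟩ hle
  rw [hu.apply, ← hhg, ← integral_neg_eq_self]
  refine integral_congr_ae (Eventually.of_forall fun x => ?_)
  simp only [Function.comp_apply]
  rw [SchwartzMap.fourierInv_coe, SchwartzMap.fourier_coe, Real.fourierInv_eq_fourier_neg, neg_neg]

theorem lineDeriv_apply_fourier (u : 𝓢'(Space n, State m)) (v : Space n) (φ : 𝓢(Space n, ℂ)) :
    (∂_{v} u) (𝓕 φ) = u (𝓕 (freqMul v φ)) := by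
  rw [TemperedDistribution.lineDerivOp_apply_apply, SchwartzMap.lineDerivOp_fourier_eq, neg_smul]
  congr 1
  rw [freqMul, ← FourierTransform.fourierCLE_apply (R := ℂ), map_neg, neg_neg]
  rfl

theorem HasSpectrum.lineDeriv {u : 𝓢'(Space n, State m)} {h : Space n → State m}
    (hu : HasSpectrum u h) (v : Space n) :
    HasSpectrum (∂_{v} u) fun ξ => (2 * Real.pi * Complex.I * ((inner ℝ ξ v : ℝ) : ℂ)) • h ξ := by
  have he : ∀ φ : 𝓢(Space n, ℂ), (fun ξ => freqMul v φ ξ • h ξ) =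
      fun ξ => φ ξ • (2 * Real.pi * Complex.I * ((inner ℝ ξ v : ℝ) : ℂ)) • h ξ := fun φ => by
    ext1 ξ
    rw [freqMul_apply, smul_smul, mul_comm]
  refine ⟨?_, fun φ => ?_, fun φ => ?_⟩
  · rw [← locallyIntegrableOn_univ]
    refine LocallyIntegrableOn.continuousOn_smul isOpen_univ.isLocallyClosed
      (locallyIntegrableOn_univ.2 hu.locallyIntegrable) (Continuous.continuousOn ?_)
    fun_prop
  · rw [← he]; exact hu.integrable _
  · rw [lineDeriv_apply_fourier, hu.apply_fourier, he]

theorem inner_stdVec (ξ : Space n) (j : Fin n) : inner ℝ ξ (stdVec j) = ξ j := by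
  simp [stdVec, EuclideanSpace.inner_single_right]

theorem HasSpectrum.iteratedLineDeriv {k : ℕ} (α : Fin k → Fin n) {u : 𝓢'(Space n, State m)}
    {h : Space n → State m} (hu : HasSpectrum u h) :
    HasSpectrum (∂^{fun i => stdVec (α i)} u)
      fun ξ => (∏ i, (2 * Real.pi * Complex.I * (ξ (α i) : ℂ))) • h ξ := by
  induction k with
  | zero => simpa using hu
  | succ k ih =>
    have := (ih (Fin.tail α)).lineDeriv (stdVec (α 0))
    simp only [inner_stdVec, smul_smul] at this
    simpa only [Fin.prod_univ_succ] using! this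

theorem constraintSymbol_apply {Q : Fin n → Matrix (Fin m₁) (Fin m) ℝ}
    {R : Matrix (Fin m₁) (Fin m) ℝ} (ξ : Space n) (φ : State m) :
    constraintSymbol Q R ξ φ =
      ∑ j, act (Q j) ((2 * Real.pi * Complex.I * (ξ j : ℂ)) • φ) + act R φ := by
  simp only [constraintSymbol, act_symbol, LinearMap.coe_toContinuousLinearMap',
    LinearMap.add_apply, LinearMap.smul_apply, LinearMap.sum_apply, Finset.smul_sum, smul_smul,
    map_smul]

theorem HasSpectrum.integrable_act {u : 𝓢'(Space n, State m)} {h : Space n → State m}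
    (hu : HasSpectrum u h) (M : Matrix (Fin m₁) (Fin m) ℝ) (φ : 𝓢(Space n, ℂ)) :
    Integrable (fun ξ => φ ξ • act M (h ξ)) := by
  have := (act M).toContinuousLinearMap.integrable_comp (hu.integrable φ)
  simpa only [LinearMap.coe_toContinuousLinearMap', map_smul] using this

theorem HasSpectrum.act_apply {u : 𝓢'(Space n, State m)} {h : Space n → State m}
    (hu : HasSpectrum u h) (M : Matrix (Fin m₁) (Fin m) ℝ) (φ : 𝓢(Space n, ℂ)) :
    act M (u (𝓕 φ)) = ∫ ξ, φ ξ • act M (h ξ) := by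
  have := (act M).toContinuousLinearMap.integral_comp_comm (hu.integrable φ)
  rw [hu.apply_fourier]
  simpa only [LinearMap.coe_toContinuousLinearMap', map_smul] using this.symm

theorem HasSpectrum.integrable_constraintSymbol {u : 𝓢'(Space n, State m)}
    {h : Space n → State m} (hu : HasSpectrum u h) (Q : Fin n → Matrix (Fin m₁) (Fin m) ℝ)
    (R : Matrix (Fin m₁) (Fin m) ℝ) (φ : 𝓢(Space n, ℂ)) :
    Integrable fun ξ => φ ξ • constraintSymbol Q R ξ (h ξ) := by
  simp only [constraintSymbol_apply, smul_add, Finset.smul_sum, ← inner_stdVec]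
  exact (integrable_finsetSum _ fun j _ =>
    (hu.lineDeriv (stdVec j)).integrable_act (Q j) φ).add (hu.integrable_act R φ)

theorem HasSpectrum.sum_act_lineDeriv {u : 𝓢'(Space n, State m)}
    {h : Space n → State m} (hu : HasSpectrum u h) (Q : Fin n → Matrix (Fin m₁) (Fin m) ℝ)
    (R : Matrix (Fin m₁) (Fin m) ℝ) (φ : 𝓢(Space n, ℂ)) :
    ∑ j, act (Q j) ((∂_{stdVec j} u) (𝓕 φ)) + act R (u (𝓕 φ)) =
      ∫ ξ, φ ξ • constraintSymbol Q R ξ (h ξ) := by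
  simp only [constraintSymbol_apply, smul_add, Finset.smul_sum, ← inner_stdVec]
  rw [integral_add (integrable_finsetSum _ fun j _ =>
    (hu.lineDeriv (stdVec j)).integrable_act (Q j) φ) (hu.integrable_act R φ),
    integral_finsetSum _ fun j _ => (hu.lineDeriv (stdVec j)).integrable_act (Q j) φ,
    hu.act_apply]
  congr 1
  exact Finset.sum_congr rfl fun j _ => (hu.lineDeriv (stdVec j)).act_apply (Q j) φ

theorem HasSpectrum.locallyIntegrable_constraintSymbol {u : 𝓢'(Space n, State m)}
    {h : Space n → State m} (hu : HasSpectrum u h) (Q : Fin n → Matrix (Fin m₁) (Fin m) ℝ)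
    (R : Matrix (Fin m₁) (Fin m) ℝ) :
    LocallyIntegrable fun ξ => constraintSymbol Q R ξ (h ξ) := by
  have hact : ∀ (M : Matrix (Fin m₁) (Fin m) ℝ) (h : Space n → State m), LocallyIntegrable h →
      LocallyIntegrable fun ξ => act M (h ξ) := fun M h hh x => by
    obtain ⟨s, hs, hi⟩ := hh x
    exact ⟨s, hs, (act M).toContinuousLinearMap.integrable_comp hi⟩
  simp only [constraintSymbol_apply, ← inner_stdVec]
  exact (locallyIntegrable_finsetSum _ fun j _ => hact (Q j) _
    (hu.lineDeriv (stdVec j)).locallyIntegrable).add (hact R _ hu.locallyIntegrable)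

theorem HasSpectrum.constraint_iff {u : 𝓢'(Space n, State m)} {h : Space n → State m}
    (hu : HasSpectrum u h) (Q : Fin n → Matrix (Fin m₁) (Fin m) ℝ) (R : Matrix (Fin m₁) (Fin m) ℝ) :
    Constraint Q R u ↔ ∀ᵐ ξ, constraintSymbol Q R ξ (h ξ) = 0 := by
  refine ⟨fun hc => ?_, fun hc ψ => ?_⟩
  · refine ae_eq_of_forall_integral_schwartz_smul (hu.locallyIntegrable_constraintSymbol Q R)
      (g' := fun _ => 0) (locallyIntegrable_zero) fun φ => ?_
    rw [← hu.sum_act_lineDeriv, hc]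
    simp
  · have := hu.sum_act_lineDeriv Q R (𝓕⁻ ψ)
    rw [FourierTransform.fourier_fourierInv_eq] at this
    rw [this]
    refine integral_eq_zero_of_ae ?_
    filter_upwards [hc] with ξ hξ
    rw [hξ, smul_zero]; rfl

end HypSys

/-! ### Existence of the solution and propagation of the constraint -/

namespace HypSys

open FourierTransform Filter Topology

variable {n m m₁ : ℕ} {A₀ : Matrix (Fin m) (Fin m) ℝ} {A : Fin n → Matrix (Fin m) (Fin m) ℝ}
  {L : Matrix (Fin m) (Fin m) ℝ} {Q : Fin n → Matrix (Fin m₁) (Fin m) ℝ}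
  {R : Matrix (Fin m₁) (Fin m) ℝ} {S : Matrix (Fin m) (Fin m) ℝ}
  {K : Space n → Matrix (Fin m) (Fin m) ℝ}

theorem generator_apply (ξ : Space n) (φ : State m) :
    generator A₀ A L ξ φ = act A₀⁻¹ (constraintSymbol A L ξ φ) := rfl

theorem continuous_constraintSymbol : Continuous fun ξ : Space n => constraintSymbol Q R ξ := by
  have h : (fun ξ : Space n => constraintSymbol Q R ξ) = fun ξ =>
      ∑ j, (2 * Real.pi * Complex.I * (ξ j : ℂ)) • (act (Q j)).toContinuousLinearMap +
        (act R).toContinuousLinearMap := by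
    ext1 ξ; ext1 φ
    simp [constraintSymbol_apply]
  rw [h]
  fun_prop

theorem continuous_propagator (t : ℝ) : Continuous fun ξ : Space n => propagator A₀ A L t ξ := by
  have h : Continuous fun ξ : Space n => generator A₀ A L ξ := by
    have h2 : (fun ξ : Space n => generator A₀ A L ξ) = fun ξ =>
      (act A₀⁻¹).toContinuousLinearMap ∘L constraintSymbol A L ξ := rfl
    rw [h2]
    exact continuous_const.clm_comp continuous_constraintSymbol
  let := NormedAlgebra.restrictScalars ℚ ℂ (State m →L[ℂ] State m)
  exact NormedSpace.exp_continuous.comp (h.neg.const_smul t)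

theorem aestronglyMeasurable_propagator {h : Space n → State m}
    (hh : AEStronglyMeasurable h volume) (t : ℝ) :
    AEStronglyMeasurable (fun ξ => propagator A₀ A L t ξ (h ξ)) volume :=
  (ContinuousLinearMap.apply ℂ (State m)).flip.aestronglyMeasurable_comp₂
    (continuous_propagator t).aestronglyMeasurable hh

theorem norm_generator_apply_le : ∃ C : ℝ, 0 < C ∧ ∀ (ξ : Space n) (φ : State m),
    ‖generator A₀ A L ξ φ‖ ≤ C * (∑ j, 2 * Real.pi * |ξ j| + 1) * ‖φ‖ := by
  obtain ⟨C₁, hC₁, hA₀⟩ := (act A₀⁻¹).exists_norm_le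
  choose C₂ hC₂ hAj using fun j => (act (A j)).exists_norm_le
  obtain ⟨C₃, hC₃, hL⟩ := (act L).exists_norm_le
  have h0 : ∀ j, 0 ≤ C₂ j := fun j => (hC₂ j).le
  have hsum : 0 ≤ ∑ j, C₂ j := Finset.sum_nonneg fun j _ => h0 j
  refine ⟨C₁ * (∑ j, C₂ j + C₃), by positivity, fun ξ φ => ?_⟩
  rw [generator_apply, constraintSymbol_apply]
  refine (hA₀ _).trans ?_
  rw [mul_assoc C₁, mul_assoc C₁]
  refine mul_le_mul_of_nonneg_left ?_ hC₁.le
  calc _ ≤ ∑ j, ‖act (A j) ((2 * Real.pi * Complex.I * (ξ j : ℂ)) • φ)‖ + ‖act L φ‖ :=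
        (norm_add_le _ _).trans (by gcongr; exact norm_sum_le _ _)
    _ ≤ ∑ j, (∑ j, C₂ j + C₃) * (2 * Real.pi * |ξ j| * ‖φ‖) + (∑ j, C₂ j + C₃) * ‖φ‖ := by
        gcongr with j
        · refine (hAj j _).trans ?_
          rw [norm_smul]
          have : ‖(2 * Real.pi * Complex.I * (ξ j : ℂ))‖ = 2 * Real.pi * |ξ j| := by
            simp [abs_of_pos Real.pi_pos]
          rw [this]
          have := Finset.single_le_sum (fun j _ => h0 j) (Finset.mem_univ j)
          have hpi := Real.pi_pos
          gcongr
          linarith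
        · refine (hL _).trans ?_
          gcongr
          linarith
    _ = _ := by
        rw [← Finset.mul_sum, ← Finset.sum_mul]; ring

/-- The solution of the Cauchy problem, given by its Fourier transform. -/
theorem exists_isSolution (hn : 1 ≤ n) (hA : ConditionA A₀ A L)
    (hC : ConditionC A₀ A L Q R) (hS : ConditionS A₀ L S)
    (hS₁ : ConditionSStar₁ A L Q R S) (hK : ConditionKStar A₀ A L Q R K) {p : ℝ≥0∞} (hp : 1 ≤ p)
    {w₀ : 𝓢'(Space n, State m)} {h : Space n → State m} (h₀ : HasSpectrum w₀ h)
    (hh : MemLp h p volume) (hc : Constraint Q R w₀) :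
    ∃ w : ℝ → 𝓢'(Space n, State m), IsSolution A₀ A L w₀ w ∧
      ∀ t, 0 ≤ t → HasSpectrum (w t) fun ξ => propagator A₀ A L t ξ (h ξ) := by
  have : Nonempty (Fin n) := ⟨⟨0, hn⟩⟩
  obtain ⟨C, c, hC0, hc0, hdec⟩ := exists_norm_propagator_le hA hC hS hS₁ hK
  have hc' := (h₀.constraint_iff Q R).1 hc
  -- The frequency 0, which the decay bound leaves out, is a null set because n ≥ 1.
  have hne : ∀ᵐ ξ : Space n, ξ ≠ 0 := by
    simp [ae_iff, measure_singleton]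
  have hbd : ∀ᵐ ξ, ∀ t, 0 ≤ t → ‖propagator A₀ A L t ξ (h ξ)‖ ≤ C * ‖h ξ‖ := by
    filter_upwards [hc', hne] with ξ h1 h2 t ht
    refine (hdec ξ h2 _ h1 t ht).trans ?_
    gcongr
    refine mul_le_of_le_one_right hC0.le (Real.exp_le_one_iff.2 ?_)
    have : 0 ≤ c * (‖ξ‖ / (1 + ‖ξ‖ ^ 2)) ^ 2 * t := by positivity
    linarith
  have hmem : ∀ t, 0 ≤ t → MemLp (fun ξ => propagator A₀ A L t ξ (h ξ)) p volume := fun t ht =>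
    hh.of_le_mul (aestronglyMeasurable_propagator hh.1 t) (hbd.mono fun ξ hξ => hξ t ht)
  -- Only t ≥ 0 is constrained; at negative times the bound by |h|, and with it membership in L^p,
  -- may fail.
  have hex : ∀ t, ∃ u : 𝓢'(Space n, State m), 0 ≤ t →
      HasSpectrum u fun ξ => propagator A₀ A L t ξ (h ξ) := fun t => by
    by_cases ht : 0 ≤ t
    · obtain ⟨u, hu⟩ := exists_hasSpectrum hp (hmem t ht)
      exact ⟨u, fun _ => hu⟩
    · exact ⟨0, fun h => absurd h ht⟩
  choose w hw using hex
  have hcont : ∀ ξ, Continuous fun t => propagator A₀ A L t ξ (h ξ) := fun ξ =>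
    continuous_iff_continuousAt.2 fun t => (hasDerivAt_propagator ξ (h ξ) t).continuousAt
  have hmeas : ∀ (φ : 𝓢(Space n, ℂ)) t,
      AEStronglyMeasurable (fun ξ => φ ξ • propagator A₀ A L t ξ (h ξ)) volume := fun φ t =>
    φ.continuous.aestronglyMeasurable.smul (aestronglyMeasurable_propagator hh.1 t)
  refine ⟨w, ⟨?_, fun ψ => ?_, fun ψ t ht => ?_⟩, hw⟩
  · have := hw 0 le_rfl
    simp only [propagator_zero] at this
    exact this.eq h₀
  · set φ : 𝓢(Space n, ℂ) := 𝓕⁻ ψ with hφ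
    have he : ∀ t ∈ Set.Ici (0 : ℝ), w t ψ = ∫ ξ, φ ξ • propagator A₀ A L t ξ (h ξ) :=
      fun t ht => (hw t ht).apply ψ
    refine ContinuousWithinAt.congr ?_ he (he 0 Set.self_mem_Ici)
    refine continuousWithinAt_of_dominated (bound := fun ξ => C * ‖φ ξ • h ξ‖)
      (Eventually.of_forall fun t => hmeas φ t) ?_ ((h₀.integrable φ).norm.const_mul C)
      (Eventually.of_forall fun ξ => ((hcont ξ).const_smul (φ ξ)).continuousWithinAt)
    filter_upwards [self_mem_nhdsWithin] with t ht
    filter_upwards [hbd] with ξ hξ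
    rw [norm_smul, norm_smul, mul_left_comm]
    gcongr
    exact hξ t ht
  · set φ : 𝓢(Space n, ℂ) := 𝓕⁻ ψ with hφ
    have hψ : 𝓕 φ = ψ := FourierTransform.fourier_fourierInv_eq ψ
    have he : ∀ t ∈ Set.Ioi (0 : ℝ), w t ψ = ∫ ξ, φ ξ • propagator A₀ A L t ξ (h ξ) :=
      fun t ht => (hw t (le_of_lt ht)).apply ψ
    obtain ⟨C', hC', hgen⟩ := norm_generator_apply_le (A₀ := A₀) (A := A) (L := L)
    have hwt := hw t ht.le
    have hint := hwt.integrable_constraintSymbol A L φ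
    have hg : (fun ξ => φ ξ • -generator A₀ A L ξ (propagator A₀ A L t ξ (h ξ))) = fun ξ =>
        -(act A₀⁻¹).toContinuousLinearMap
          (φ ξ • constraintSymbol A L ξ (propagator A₀ A L t ξ (h ξ))) := by
      ext1 ξ
      rw [map_smul, smul_neg, generator_apply]; rfl
    -- The generator grows linearly in ξ, and this growth is absorbed by the Schwartz functions
    -- 2πiξⱼφ, which makes the dominating function integrable and independent of time.
    have hder := hasDerivAt_integral_of_dominated_loc_of_deriv_le (μ := volume)
      (F := fun t ξ => φ ξ • propagator A₀ A L t ξ (h ξ))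
      (F' := fun t ξ => φ ξ • -generator A₀ A L ξ (propagator A₀ A L t ξ (h ξ)))
      (bound := fun ξ => C' * C * (∑ j, ‖freqMul (stdVec j) φ ξ • h ξ‖ + ‖φ ξ • h ξ‖))
      (Ioi_mem_nhds ht) (Eventually.of_forall fun t => hmeas φ t) (hwt.integrable φ)
      (by rw [hg]
          exact (((act A₀⁻¹).toContinuousLinearMap.integrable_comp hint).neg).1) ?_
      (((integrable_finsetSum _ fun j _ => (h₀.integrable _).norm).add
        (h₀.integrable φ).norm).const_mul _)
      (Eventually.of_forall fun ξ s _ => (hasDerivAt_propagator ξ (h ξ) s).const_smul (φ ξ))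
    · refine ⟨_, hder.2.congr_of_eventuallyEq ?_, ?_⟩
      · filter_upwards [Ioi_mem_nhds ht] with s hs using he s hs
      · have h1 := hwt.sum_act_lineDeriv A L φ
        rw [hψ] at h1
        rw [add_assoc, h1, hg, integral_neg, ContinuousLinearMap.integral_comp_comm _ hint, map_neg,
          LinearMap.coe_toContinuousLinearMap', ← LinearMap.comp_apply, hA.act_inv_act.1,
          LinearMap.id_apply, neg_add_cancel]
    · filter_upwards [hbd] with ξ hξ s hs
      have h2 := hξ s (le_of_lt hs)
      have h3 : ∀ j, ‖freqMul (stdVec j) φ ξ • h ξ‖ = 2 * Real.pi * |ξ j| * ‖φ ξ‖ * ‖h ξ‖ := by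
        intro j
        rw [norm_smul, freqMul_apply, norm_mul, inner_stdVec]
        simp [abs_of_pos Real.pi_pos]
      simp only [h3, norm_smul, norm_neg]
      refine (mul_le_mul_of_nonneg_left (hgen ξ _) (norm_nonneg (φ ξ))).trans ?_
      have h4 : 0 ≤ ∑ j, 2 * Real.pi * |ξ j| + 1 := by
        have := Finset.sum_nonneg fun j (_ : j ∈ Finset.univ) =>
          mul_nonneg Real.two_pi_pos.le (abs_nonneg (ξ j))
        linarith
      rw [← Finset.sum_mul, ← Finset.sum_mul]
      calc _ ≤ ‖φ ξ‖ * (C' * (∑ j, 2 * Real.pi * |ξ j| + 1) * (C * ‖h ξ‖)) := by gcongr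
        _ = _ := by ring

theorem HasSpectrum.constraint_propagator (hn : 1 ≤ n) (hC : ConditionC A₀ A L Q R)
    {w₀ u : 𝓢'(Space n, State m)} {h : Space n → State m} (h₀ : HasSpectrum w₀ h)
    (hc : Constraint Q R w₀) {t : ℝ}
    (hu : HasSpectrum u fun ξ => propagator A₀ A L t ξ (h ξ)) : Constraint Q R u := by
  have : Nonempty (Fin n) := ⟨⟨0, hn⟩⟩
  rw [hu.constraint_iff]
  have hne : ∀ᵐ ξ : Space n, ξ ≠ 0 := by
    simp [ae_iff, measure_singleton]
  filter_upwards [(h₀.constraint_iff Q R).1 hc, hne] with ξ h1 h2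
  rw [constraintSymbol_propagator hC h2, h1]

end HypSys

/-! ### Low- and high-frequency profiles -/

section Profiles

theorem exists_one_add_pow_mul_exp_neg_sq_le {a : ℝ} (ha : 0 < a) (M : ℕ) :
    ∃ B : ℝ, 0 < B ∧ ∀ x : ℝ, 0 ≤ x → (1 + x) ^ M * Real.exp (-a * x ^ 2) ≤ B := by
  refine ⟨2 ^ M * (2 + M.factorial / a ^ M), by positivity, fun x hx => ?_⟩
  have h1 : (1 + x) ^ M ≤ 2 ^ M * (1 + x ^ M) := by
    refine (add_pow_le zero_le_one hx M).trans ?_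
    rw [one_pow]
    gcongr
    · norm_num
    · exact Nat.sub_le _ _
  have h2 : x ^ M ≤ 1 + (x ^ 2) ^ M := by
    rw [← pow_mul, mul_comm 2 M, pow_mul]
    nlinarith [sq_nonneg (x ^ M - 1)]
  have h3 : (x ^ 2) ^ M * Real.exp (-a * x ^ 2) ≤ M.factorial / a ^ M := by
    have := Real.pow_div_factorial_le_exp (a * x ^ 2) (by positivity) M
    rw [neg_mul, Real.exp_neg, ← div_eq_mul_inv, div_le_div_iff₀ (Real.exp_pos _) (by positivity)]
    rw [div_le_iff₀ (by positivity), mul_pow] at this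
    linarith
  have h4 : Real.exp (-a * x ^ 2) ≤ 1 := by
    rw [Real.exp_le_one_iff]; nlinarith [sq_nonneg x]
  have h5 := Real.exp_pos (-a * x ^ 2)
  calc (1 + x) ^ M * Real.exp (-a * x ^ 2)
      ≤ 2 ^ M * (1 + (1 + (x ^ 2) ^ M)) * Real.exp (-a * x ^ 2) := by
        gcongr
        exact h1.trans (by gcongr)
    _ = 2 ^ M * (2 * Real.exp (-a * x ^ 2) + (x ^ 2) ^ M * Real.exp (-a * x ^ 2)) := by ring
    _ ≤ _ := by gcongr; linarith

/-- The profile `xᵏ exp (-a x²)`. -/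
noncomputable def expProfile (a : ℝ) (k : ℕ) (x : ℝ) : ℝ := x ^ k * Real.exp (-a * x ^ 2)

theorem expProfile_nonneg (a : ℝ) (k : ℕ) {x : ℝ} (hx : 0 ≤ x) : 0 ≤ expProfile a k x := by
  unfold expProfile; positivity

theorem measurable_expProfile (a : ℝ) (k : ℕ) : Measurable (expProfile a k) := by
  unfold expProfile; fun_prop

theorem exists_expProfile_le {a : ℝ} (ha : 0 < a) (k N : ℕ) : ∃ B : ℝ, 0 < B ∧
    ∀ x : ℝ, 0 ≤ x → expProfile a k x ≤ B * ((1 + x) ^ N)⁻¹ := by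
  obtain ⟨B, hB, h⟩ := exists_one_add_pow_mul_exp_neg_sq_le ha (N + k)
  refine ⟨B, hB, fun x hx => ?_⟩
  rw [← div_eq_mul_inv, le_div_iff₀ (by positivity)]
  refine le_trans ?_ (h x hx)
  rw [expProfile, mul_right_comm, pow_add, mul_comm (x ^ k)]
  gcongr
  linarith

/-- With inverted argument the Gaussian no longer helps at infinity, where only the power x^(-k) is
left. This is the origin of the lower bound on ℓ in the theorem. -/
theorem exists_expProfile_inv_le {a : ℝ} (ha : 0 < a) (k : ℕ) : ∃ B : ℝ, 0 < B ∧
    ∀ x : ℝ, 0 ≤ x → expProfile a k x⁻¹ ≤ B * ((1 + x) ^ k)⁻¹ := by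
  obtain ⟨B, hB, h⟩ := exists_one_add_pow_mul_exp_neg_sq_le ha k
  refine ⟨B, hB, fun x hx => ?_⟩
  rw [← div_eq_mul_inv, le_div_iff₀ (by positivity)]
  refine le_trans ?_ (h x⁻¹ (inv_nonneg.2 hx))
  rw [expProfile, mul_right_comm, ← mul_pow]
  have : x⁻¹ * (1 + x) ≤ 1 + x⁻¹ := by
    have := inv_mul_le_one (a := x)
    linarith
  have h0 : 0 ≤ x⁻¹ := inv_nonneg.2 hx
  gcongr

/-- A bound for the symbol `xᵏ exp (-c (x / (1 + x²))² t)`, at low frequencies by a heat kernel and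
at high frequencies by a decay of regularity-loss type. -/
theorem pow_mul_exp_le_expProfile {c t x : ℝ} (hc : 0 < c) (ht : 0 ≤ t) (hx : 0 < x) (k ℓ : ℕ) :
    x ^ k * Real.exp (-c * (x / (1 + x ^ 2)) ^ 2 * t) ≤ Real.exp (c / 4) *
      ((√(1 + t))⁻¹ ^ k * expProfile (c / 4) k (√(1 + t) * x) +
        (√(1 + t))⁻¹ ^ ℓ * (expProfile (c / 4) ℓ ((√(1 + t))⁻¹ * x)⁻¹ * x ^ (k + ℓ))) := by
  have hl : 0 < √(1 + t) := by positivity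
  have hl2 : √(1 + t) ^ 2 = 1 + t := Real.sq_sqrt (by positivity)
  set l := √(1 + t)
  have e1 : l⁻¹ ^ k * expProfile (c / 4) k (l * x) =
      x ^ k * Real.exp (-(c / 4) * ((1 + t) * x ^ 2)) := by
    rw [expProfile, mul_pow l x 2, hl2, mul_pow, ← mul_assoc, ← mul_assoc, ← mul_pow,
      inv_mul_cancel₀ hl.ne', one_pow, one_mul]
  have e2 : l⁻¹ ^ ℓ * (expProfile (c / 4) ℓ (l⁻¹ * x)⁻¹ * x ^ (k + ℓ)) =
      x ^ k * Real.exp (-(c / 4) * ((1 + t) * (x⁻¹) ^ 2)) := by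
    rw [expProfile, mul_inv, inv_inv, mul_pow l x⁻¹ 2, hl2, mul_pow, pow_add, inv_pow, inv_pow x ℓ]
    field_simp
  have hpos1 : 0 ≤ x ^ k * Real.exp (-(c / 4) * ((1 + t) * x ^ 2)) := by positivity
  have hpos2 : 0 ≤ x ^ k * Real.exp (-(c / 4) * ((1 + t) * (x⁻¹) ^ 2)) := by positivity
  rw [e1, e2]
  -- Used with y = min(x, 1/x). The factor exp(c/4) pays for replacing t by 1 + t, since y ≤ 1.
  have key : ∀ y : ℝ, 0 ≤ y → y ≤ 1 → y / 2 ≤ x / (1 + x ^ 2) →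
      Real.exp (-c * (x / (1 + x ^ 2)) ^ 2 * t) ≤
        Real.exp (c / 4) * Real.exp (-(c / 4) * ((1 + t) * y ^ 2)) := by
    intro y hy hy1 hyx
    rw [← Real.exp_add, Real.exp_le_exp]
    have h1 : (y / 2) ^ 2 ≤ (x / (1 + x ^ 2)) ^ 2 := by gcongr
    have h2 : y ^ 2 ≤ 1 := by nlinarith
    have h3 : c * ((y / 2) ^ 2) * t ≤ c * (x / (1 + x ^ 2)) ^ 2 * t := by gcongr
    nlinarith
  rcases le_total x 1 with h | h
  · have := key x hx.le h (by
      rw [div_le_div_iff₀ two_pos (by positivity)]; nlinarith [sq_nonneg x])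
    calc x ^ k * Real.exp (-c * (x / (1 + x ^ 2)) ^ 2 * t)
        ≤ x ^ k * (Real.exp (c / 4) * Real.exp (-(c / 4) * ((1 + t) * x ^ 2))) := by gcongr
      _ = Real.exp (c / 4) * (x ^ k * Real.exp (-(c / 4) * ((1 + t) * x ^ 2))) := by ring
      _ ≤ _ := by gcongr; linarith
  · have := key x⁻¹ (inv_nonneg.2 hx.le) (inv_le_one_of_one_le₀ h) (by
      rw [inv_eq_one_div, div_div, div_le_div_iff₀ (by positivity) (by positivity)]; nlinarith)
    calc x ^ k * Real.exp (-c * (x / (1 + x ^ 2)) ^ 2 * t)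
        ≤ x ^ k * (Real.exp (c / 4) * Real.exp (-(c / 4) * ((1 + t) * x⁻¹ ^ 2))) := by gcongr
      _ = Real.exp (c / 4) * (x ^ k * Real.exp (-(c / 4) * ((1 + t) * x⁻¹ ^ 2))) := by ring
      _ ≤ _ := by gcongr; linarith

end Profiles

/-! ### Hölder's inequality with rescaled weights -/

section Scaling

variable {E F : Type*} [NormedAddCommGroup E] [NormedSpace ℝ E] [FiniteDimensional ℝ E]
  [MeasurableSpace E] [BorelSpace E] [NormedAddCommGroup F]
  {μ : Measure E} [μ.IsAddHaarMeasure]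

theorem memLp_of_norm_le_one_add_pow {f : E → F} {N : ℕ} {B : ℝ} {s : ℝ≥0∞}
    (hf : AEStronglyMeasurable f μ) (hb : ∀ x, ‖f x‖ ≤ B * ((1 + ‖x‖) ^ N)⁻¹)
    (hs : s = ∞ ∨ (Module.finrank ℝ E : ℝ) * (s⁻¹).toReal < N) : MemLp f s μ := by
  have hB : 0 ≤ B := by
    have := (norm_nonneg _).trans (hb 0)
    simpa using this
  rcases eq_or_ne s ∞ with rfl | hst
  · refine memLp_top_of_bound hf B (Filter.Eventually.of_forall fun x => (hb x).trans ?_)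
    refine mul_le_of_le_one_right hB (inv_le_one_of_one_le₀ (one_le_pow₀ ?_))
    linarith [norm_nonneg x]
  rcases eq_or_ne s 0 with rfl | hs0
  · exact memLp_zero_iff_aestronglyMeasurable.2 hf
  replace hs := hs.resolve_left hst
  have hsp : 0 < s.toReal := ENNReal.toReal_pos hs0 hst
  have hmeas : AEStronglyMeasurable (fun x : E => ((1 + ‖x‖) ^ N)⁻¹) μ := by
    refine Measurable.aestronglyMeasurable ?_
    fun_prop
  have hmem : MemLp (fun x : E => ((1 + ‖x‖) ^ N)⁻¹) s μ := by
    rw [← integrable_norm_rpow_iff hmeas hs0 hst]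
    have : (Module.finrank ℝ E : ℝ) < N * s.toReal := by
      rw [ENNReal.toReal_inv, ← div_eq_mul_inv, div_lt_iff₀ hsp] at hs
      exact hs
    refine (integrable_one_add_norm (μ := μ) this).congr (Filter.Eventually.of_forall fun x => ?_)
    have hx : 0 ≤ 1 + ‖x‖ := by positivity
    simp only []
    rw [Real.norm_of_nonneg (by positivity), Real.inv_rpow (by positivity), ← Real.rpow_natCast,
      ← Real.rpow_mul hx, Real.rpow_neg hx]
  refine hmem.of_le_mul (c := B) hf (Filter.Eventually.of_forall fun x => ?_)
  rw [Real.norm_of_nonneg (by positivity : (0 : ℝ) ≤ ((1 + ‖x‖) ^ N)⁻¹)]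
  exact hb x

theorem eLpNorm_comp_smul_eq (f : E → F) {l : ℝ} (hl : 0 < l) (s : ℝ≥0∞) :
    eLpNorm (fun x => f (l • x)) s μ =
      ENNReal.ofReal (l ^ (-((Module.finrank ℝ E : ℝ) * (s⁻¹).toReal))) * eLpNorm f s μ := by
  have hemb : MeasurableEmbedding fun x : E => l • x :=
    (Homeomorph.smulOfNeZero l hl.ne').measurableEmbedding
  have h1 := hemb.eLpNorm_map_measure (g := f) (p := s) (μ := μ)
  rw [Measure.map_addHaar_smul μ hl.ne', eLpNorm_smul_measure_of_ne_zero (by simp; positivity)] at h1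
  change eLpNorm (f ∘ fun x => l • x) s μ = _
  rw [← h1, smul_eq_mul, abs_of_pos (by positivity), ENNReal.ofReal_rpow_of_pos (by positivity)]
  congr 2
  rw [one_div, ← Real.rpow_natCast, ← Real.rpow_neg hl.le, ← Real.rpow_mul hl.le, neg_mul]

/-- Hölder with 1/p' = (1/q - 1/p) + 1/q'; rescaling the weight by l contributes l to the power
-n(1/q - 1/p). -/
theorem exists_eLpNorm_comp_smul_smul_le [NormedSpace ℝ F] {g : E → ℝ} {p q : ℝ≥0∞}
    (hq : 1 ≤ q) (hqp : q ≤ p) (hg : MemLp g (q⁻¹ - p⁻¹)⁻¹ μ) :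
    ∃ C : ℝ, 0 < C ∧ ∀ l : ℝ, 0 < l → ∀ f : E → F, AEStronglyMeasurable f μ →
      eLpNorm (fun x => g (l • x) • f x) (1 - p⁻¹)⁻¹ μ ≤
        ENNReal.ofReal (C * l ^ (-((Module.finrank ℝ E : ℝ) * ((q⁻¹).toReal - (p⁻¹).toReal)))) *
          eLpNorm f (1 - q⁻¹)⁻¹ μ := by
  have hp1 : p⁻¹ ≤ q⁻¹ := ENNReal.inv_le_inv.2 hqp
  have hq1 : q⁻¹ ≤ 1 := ENNReal.inv_le_one.2 hq
  have htri : ENNReal.HolderTriple (q⁻¹ - p⁻¹)⁻¹ (1 - q⁻¹)⁻¹ (1 - p⁻¹)⁻¹ := by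
    refine ⟨?_⟩
    rw [inv_inv, inv_inv, inv_inv, add_comm, tsub_add_tsub_cancel hq1 hp1]
  set B := (eLpNorm g (q⁻¹ - p⁻¹)⁻¹ μ).toReal with hB
  have hgB : eLpNorm g (q⁻¹ - p⁻¹)⁻¹ μ ≤ ENNReal.ofReal (B + 1) := by
    rw [← ENNReal.ofReal_toReal hg.eLpNorm_ne_top, ← hB]
    exact ENNReal.ofReal_le_ofReal (by linarith)
  have hB0 : 0 ≤ B := ENNReal.toReal_nonneg
  refine ⟨B + 1, by positivity, fun l hl f hf => ?_⟩
  have hscale := eLpNorm_comp_smul_eq (μ := μ) g hl (q⁻¹ - p⁻¹)⁻¹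
  rw [inv_inv, ENNReal.toReal_sub_of_le hp1 (hq1.trans_lt ENNReal.one_lt_top).ne] at hscale
  have hgm : AEStronglyMeasurable (fun x => g (l • x)) μ := by
    refine hg.1.comp_quasiMeasurePreserving ⟨measurable_const_smul l, ?_⟩
    rw [Measure.map_addHaar_smul μ hl.ne']
    exact Measure.smul_absolutelyContinuous
  refine (eLpNorm_smul_le_mul_eLpNorm (p := (q⁻¹ - p⁻¹)⁻¹) (q := (1 - q⁻¹)⁻¹)
    hf hgm).trans ?_
  rw [hscale, mul_comm (B + 1), ENNReal.ofReal_mul (by positivity)]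
  gcongr

end Scaling

/-! ### The decay estimate in L^p -/

namespace HypSys

open FourierTransform Filter Topology

variable {n m m₁ : ℕ}

theorem norm_prod_freq {k : ℕ} (α : Fin k → Fin n) (ξ : Space n) :
    ‖∏ i, (2 * Real.pi * Complex.I * (ξ (α i) : ℂ))‖ = ∏ i, (2 * Real.pi * |ξ (α i)|) := by
  rw [norm_prod]
  refine Finset.prod_congr rfl fun i _ => ?_
  simp [abs_of_pos Real.pi_pos]

theorem norm_prod_freq_le {k : ℕ} (α : Fin k → Fin n) (ξ : Space n) :
    ‖∏ i, (2 * Real.pi * Complex.I * (ξ (α i) : ℂ))‖ ≤ (2 * Real.pi) ^ k * ‖ξ‖ ^ k := by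
  rw [norm_prod_freq, ← mul_pow]
  have hpi := Real.pi_pos
  refine (Finset.prod_le_prod (g := fun _ => 2 * Real.pi * ‖ξ‖) (fun i _ => by positivity)
    fun i _ => ?_).trans_eq (by simp)
  gcongr
  exact PiLp.norm_apply_le ξ (α i)

theorem norm_stdVec (j : Fin n) : ‖(stdVec j : Space n)‖ = 1 := by
  simp [stdVec]

/-- Bounding |ξ| by the sum of the 2π|ξⱼ| and expanding the k-th power produces all the monomials of
order k, so |ξ|^k is controlled by the derivatives in `derivNorm`. -/
theorem norm_pow_le_sum_norm_prod_freq (k : ℕ) (ξ : Space n) :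
    ‖ξ‖ ^ k ≤ ∑ α : Fin k → Fin n, ‖∏ i, (2 * Real.pi * Complex.I * (ξ (α i) : ℂ))‖ := by
  have h1 : ‖ξ‖ ≤ ∑ j, 2 * Real.pi * |ξ j| := by
    have hξ : ξ = ∑ j, ξ j • (stdVec j : Space n) := by
      ext i
      simp [stdVec, Finset.sum_apply, Pi.single_apply]
    calc ‖ξ‖ = ‖∑ j, ξ j • (stdVec j : Space n)‖ := by rw [← hξ]
      _ ≤ ∑ j, ‖ξ j • (stdVec j : Space n)‖ := norm_sum_le _ _
      _ ≤ ∑ j, 2 * Real.pi * |ξ j| := by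
        refine Finset.sum_le_sum fun j _ => ?_
        rw [norm_smul, norm_stdVec,  mul_one, Real.norm_eq_abs]
        have := Real.pi_gt_three
        nlinarith [abs_nonneg (ξ j)]
  simp only [norm_prod_freq]
  rw [← Fintype.sum_pow fun j => 2 * Real.pi * |ξ j|]
  gcongr

theorem one_le_inv_one_sub_inv (p : ℝ≥0∞) : 1 ≤ (1 - p⁻¹)⁻¹ := by
  rw [ENNReal.one_le_inv]; exact tsub_le_self

/-- The Hausdorff-Young inequality for the derivatives of order `k`. -/
theorem exists_eLpNorm_norm_pow_smul_le (n m k : ℕ) {r : ℝ≥0∞} (hr1 : 1 ≤ r) (hr2 : r ≤ 2) :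
    ∃ C : ℝ, 0 < C ∧ ∀ (u : 𝓢'(Space n, State m)) (h : Space n → State m), HasSpectrum u h →
      derivNorm k r u < ∞ → eLpNorm (fun ξ => ‖ξ‖ ^ k • h ξ) (1 - r⁻¹)⁻¹ volume ≤
        ENNReal.ofReal C * derivNorm k r u := by
  obtain ⟨C, hC, hHY⟩ := exists_hasSpectrum_eLpNorm_le n m hr1 hr2
  refine ⟨C, hC, fun u h hu hfin => ?_⟩
  have hlt : ∀ α : Fin k → Fin n, lpNorm r (∂^{fun i => stdVec (α i)} u) < ∞ := fun α =>
    (ENNReal.sum_lt_top.1 hfin) α (Finset.mem_univ α)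
  choose g hg _ hle using fun α => hHY _ (hlt α)
  have hae : ∀ᵐ ξ, ∀ α, g α ξ = (∏ i, (2 * Real.pi * Complex.I * (ξ (α i) : ℂ))) • h ξ :=
    ae_all_iff.2 fun α => (hg α).ae_eq (hu.iteratedLineDeriv α)
  calc eLpNorm (fun ξ => ‖ξ‖ ^ k • h ξ) (1 - r⁻¹)⁻¹ volume
      ≤ eLpNorm (∑ α, fun ξ => ‖g α ξ‖) (1 - r⁻¹)⁻¹ volume := by
        refine eLpNorm_mono_ae_real ?_
        filter_upwards [hae] with ξ hξ
        simp only [Finset.sum_apply, hξ, norm_smul, norm_pow, norm_norm, ← Finset.sum_mul]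
        gcongr
        exact norm_pow_le_sum_norm_prod_freq k ξ
    _ ≤ ∑ α, eLpNorm (fun ξ => ‖g α ξ‖) (1 - r⁻¹)⁻¹ volume :=
        eLpNorm_sum_le (fun α _ => (hg α).locallyIntegrable.aestronglyMeasurable.norm)
          (one_le_inv_one_sub_inv r)
    _ ≤ ∑ α : Fin k → Fin n, ENNReal.ofReal C * lpNorm r (∂^{fun i => stdVec (α i)} u) := by
        refine Finset.sum_le_sum fun α _ => ?_
        rw [eLpNorm_norm]
        exact hle α
    _ = _ := by rw [derivNorm, Finset.mul_sum]

theorem sqrt_inv_pow_mul_rpow {s : ℝ} (hs : 0 < s) (k : ℕ) (d : ℝ) :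
    (√s)⁻¹ ^ k * √s ^ (-d) = s ^ (-(d / 2) - (k : ℝ) / 2) := by
  rw [Real.sqrt_eq_rpow, ← Real.rpow_neg hs.le, ← Real.rpow_natCast, ← Real.rpow_mul hs.le,
    ← Real.rpow_mul hs.le, ← Real.rpow_add hs]
  congr 1
  ring

variable {A₀ : Matrix (Fin m) (Fin m) ℝ} {A : Fin n → Matrix (Fin m) (Fin m) ℝ}
  {L : Matrix (Fin m) (Fin m) ℝ} {Q : Fin n → Matrix (Fin m₁) (Fin m) ℝ}
  {R : Matrix (Fin m₁) (Fin m) ℝ} {S : Matrix (Fin m) (Fin m) ℝ}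
  {K : Space n → Matrix (Fin m) (Fin m) ℝ}

/-- The decay estimate for the derivatives of a distribution whose Fourier transform solves the
ordinary differential equations of the system. -/
theorem exists_derivNorm_le (hn : 1 ≤ n) (hA : ConditionA A₀ A L) (hC : ConditionC A₀ A L Q R)
    (hS : ConditionS A₀ L S) (hS₁ : ConditionSStar₁ A L Q R S) (hK : ConditionKStar A₀ A L Q R K)
    {p q r : ℝ≥0∞} (hq1 : 1 ≤ q) (hq2 : q ≤ 2) (hr1 : 1 ≤ r) (hr2 : r ≤ 2) (hp : 2 ≤ p) (k ℓ : ℕ)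
    (hℓ : (n : ℝ) * ((r⁻¹).toReal - (p⁻¹).toReal) < (ℓ : ℝ) ∨ (p = 2 ∧ r = 2)) :
    ∃ C : ℝ, 0 < C ∧ ∀ (w₀ u : 𝓢'(Space n, State m)) (h : Space n → State m) (t : ℝ), 0 ≤ t →
      lpNorm q w₀ < ∞ → derivNorm (k + ℓ) r w₀ < ∞ → Constraint Q R w₀ → HasSpectrum w₀ h →
      HasSpectrum u (fun ξ => propagator A₀ A L t ξ (h ξ)) →
      derivNorm k p u ≤
        ENNReal.ofReal (C * (1 + t) ^ (-gammaExp n 2 q p - (k : ℝ) / 2)) * lpNorm q w₀ +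
          ENNReal.ofReal (C * (1 + t) ^ (-(ℓ : ℝ) / 2 + gammaExp n 2 r p)) *
            derivNorm (k + ℓ) r w₀ := by
  have : Nonempty (Fin n) := ⟨⟨0, hn⟩⟩
  have hne : ∀ᵐ ξ : Space n, ξ ≠ 0 := by
    simp [ae_iff, measure_singleton]
  have hfin : (Module.finrank ℝ (Space n) : ℝ) = n := by simp
  have hp2 : p⁻¹ ≤ 2⁻¹ := ENNReal.inv_le_inv.2 hp
  -- As p ≥ 2, the conjugate exponent p' is at most 2, so Hausdorff-Young for the inverse transform
  -- maps L^p' into L^p.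
  have hp'2 : (1 - p⁻¹)⁻¹ ≤ 2 := by
    rw [ENNReal.inv_le_iff_inv_le, ← ENNReal.one_sub_inv_two]
    exact tsub_le_tsub_left hp2 1
  have hp'p : (1 - ((1 - p⁻¹)⁻¹)⁻¹)⁻¹ = p := by
    rw [inv_inv, ENNReal.sub_sub_cancel ENNReal.one_ne_top
      (hp2.trans (ENNReal.inv_le_one.2 one_le_two)), inv_inv]
  obtain ⟨C₁, c, hC₁, hc, hdec⟩ := exists_norm_propagator_le hA hC hS hS₁ hK
  have ha : 0 < c / 4 := by positivity
  obtain ⟨C₂, hC₂, hinv⟩ := exists_lpNorm_le_of_hasSpectrum n m (one_le_inv_one_sub_inv p) hp'2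
  rw [hp'p] at hinv
  obtain ⟨C₃, hC₃, hHY⟩ := exists_hasSpectrum_eLpNorm_le n m hq1 hq2
  obtain ⟨C₄, hC₄, hHYk⟩ := exists_eLpNorm_norm_pow_smul_le n m (k + ℓ) hr1 hr2
  have hlow : MemLp (fun ξ : Space n => expProfile (c / 4) k ‖ξ‖) (q⁻¹ - p⁻¹)⁻¹ volume := by
    obtain ⟨N, hN⟩ := exists_nat_gt
      ((Module.finrank ℝ (Space n) : ℝ) * (((q⁻¹ - p⁻¹)⁻¹)⁻¹).toReal)
    obtain ⟨B, hB, h⟩ := exists_expProfile_le ha k N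
    refine memLp_of_norm_le_one_add_pow (N := N) (B := B)
      ((measurable_expProfile _ _).comp measurable_norm).aestronglyMeasurable (fun ξ => ?_)
      (Or.inr hN)
    rw [Real.norm_of_nonneg (expProfile_nonneg _ _ (norm_nonneg _))]
    exact h _ (norm_nonneg _)
  have hhigh : MemLp (fun ξ : Space n => expProfile (c / 4) ℓ ‖ξ‖⁻¹) (r⁻¹ - p⁻¹)⁻¹ volume := by
    obtain ⟨B, hB, h⟩ := exists_expProfile_inv_le ha ℓ
    refine memLp_of_norm_le_one_add_pow (N := ℓ) (B := B)
      ((measurable_expProfile _ _).comp measurable_norm.inv).aestronglyMeasurable (fun ξ => ?_) ?_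
    · rw [Real.norm_of_nonneg (expProfile_nonneg _ _ (inv_nonneg.2 (norm_nonneg _)))]
      exact h _ (norm_nonneg _)
    -- Integrability at infinity of the power -ℓ is the condition ℓ > n(1/r - 1/p). If p = r = 2 the
    -- Hölder exponent is ∞ and boundedness is enough, even for ℓ = 0.
    · rcases hℓ with hℓ | ⟨rfl, rfl⟩
      · right
        rwa [inv_inv, hfin, ENNReal.toReal_sub_of_le (ENNReal.inv_le_inv.2 (hr2.trans hp))
          ((ENNReal.inv_le_one.2 hr1).trans_lt ENNReal.one_lt_top).ne]
      · left; simp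
  obtain ⟨C₅, hC₅, hHlow⟩ := exists_eLpNorm_comp_smul_smul_le (F := State m) hq1 (hq2.trans hp) hlow
  obtain ⟨C₆, hC₆, hHhigh⟩ :=
    exists_eLpNorm_comp_smul_smul_le (F := State m) hr1 (hr2.trans hp) hhigh
  rw [hfin] at hHlow hHhigh
  -- The factors come from the symbols of the derivatives, the decay of the propagator, and the
  -- splitting into profiles. The factor n^k below counts the derivatives of order k.
  set D : ℝ := (2 * Real.pi) ^ k * C₁ * Real.exp (c / 4) with hD
  have hD0 : 0 < D := by positivity
  refine ⟨(n : ℝ) ^ k * (C₂ * D * (C₅ * C₃ + C₆ * C₄)), ?_, ?_⟩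
  · have : (0 : ℝ) < n := by exact_mod_cast hn
    positivity
  intro w₀ u h t ht hq hr hcon hw hu
  have ht1 : 0 < 1 + t := by linarith
  set l := √(1 + t) with hl
  have hl0 : 0 < l := Real.sqrt_pos.2 ht1
  have hhm : AEStronglyMeasurable h volume := hw.locallyIntegrable.aestronglyMeasurable
  have hhq : eLpNorm h (1 - q⁻¹)⁻¹ volume ≤ ENNReal.ofReal C₃ * lpNorm q w₀ := by
    obtain ⟨h', hh', -, hle⟩ := hHY w₀ hq
    rwa [eLpNorm_congr_ae (hw.ae_eq hh')]
  have hhr := hHYk w₀ h hw hr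
  set F₁ : Space n → State m := fun ξ => expProfile (c / 4) k ‖l • ξ‖ • h ξ with hF₁
  set F₂ : Space n → State m :=
    fun ξ => expProfile (c / 4) ℓ ‖l⁻¹ • ξ‖⁻¹ • ‖ξ‖ ^ (k + ℓ) • h ξ with hF₂
  have hgm : AEStronglyMeasurable (fun ξ => ‖ξ‖ ^ (k + ℓ) • h ξ) volume :=
    ((measurable_norm.pow_const (k + ℓ)).aestronglyMeasurable).smul hhm
  have hF₁m : AEStronglyMeasurable F₁ volume :=
    ((measurable_expProfile _ _).comp (by fun_prop)).aestronglyMeasurable.smul hhm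
  have hF₂m : AEStronglyMeasurable F₂ volume :=
    ((measurable_expProfile _ _).comp (by fun_prop)).aestronglyMeasurable.smul hgm
  have hF₁n := hHlow l hl0 h hhm
  have hF₂n := hHhigh l⁻¹ (inv_pos.2 hl0) _ hgm
  set T₁ := (1 + t) ^ (-gammaExp n 2 q p - (k : ℝ) / 2) with hT₁
  set T₂ := (1 + t) ^ (-(ℓ : ℝ) / 2 + gammaExp n 2 r p) with hT₂
  -- With l² = 1 + t, the profile is dilated by l at low frequencies and by 1/l at high ones, so the
  -- Hölder factor helps the decay in the first case and hurts it in the second.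
  have e₁ : l⁻¹ ^ k * l ^ (-((n : ℝ) * ((q⁻¹).toReal - (p⁻¹).toReal))) = T₁ := by
    rw [hl, sqrt_inv_pow_mul_rpow ht1, hT₁, gammaExp]
    congr 1
    ring
  have e₂ : l⁻¹ ^ ℓ * l⁻¹ ^ (-((n : ℝ) * ((r⁻¹).toReal - (p⁻¹).toReal))) = T₂ := by
    rw [Real.inv_rpow hl0.le, ← Real.rpow_neg hl0.le, hl, sqrt_inv_pow_mul_rpow ht1, hT₂, gammaExp]
    congr 1
    ring
  have hsum : eLpNorm (l⁻¹ ^ k • F₁ + l⁻¹ ^ ℓ • F₂) (1 - p⁻¹)⁻¹ volume ≤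
      ENNReal.ofReal (C₅ * C₃ * T₁) * lpNorm q w₀ +
        ENNReal.ofReal (C₆ * C₄ * T₂) * derivNorm (k + ℓ) r w₀ := by
    refine (eLpNorm_add_le (hF₁m.const_smul _) (hF₂m.const_smul _)
      (one_le_inv_one_sub_inv p)).trans (add_le_add ?_ ?_)
    · rw [eLpNorm_const_smul, Real.enorm_of_nonneg (by positivity)]
      calc _ ≤ ENNReal.ofReal (l⁻¹ ^ k) * (ENNReal.ofReal (C₅ *
            l ^ (-((n : ℝ) * ((q⁻¹).toReal - (p⁻¹).toReal)))) *
              (ENNReal.ofReal C₃ * lpNorm q w₀)) := by gcongr; exact hF₁n.trans (by gcongr)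
        _ = _ := by
          rw [← mul_assoc, ← mul_assoc, ← ENNReal.ofReal_mul (by positivity),
            ← ENNReal.ofReal_mul (by positivity), ← e₁]
          congr 2
          ring
    · rw [eLpNorm_const_smul, Real.enorm_of_nonneg (by positivity)]
      calc _ ≤ ENNReal.ofReal (l⁻¹ ^ ℓ) * (ENNReal.ofReal (C₆ *
            l⁻¹ ^ (-((n : ℝ) * ((r⁻¹).toReal - (p⁻¹).toReal)))) *
              (ENNReal.ofReal C₄ * derivNorm (k + ℓ) r w₀)) := by
            gcongr; exact hF₂n.trans (by gcongr)
        _ = _ := by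
          rw [← mul_assoc, ← mul_assoc, ← ENNReal.ofReal_mul (by positivity),
            ← ENNReal.ofReal_mul (by positivity), ← e₂]
          congr 2
          ring
  have hα : ∀ α : Fin k → Fin n, lpNorm p (∂^{fun i => stdVec (α i)} u) ≤
      ENNReal.ofReal (C₂ * D) * (ENNReal.ofReal (C₅ * C₃ * T₁) * lpNorm q w₀ +
        ENNReal.ofReal (C₆ * C₄ * T₂) * derivNorm (k + ℓ) r w₀) := by
    intro α
    have hs := hu.iteratedLineDeriv α
    have hle : ∀ᵐ ξ, ‖(∏ i, (2 * Real.pi * Complex.I * (ξ (α i) : ℂ))) •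
        propagator A₀ A L t ξ (h ξ)‖ ≤ D * ‖(l⁻¹ ^ k • F₁ + l⁻¹ ^ ℓ • F₂) ξ‖ := by
      filter_upwards [(hw.constraint_iff Q R).1 hcon, hne] with ξ h1 h2
      have hξ : 0 < ‖ξ‖ := norm_pos_iff.2 h2
      have hF : (l⁻¹ ^ k • F₁ + l⁻¹ ^ ℓ • F₂) ξ = (l⁻¹ ^ k * expProfile (c / 4) k (l * ‖ξ‖) +
          l⁻¹ ^ ℓ * (expProfile (c / 4) ℓ (l⁻¹ * ‖ξ‖)⁻¹ * ‖ξ‖ ^ (k + ℓ))) • h ξ := by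
        simp only [Pi.add_apply, Pi.smul_apply, hF₁, hF₂, norm_smul, Real.norm_of_nonneg hl0.le,
          Real.norm_of_nonneg (inv_nonneg.2 hl0.le), smul_smul, add_smul]
      have hnn : 0 ≤ l⁻¹ ^ k * expProfile (c / 4) k (l * ‖ξ‖) +
          l⁻¹ ^ ℓ * (expProfile (c / 4) ℓ (l⁻¹ * ‖ξ‖)⁻¹ * ‖ξ‖ ^ (k + ℓ)) := by
        have h3 := expProfile_nonneg (c / 4) k (x := l * ‖ξ‖) (by positivity)
        have h4 := expProfile_nonneg (c / 4) ℓ (x := (l⁻¹ * ‖ξ‖)⁻¹) (by positivity)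
        positivity
      rw [hF, norm_smul, norm_smul, Real.norm_of_nonneg hnn]
      calc _ ≤ (2 * Real.pi) ^ k * ‖ξ‖ ^ k *
            (C₁ * Real.exp (-c * (‖ξ‖ / (1 + ‖ξ‖ ^ 2)) ^ 2 * t) * ‖h ξ‖) :=
            mul_le_mul (norm_prod_freq_le α ξ) (hdec ξ h2 _ h1 t ht) (norm_nonneg _)
              (by positivity)
        _ = (2 * Real.pi) ^ k * C₁ *
            (‖ξ‖ ^ k * Real.exp (-c * (‖ξ‖ / (1 + ‖ξ‖ ^ 2)) ^ 2 * t)) * ‖h ξ‖ := by ring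
        _ ≤ (2 * Real.pi) ^ k * C₁ * (Real.exp (c / 4) *
            (l⁻¹ ^ k * expProfile (c / 4) k (l * ‖ξ‖) +
              l⁻¹ ^ ℓ * (expProfile (c / 4) ℓ (l⁻¹ * ‖ξ‖)⁻¹ * ‖ξ‖ ^ (k + ℓ)))) * ‖h ξ‖ := by
            refine mul_le_mul_of_nonneg_right (mul_le_mul_of_nonneg_left
              (pow_mul_exp_le_expProfile hc ht hξ k ℓ) (by positivity)) (norm_nonneg _)
        _ = _ := by rw [hD]; ring
    have hnorm := (eLpNorm_le_mul_eLpNorm_of_ae_le_mul hle (1 - p⁻¹)⁻¹).trans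
      (mul_le_mul_right hsum _)
    have hmem : MemLp _ (1 - p⁻¹)⁻¹ volume :=
      ⟨hs.locallyIntegrable.aestronglyMeasurable, hnorm.trans_lt (by finiteness)⟩
    refine (hinv _ _ hs hmem).trans ?_
    rw [ENNReal.ofReal_mul hC₂.le, mul_assoc (ENNReal.ofReal C₂)]
    exact mul_le_mul_right hnorm _
  have hT₁0 : 0 ≤ T₁ := by positivity
  have hT₂0 : 0 ≤ T₂ := by positivity
  calc derivNorm k p u ≤ ∑ _α : Fin k → Fin n, ENNReal.ofReal (C₂ * D) *
        (ENNReal.ofReal (C₅ * C₃ * T₁) * lpNorm q w₀ +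
          ENNReal.ofReal (C₆ * C₄ * T₂) * derivNorm (k + ℓ) r w₀) :=
        Finset.sum_le_sum fun α _ => hα α
    _ = ENNReal.ofReal ((n : ℝ) ^ k * (C₂ * D)) * (ENNReal.ofReal (C₅ * C₃ * T₁) * lpNorm q w₀ +
          ENNReal.ofReal (C₆ * C₄ * T₂) * derivNorm (k + ℓ) r w₀) := by
        rw [Finset.sum_const, Finset.card_univ, nsmul_eq_mul, Fintype.card_fun, Fintype.card_fin,
          Fintype.card_fin, ENNReal.ofReal_mul (p := (n : ℝ) ^ k) (by positivity), ← Nat.cast_pow,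
          ENNReal.ofReal_natCast, mul_assoc (_ : ℝ≥0∞)]
    _ ≤ _ := by
        have hM : 0 ≤ (n : ℝ) ^ k * (C₂ * D) := by positivity
        rw [mul_add, ← mul_assoc (_ : ℝ≥0∞) _ (lpNorm q w₀),
          ← mul_assoc (_ : ℝ≥0∞) _ (derivNorm (k + ℓ) r w₀), ← ENNReal.ofReal_mul hM,
          ← ENNReal.ofReal_mul hM]
        gcongr ENNReal.ofReal ?_ * _ + ENNReal.ofReal ?_ * _
        · calc _ = (n : ℝ) ^ k * (C₂ * D * (C₅ * C₃)) * T₁ := by ring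
            _ ≤ _ := by
              gcongr
              have : 0 < C₆ * C₄ := by positivity
              linarith
        · calc _ = (n : ℝ) ^ k * (C₂ * D * (C₆ * C₄)) * T₂ := by ring
            _ ≤ _ := by
              gcongr
              have : 0 < C₅ * C₃ := by positivity
              linarith

end HypSys

/-! ### Well-posedness and decay -/

theorem proposition4p2 {n m m₁ : ℕ} (hn : 1 ≤ n) (hm₁ : m₁ < m)
    (A₀ : Matrix (Fin m) (Fin m) ℝ) (A : Fin n → Matrix (Fin m) (Fin m) ℝ)
    (L : Matrix (Fin m) (Fin m) ℝ)
    (Q : Fin n → Matrix (Fin m₁) (Fin m) ℝ) (R : Matrix (Fin m₁) (Fin m) ℝ)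
    (S : Matrix (Fin m) (Fin m) ℝ) (K : HypSys.Space n → Matrix (Fin m) (Fin m) ℝ)
    (hA : HypSys.ConditionA A₀ A L) (hC : HypSys.ConditionC A₀ A L Q R)
    (hS : HypSys.ConditionS A₀ L S) (hS₁ : HypSys.ConditionSStar₁ A L Q R S)
    (hK : HypSys.ConditionKStar A₀ A L Q R K) :
    -- well-posedness, and propagation of the constraint
    (∀ q r : ℝ≥0∞, 1 ≤ q → q ≤ 2 → 1 ≤ r → r ≤ 2 → ∀ l : ℕ,
      ∀ w₀ : 𝓢'(HypSys.Space n, HypSys.State m),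
        HypSys.MemSobolevInter l r q w₀ → HypSys.Constraint Q R w₀ →
        (∃ w : ℝ → 𝓢'(HypSys.Space n, HypSys.State m), HypSys.IsSolution A₀ A L w₀ w ∧
          ∀ w' : ℝ → 𝓢'(HypSys.Space n, HypSys.State m), HypSys.IsSolution A₀ A L w₀ w' →
            ∀ t : ℝ, 0 ≤ t → w' t = w t) ∧
        ∀ w : ℝ → 𝓢'(HypSys.Space n, HypSys.State m), HypSys.IsSolution A₀ A L w₀ w →
          ∀ t : ℝ, 0 < t → HypSys.Constraint Q R (w t)) ∧
    -- the decay estimate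
    (∀ p q r : ℝ≥0∞, 1 ≤ q → q ≤ 2 → 1 ≤ r → r ≤ 2 → 2 ≤ p → ∀ k ℓ : ℕ,
      ((n : ℝ) * ((r⁻¹).toReal - (p⁻¹).toReal) < (ℓ : ℝ) ∨ (p = 2 ∧ r = 2)) →
      ∃ C : ℝ, 0 < C ∧ ∀ l : ℕ, k + ℓ ≤ l →
        ∀ w₀ : 𝓢'(HypSys.Space n, HypSys.State m),
          HypSys.MemSobolevInter l r q w₀ → HypSys.Constraint Q R w₀ →
          ∀ w : ℝ → 𝓢'(HypSys.Space n, HypSys.State m), HypSys.IsSolution A₀ A L w₀ w →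
            ∀ t : ℝ, 0 ≤ t →
              HypSys.derivNorm k p (w t) ≤
                ENNReal.ofReal (C * (1 + t) ^ (-HypSys.gammaExp n 2 q p - (k : ℝ) / 2)) *
                    HypSys.lpNorm q w₀ +
                  ENNReal.ofReal (C * (1 + t) ^ (-(ℓ : ℝ) / 2 + HypSys.gammaExp n 2 r p)) *
                    HypSys.derivNorm (k + ℓ) r w₀) := by
  refine ⟨fun q r hq1 hq2 _ _ _ w₀ hw₀ hcon => ?_, fun p q r hq1 hq2 hr1 hr2 hp k ℓ hℓ => ?_⟩
  · obtain ⟨_, _, hspec⟩ := HypSys.exists_hasSpectrum_eLpNorm_le n m hq1 hq2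
    obtain ⟨h, hh, hmem, -⟩ := hspec w₀ hw₀.lebesgue
    obtain ⟨w, hw, hprop⟩ := HypSys.exists_isSolution hn hA hC hS hS₁ hK
      (HypSys.one_le_inv_one_sub_inv q) hh hmem hcon
    refine ⟨⟨w, hw, fun w' hw' t ht => hw'.unique hA hw ht⟩, fun w' hw' t ht => ?_⟩
    rw [hw'.unique hA hw ht.le]
    exact hh.constraint_propagator hn hC hcon (hprop t ht.le)
  · obtain ⟨C, hC0, hdecay⟩ :=
      HypSys.exists_derivNorm_le hn hA hC hS hS₁ hK hq1 hq2 hr1 hr2 hp k ℓ hℓ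
    refine ⟨C, hC0, fun l hl w₀ hw₀ hcon w hw t ht => ?_⟩
    obtain ⟨_, _, hspec⟩ := HypSys.exists_hasSpectrum_eLpNorm_le n m hq1 hq2
    obtain ⟨h, hh, hmem, -⟩ := hspec w₀ hw₀.lebesgue
    obtain ⟨w', hw', hprop⟩ := HypSys.exists_isSolution hn hA hC hS hS₁ hK
      (HypSys.one_le_inv_one_sub_inv q) hh hmem hcon
    -- By uniqueness the given solution is the one with spectrum `propagator A₀ A L t ξ (h ξ)`, to
    -- which the estimate applies.
    rw [hw.unique hA hw' ht]
    exact hdecay w₀ (w' t) h t ht hw₀.lebesgue (hw₀.sobolev _ hl) hcon hh (hprop t ht)
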